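/- Let $R$ be a commutative noetherian ring, $n\ge 0$, and let $\emptyset = Y_{-1}\subseteq Y_0\subseteq Y_1\subseteq\cdots$ be subsets of $\operatorname{Spec} R$ that are generalization closed (if $\mathfrak q\in Y_i$ and $\mathfrak p\subseteq\mathfrak q$ is prime, then $\mathfrak p\in Y_i$), such that $\bigcup_i Y_i=\operatorname{Spec}R$, $\operatorname{Ass}(\mho^i R)\subseteq Y_i$ for all $i\ge 0$, and $Y_{n-1}\subsetneq Y_n=\operatorname{Spec} R$. Here $\mho^i M$ is the $i$-th cosyzygy in the minimal injective coresolution of a module $M$ (so $\mho^0M=M$). Let $\mathcal C(Y_0,\dots,Y_{n-1})$ be the class of all $R$-modules whose minimal injective coresolution has, for each $i\ge 0$, as its $i$-th term a direct sum of copies of injective hulls $E(R/\mathfrak p)$ with $\mathfrak p\in Y_i$. Let $\mathcal I(Y)$ be the class of direct summands of direct sums of copies of $\bigoplus_{\mathfrak p\in Y}E(R/\mathfrak p)$. An $\mathcal I(Y)$-cover of $M$ is a homomorphism $f\colon E\to M$ with $E\in\mathcal I(Y)$ through which every homomorphism $E'\to M$ with $E'\in\mathcal I(Y)$ factors, and such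 that every endomorphism $g$ of $E$ with $fg=f$ is an automorphism. A module $C$ is cotilting if it has finite injective dimension, $\operatorname{Ext}^i_R(C^\kappa,C)=0$ for all $i\ge 1$ and all cardinals $\kappa$, and there are $r<\omega$ and an exact sequence $0\to C_r\to\cdots\to C_0\to W\to 0$ in which $W$ is an injective cogenerator and each $C_k$ is a direct summand of a direct product of copies of $C$; it is $n$-cotilting if moreover its injective dimension is at most $n$. It induces the class ${}^\perp C=\{M:\operatorname{Ext}^i_R(M,C)=0\text{ for all }i\ge1\}$. A cotilting module $C$ is minimal if it is isomorphic to a direct summand of every cotilting module $D$ with ${}^\perp D={}^\perp C$. For $0\le j\le n$ let $\mathcal S_j$ be the set of primes that are maximal with respect to inclusion in $Y_j\setminus Y_{j-1}$. Then for each $j$ there is an exact sequence $$0\to C_{\mathcal S_j}\to E_0\xrightarrow{\varphi_0}E_1\to\cdots\to E_{j-1}\xrightarrow{\varphi_{j-1}}\bigoplus_{\mathfrak p\in\mathcal S_j}E(R/\mathfrak p)\to0$$ in which $\varphi_{j-1}$ is an $\mathcal I(Y_{j-1})$-cover and, for each $\ell<j-1$, the map $E_\ell\to\operatorname{Ker}\varphi_{\ell+1}$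 induced by $\varphi_\ell$ is an $\mathcal I(Y_\ell)$-cover (for $j=0$ this means $C_{\mathcal S_0}\cong\bigoplus_{\mathfrak p\in\mathcal S_0}E(R/\mathfrak p)$). For any choice of such sequences, every module $$C\cong C_{\mathcal S_0}\oplus C_{\mathcal S_1}\oplus\cdots\oplus C_{\mathcal S_n}$$ is a minimal cotilting module, it is $n$-cotilting, and ${}^\perp C=\mathcal C(Y_0,\dots,Y_{n-1})$. Moreover, every minimal cotilting module $D$ with ${}^\perp D=\mathcal C(Y_0,\dots,Y_{n-1})$ is isomorphic to $C$. -/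

import Mathlib

universe u

open CategoryTheory

namespace MinCotilt

section Basic

variable {R : Type u} [CommRing R]

/-- `M` is isomorphic to a direct summand of `N`. -/
def IsSummand (M N : ModuleCat.{u} R) : Prop :=
  ∃ (i : M →ₗ[R] N) (r : N →ₗ[R] M), r ∘ₗ i = LinearMap.id

/-- A submodule is essential if it meets every nonzero submodule nontrivially. -/
def IsEssential {M : Type u} [AddCommGroup M] [Module R M] (N : Submodule R M) : Prop :=
  ∀ K : Submodule R M, K ⊓ N = ⊥ → K = ⊥

/-- `E` is an injective hull (injective envelope) of `N`. -/
def IsInjectiveHull (N E : ModuleCat.{u} R) : Prop :=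
  Module.Injective R E ∧
    ∃ f : N →ₗ[R] E, Function.Injective f ∧ IsEssential (LinearMap.range f)

/-- The direct sum of a family of modules. -/
noncomputable def dsum {ι : Type u} (E : ι → ModuleCat.{u} R) : ModuleCat.{u} R :=
  ModuleCat.of R (DirectSum ι fun i => E i)

/-- `M ≅ ⨁ i, E(R/p i)`. -/
def IsSumOfHulls {ι : Type u} (p : ι → PrimeSpectrum R) (M : ModuleCat.{u} R) : Prop :=
  ∃ E : ι → ModuleCat.{u} R,
    (∀ i, IsInjectiveHull (ModuleCat.of R (R ⧸ (p i).asIdeal)) (E i)) ∧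
      Nonempty (M ≃ₗ[R] dsum E)

/-- `Add X`: direct summands of direct sums of copies of `X`. -/
def InAdd (X M : ModuleCat.{u} R) : Prop :=
  ∃ κ : Type u, IsSummand M (dsum fun _ : κ => X)

/-- `Prod X`: direct summands of direct products of copies of `X`. -/
def InProd (X M : ModuleCat.{u} R) : Prop :=
  ∃ κ : Type u, IsSummand M (ModuleCat.of R (κ → X))

/-- `𝓘(Y) = Add (⨁ p ∈ Y, E(R/p))`. -/
def InjClass (Y : Set (PrimeSpectrum R)) : ObjectProperty (ModuleCat.{u} R) := fun M =>
  ∃ X : ModuleCat.{u} R, IsSumOfHulls (fun p : Y => (p : PrimeSpectrum R)) X ∧ InAdd X M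

/-- `f : E → M` is a `𝒞`-precover of `M`. -/
def IsPrecover (𝒞 : ObjectProperty (ModuleCat.{u} R)) {E M : ModuleCat.{u} R}
    (f : E →ₗ[R] M) : Prop :=
  𝒞 E ∧ ∀ (E' : ModuleCat.{u} R), 𝒞 E' → ∀ f' : E' →ₗ[R] M,
    ∃ g : E' →ₗ[R] E, f' = f ∘ₗ g

/-- `f : E → M` is a `𝒞`-cover of `M`. -/
def IsCover (𝒞 : ObjectProperty (ModuleCat.{u} R)) {E M : ModuleCat.{u} R}
    (f : E →ₗ[R] M) : Prop :=
  IsPrecover 𝒞 f ∧ ∀ g : E →ₗ[R] E, f = f ∘ₗ g → Function.Bijective g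

/-! ### Minimal injective coresolutions and the classes `𝒞(Y₀, Y₁, …)` -/

/-- The `i`-th cosyzygy of an injective coresolution `0 → X → I⁰ → I¹ → ⋯`, that is, the kernel
of `Iⁱ → Iⁱ⁺¹` (which is a copy of `X` for `i = 0` and the image of `Iⁱ⁻¹ → Iⁱ` for `i > 0`). -/
noncomputable def cosyzygy {X : ModuleCat.{u} R} (I : InjectiveResolution X) (i : ℕ) :
    Submodule R (I.cocomplex.X i) :=
  LinearMap.ker (I.cocomplex.d i (i + 1)).hom

/-- An injective coresolution is minimal if each term is an injective hull of the corresponding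
cosyzygy. -/
def IsMinimalResolution {X : ModuleCat.{u} R} (I : InjectiveResolution X) : Prop :=
  ∀ i, IsEssential (cosyzygy I i)

/-- `𝒞(𝒴)`: the modules whose minimal injective coresolution has as its `i`-th term a direct sum
of copies of the modules `E(R/p)`, `p ∈ Yᵢ`. -/
def CotiltClass (Y : ℕ → Set (PrimeSpectrum R)) : ObjectProperty (ModuleCat.{u} R) := fun X =>
  ∃ I : InjectiveResolution X, IsMinimalResolution I ∧
    ∀ i, ∃ (ι : Type u) (p : ι → PrimeSpectrum R),
      (∀ k, p k ∈ Y i) ∧ IsSumOfHulls p (I.cocomplex.X i)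

/-- The predecessor `Y_{j-1}` in the sequence, with `Y_{-1} = ∅`. -/
def prev (Y : ℕ → Set (PrimeSpectrum R)) : ℕ → Set (PrimeSpectrum R)
  | 0 => ∅
  | j + 1 => Y j

/-- Increasing sequences `∅ = Y_{-1} ⊆ Y₀ ⊆ Y₁ ⊆ ⋯` of generalization closed subsets of `Spec R`
with union `Spec R`, with `Ass (℧ⁱ R) ⊆ Yᵢ` for all `i`, and with `Y_{n-1} ⊊ Y_n = Spec R`. -/
structure IsCotiltSequence (n : ℕ) (Y : ℕ → Set (PrimeSpectrum R)) : Prop where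
  mono : Monotone Y
  generalization : ∀ i, IsLowerSet (Y i)
  union : ⋃ i, Y i = Set.univ
  ass : ∀ I : InjectiveResolution (ModuleCat.of R R), IsMinimalResolution I →
    ∀ (i : ℕ) (p : PrimeSpectrum R), p.asIdeal ∈ associatedPrimes R (cosyzygy I i) → p ∈ Y i
  strict : prev Y n ⊂ Y n
  top : Y n = Set.univ

/-! ### Cotilting modules -/

/-- `^⊥ C`. -/
def LeftPerp (C : ModuleCat.{u} R) : ObjectProperty (ModuleCat.{u} R) := fun M =>
  ∀ i : ℕ, 1 ≤ i → Subsingleton (Abelian.Ext M C i)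

/-- There is an exact sequence `0 → C_r → ⋯ → C₀ → W → 0` with all `C_k` in `Prod C`. -/
def HasProdResolution (C : ModuleCat.{u} R) : ℕ → ModuleCat.{u} R → Prop
  | 0, W => InProd C W
  | r + 1, W => ∃ (C₀ : ModuleCat.{u} R) (f : C₀ →ₗ[R] W), InProd C C₀ ∧
      Function.Surjective f ∧ HasProdResolution C r (ModuleCat.of R (LinearMap.ker f))

/-- Cotilting modules. -/
structure IsCotilting (C : ModuleCat.{u} R) : Prop where
  finite_injDim : ∃ m : ℕ, HasInjectiveDimensionLE C m
  ext_eq_zero : ∀ κ : Type u, LeftPerp C (ModuleCat.of R (κ → C))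
  exists_resolution : ∃ (r : ℕ) (W : ModuleCat.{u} R),
    Module.Injective R W ∧ IsCoseparator W ∧ HasProdResolution C r W

/-- `n`-cotilting modules: cotilting modules of injective dimension at most `n`. -/
def IsNCotilting (n : ℕ) (C : ModuleCat.{u} R) : Prop :=
  IsCotilting C ∧ HasInjectiveDimensionLE C n

/-- Minimal cotilting modules: those that are isomorphic to a direct summand of each cotilting
module inducing the same cotilting class. -/
def IsMinimalCotilting (C : ModuleCat.{u} R) : Prop :=
  IsCotilting C ∧ ∀ D : ModuleCat.{u} R, IsCotilting D → LeftPerp D = LeftPerp C → IsSummand C D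

/-! ### The modules `C_S` -/

/-- `C` is the leftmost term of an exact sequence
`0 → C → E₀ → E₁ → ⋯ → E_{j-1} → K → 0` with kernels `K_ℓ = Ker (E_ℓ → E_{ℓ+1})`, in which
`E_{j-1} → K` is an `𝓘(Y_{j-1})`-cover and each `E_ℓ → K_{ℓ+1}` is an `𝓘(Y_ℓ)`-cover;
for `j = 0` this means `C ≅ K`. -/
def IsIteratedKernel (Y : ℕ → Set (PrimeSpectrum R)) :
    ℕ → ModuleCat.{u} R → ModuleCat.{u} R → Prop
  | 0, K, C => Nonempty (C ≃ₗ[R] K)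
  | j + 1, K, C => ∃ (E : ModuleCat.{u} R) (φ : E →ₗ[R] K), IsCover (InjClass (Y j)) φ ∧
      Function.Surjective φ ∧
      IsIteratedKernel Y j (ModuleCat.of R (LinearMap.ker φ)) C

/-- `C` is (a copy of) the module `C_S`, for `S ⊆ Y_j \ Y_{j-1}`: the iterated kernel that starts
with `⨁ p ∈ S, E(R/p)`. -/
def IsCoverModule (Y : ℕ → Set (PrimeSpectrum R)) (j : ℕ) (S : Set (PrimeSpectrum R))
    (C : ModuleCat.{u} R) : Prop :=
  ∃ K : ModuleCat.{u} R, IsSumOfHulls (fun p : S => (p : PrimeSpectrum R)) K ∧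
    IsIteratedKernel Y j K C

/-- `S_j`: the primes that are maximal with respect to inclusion in `Y_j \ Y_{j-1}`. -/
def maxPrimes (Y : ℕ → Set (PrimeSpectrum R)) (j : ℕ) : Set (PrimeSpectrum R) :=
  {p | Maximal (fun q => q ∈ Y j \ prev Y j) p}

end Basic

end MinCotilt

/-! Everything is phrased through cosyzygies: by Matlis' theorem a module lies in 𝒞(Y₀, Y₁, …)
exactly when, for every i, the associated primes of its i-th cosyzygy lie in Yᵢ (`CcA`,
`cotiltClass_iff`). In this form the class is closed under summands, extensions and products. It is
also closed under kernels of epimorphisms whose target lies in the class of the shifted sequence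
(`CcA.ker`).

The engine is a trade between shifts of Y and right orthogonality. If K is right orthogonal to the
class of the sequence shifted by l + 1, then the kernel of a surjective 𝓘(Y_l)-precover of K is
right orthogonal to the class shifted by l (`QPerp.ker`); cosyzygies go back (`QPerp.mho`).
Surjectivity of the precovers comes from R being in the class. Starting from the injective module ⨁
E(R/p), p ∈ S_j, the iterated kernels therefore exist, and they lie both in the class and in its
right orthogonal. Kernels of covers are reduced, that is, they contain no nonzero injective
submodule. So the covers form a minimal injective coresolution of C_{S_j}: its j-th cosyzygy is ⨁
E(R/p), the earlier ones are reduced and the later ones vanish (`IsIteratedKernel.mhoN`).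

Cotilting: Ext vanishing on powers follows from closure under products. A finite Prod C-resolution
of an injective cogenerator is built by induction along the Y_j (`res_of_injClass`), since every
prime of Y_j is in Y_{j-1} or below a prime of S_j. A module in ^⊥C embeds in a power of C with
cokernel again in ^⊥C, which puts ^⊥C inside the class (`IsCotilting.ccA`).

Minimality: let D be cotilting with the same class. Each C_{S_j} lies in Prod D, so maximality of
the primes in S_j forces every E(R/p), p ∈ S_j, into the j-th cosyzygy of D
(`IsCoverModule.hasHulls`). Going back through the covers splits C_{S_j} off D
(`IsIteratedKernel.isSummand`), and reducedness lets this be repeated on the complement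
(`isSummand_psum`). Uniqueness is a cancellation property: C ≅ C ⊕ X forces X = 0, because S_j is an
antichain (`subsingleton_of_psum_equiv`). -/

namespace MinCotilt

/-! ### Vanishing of `Ext` -/

section ExtVanishing

variable {R : Type u} [CommRing R]

/-- `Ext^i(M, X) = 0`. -/
def ExtZero (M X : ModuleCat.{u} R) (i : ℕ) : Prop := Subsingleton (Abelian.Ext M X i)

variable {A B C M X : ModuleCat.{u} R} {f : A →ₗ[R] B} {g : B →ₗ[R] C}

theorem extZero_iff {i : ℕ} : ExtZero M X i ↔ ∀ e : Abelian.Ext M X i, e = 0 :=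
  ⟨fun h _ => h.elim _ _, fun h => ⟨fun a b => (h a).trans (h b).symm⟩⟩

/-- The short complex attached to an exact pair of linear maps. -/
abbrev seqComplex (f : A →ₗ[R] B) (g : B →ₗ[R] C) (hfg : Function.Exact f g) :
    ShortComplex (ModuleCat.{u} R) :=
  ShortComplex.mk (ModuleCat.ofHom f) (ModuleCat.ofHom g) (by
    ext x; exact hfg.apply_apply_eq_zero x)

theorem seqComplex_shortExact (hf : Function.Injective f) (hfg : Function.Exact f g)
    (hg : Function.Surjective g) : (seqComplex f g hfg).ShortExact :=
  ModuleCat.shortComplex_shortExact _ hfg hf hg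

theorem ExtZero.right₃ (hf : Function.Injective f) (hfg : Function.Exact f g)
    (hg : Function.Surjective g) {i : ℕ} (hB : ExtZero M B i) (hA : ExtZero M A (i + 1)) :
    ExtZero M C i := by
  rw [extZero_iff] at *
  intro e
  obtain ⟨y, rfl⟩ := Abelian.Ext.covariant_sequence_exact₃ M (seqComplex_shortExact hf hfg hg) e
    rfl (hA _)
  rw [hB y, Abelian.Ext.zero_comp]

theorem ExtZero.right₁ (hf : Function.Injective f) (hfg : Function.Exact f g)
    (hg : Function.Surjective g) {i : ℕ} (hC : ExtZero M C i) (hB : ExtZero M B (i + 1)) :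
    ExtZero M A (i + 1) := by
  rw [extZero_iff] at *
  intro e
  obtain ⟨y, rfl⟩ := Abelian.Ext.covariant_sequence_exact₁ M (seqComplex_shortExact hf hfg hg) e
    (hB _) rfl
  rw [hC y, Abelian.Ext.zero_comp]

theorem ExtZero.left₃ (hf : Function.Injective f) (hfg : Function.Exact f g)
    (hg : Function.Surjective g) {i : ℕ} (hA : ExtZero A X i) (hB : ExtZero B X (i + 1)) :
    ExtZero C X (i + 1) := by
  rw [extZero_iff] at *
  intro e
  obtain ⟨y, rfl⟩ := Abelian.Ext.contravariant_sequence_exact₃ (seqComplex_shortExact hf hfg hg)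
    X e (hB _) (add_comm 1 i)
  rw [hA y, Abelian.Ext.comp_zero]

/-- If `Ext¹(M, A) = 0`, every map `M → C` lifts to `B`. -/
theorem ExtZero.exists_lift (hf : Function.Injective f) (hfg : Function.Exact f g)
    (hg : Function.Surjective g) (hA : ExtZero M A 1) (h : M →ₗ[R] C) :
    ∃ k : M →ₗ[R] B, g ∘ₗ k = h := by
  rw [extZero_iff] at hA
  obtain ⟨y, hy⟩ := Abelian.Ext.covariant_sequence_exact₃ M (seqComplex_shortExact hf hfg hg)
    (Abelian.Ext.mk₀ (ModuleCat.ofHom h)) (zero_add 1) (hA _)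
  obtain ⟨y, rfl⟩ := Abelian.Ext.homEquiv₀.symm.surjective y
  refine ⟨y.hom, ?_⟩
  have := Abelian.Ext.homEquiv₀.symm.injective (by simpa using hy :
    Abelian.Ext.homEquiv₀.symm (y ≫ ModuleCat.ofHom g) =
      Abelian.Ext.homEquiv₀.symm (ModuleCat.ofHom h))
  exact congrArg ModuleCat.Hom.hom this

/-- If `Ext¹(C, X) = 0`, every map `A → X` extends to `B`. -/
theorem ExtZero.exists_extend (hf : Function.Injective f) (hfg : Function.Exact f g)
    (hg : Function.Surjective g) (hC : ExtZero C X 1) (h : A →ₗ[R] X) :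
    ∃ k : B →ₗ[R] X, k ∘ₗ f = h := by
  rw [extZero_iff] at hC
  obtain ⟨y, hy⟩ := Abelian.Ext.contravariant_sequence_exact₁ (seqComplex_shortExact hf hfg hg)
    X (Abelian.Ext.mk₀ (ModuleCat.ofHom h)) (add_zero 1) (hC _)
  obtain ⟨y, rfl⟩ := Abelian.Ext.homEquiv₀.symm.surjective y
  refine ⟨y.hom, ?_⟩
  have := Abelian.Ext.homEquiv₀.symm.injective (by simpa using hy :
    Abelian.Ext.homEquiv₀.symm (ModuleCat.ofHom f ≫ y) =
      Abelian.Ext.homEquiv₀.symm (ModuleCat.ofHom h))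
  exact congrArg ModuleCat.Hom.hom this

/-- A class in Ext¹(M, A) is the connecting image of some map M → C; once that map factors through
B, its connecting image vanishes. -/
theorem ExtZero.of_lift (hf : Function.Injective f) (hfg : Function.Exact f g)
    (hg : Function.Surjective g) (hB : ExtZero M B 1)
    (H : ∀ h : M →ₗ[R] C, ∃ k : M →ₗ[R] B, g ∘ₗ k = h) : ExtZero M A 1 := by
  rw [extZero_iff] at *
  intro e
  obtain ⟨y, rfl⟩ := Abelian.Ext.covariant_sequence_exact₁ M (seqComplex_shortExact hf hfg hg) e
    (hB _) (zero_add 1)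
  obtain ⟨y, rfl⟩ := Abelian.Ext.homEquiv₀.symm.surjective y
  obtain ⟨k, hk⟩ := H y.hom
  have hy : y = ModuleCat.ofHom k ≫ (seqComplex f g hfg).g := by
    ext x; exact (LinearMap.congr_fun hk x).symm
  rw [hy, Abelian.Ext.homEquiv₀_symm_apply, ← Abelian.Ext.mk₀_comp_mk₀,
    Abelian.Ext.comp_assoc_of_second_deg_zero,
    (seqComplex_shortExact hf hfg hg).comp_extClass, Abelian.Ext.comp_zero]

theorem ExtZero.of_extend (hf : Function.Injective f) (hfg : Function.Exact f g)
    (hg : Function.Surjective g) (hB : ExtZero B X 1)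
    (H : ∀ h : A →ₗ[R] X, ∃ k : B →ₗ[R] X, k ∘ₗ f = h) : ExtZero C X 1 := by
  rw [extZero_iff] at *
  intro e
  obtain ⟨y, rfl⟩ := Abelian.Ext.contravariant_sequence_exact₃ (seqComplex_shortExact hf hfg hg)
    X e (hB _) (add_zero 1)
  obtain ⟨y, rfl⟩ := Abelian.Ext.homEquiv₀.symm.surjective y
  obtain ⟨k, hk⟩ := H y.hom
  have hy : y = (seqComplex f g hfg).f ≫ ModuleCat.ofHom k := by
    ext x; exact (LinearMap.congr_fun hk x).symm
  rw [hy, Abelian.Ext.homEquiv₀_symm_apply, ← Abelian.Ext.mk₀_comp_mk₀,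
    ← Abelian.Ext.comp_assoc_of_second_deg_zero,
    (seqComplex_shortExact hf hfg hg).extClass_comp, Abelian.Ext.zero_comp]

theorem extZero_of_injective (hX : Module.Injective R X) (i : ℕ) : ExtZero M X (i + 1) := by
  have : Injective X := (Module.injective_iff_injective_object R X).1 hX
  exact extZero_iff.2 fun e => e.eq_zero_of_injective

theorem extZero_of_projective (hM : Module.Projective R M) (i : ℕ) : ExtZero M X (i + 1) := by
  have : Projective M := (IsProjective.iff_projective (R := R) M).1 hM
  exact extZero_iff.2 fun e => e.eq_zero_of_projective

theorem ExtZero.of_isSummand_right {X' : ModuleCat.{u} R} {i : ℕ} (h : IsSummand X X')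
    (hX : ExtZero M X' i) : ExtZero M X i := by
  rw [extZero_iff] at *
  intro e
  obtain ⟨a, b, hab⟩ := h
  have : ModuleCat.ofHom a ≫ ModuleCat.ofHom b = 𝟙 X := by
    ext x; exact LinearMap.congr_fun hab x
  rw [← e.comp_mk₀_id, ← this, ← Abelian.Ext.mk₀_comp_mk₀,
    ← Abelian.Ext.comp_assoc_of_second_deg_zero, hX (e.comp _ _), Abelian.Ext.zero_comp]

theorem ExtZero.of_isSummand_left {M' : ModuleCat.{u} R} {i : ℕ} (h : IsSummand M M')
    (hX : ExtZero M' X i) : ExtZero M X i := by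
  rw [extZero_iff] at *
  intro e
  obtain ⟨a, b, hab⟩ := h
  have : ModuleCat.ofHom a ≫ ModuleCat.ofHom b = 𝟙 M := by
    ext x; exact LinearMap.congr_fun hab x
  rw [← e.mk₀_id_comp, ← this, ← Abelian.Ext.mk₀_comp_mk₀,
    Abelian.Ext.comp_assoc_of_second_deg_zero, hX (Abelian.Ext.comp _ e _), Abelian.Ext.comp_zero]

/-- Every module embeds in an injective module. -/
theorem exists_injective_embedding (X : ModuleCat.{u} R) :
    ∃ (I : ModuleCat.{u} R) (f : X →ₗ[R] I), Module.Injective R I ∧ Function.Injective f := by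
  refine ⟨Injective.under X, (Injective.ι X).hom, ?_, ?_⟩
  · exact (Module.injective_iff_injective_object R _).2
      (inferInstanceAs (Injective (Injective.under X)))
  · exact (ModuleCat.mono_iff_injective _).1 inferInstance

/-- The product of a family of linear maps. -/
def piMap {ι : Type u} {X X' : ι → ModuleCat.{u} R} (a : ∀ k, X k →ₗ[R] X' k) :
    (∀ k, X k) →ₗ[R] (∀ k, X' k) :=
  LinearMap.pi fun k => a k ∘ₗ LinearMap.proj k

section PiMap

variable {ι : Type u} {X X' X'' : ι → ModuleCat.{u} R} {a : ∀ k, X k →ₗ[R] X' k}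
  {b : ∀ k, X' k →ₗ[R] X'' k}

theorem piMap_injective (ha : ∀ k, Function.Injective (a k)) : Function.Injective (piMap a) :=
  fun _ _ hxy => funext fun k => ha k (congrFun hxy k)

theorem piMap_surjective (ha : ∀ k, Function.Surjective (a k)) :
    Function.Surjective (piMap a) := fun y => by
  choose x hx using fun k => ha k (y k)
  exact ⟨x, funext hx⟩

theorem piMap_exact (hab : ∀ k, Function.Exact (a k) (b k)) :
    Function.Exact (piMap a) (piMap b) := by
  intro y
  constructor
  · intro hy
    choose x hx using fun k => (hab k (y k)).1 (congrFun hy k)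
    exact ⟨x, funext hx⟩
  · rintro ⟨x, rfl⟩
    exact funext fun k => (hab k).apply_apply_eq_zero (x k)

end PiMap

/-- `Ext` in the second variable vanishes on products. -/
theorem extZero_pi {ι : Type u} (i : ℕ) (X : ι → ModuleCat.{u} R)
    (h : ∀ k, ExtZero M (X k) (i + 1)) :
    ExtZero M (ModuleCat.of R (∀ k, X k)) (i + 1) := by
  -- Embed every factor in an injective module. In degree one the lifts are chosen coordinatewise;
  -- higher degrees shift down to the product of the quotients.
  induction i generalizing X with
  | zero =>
    choose I a hI ha using fun k => exists_injective_embedding (X k)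
    let Q : ι → ModuleCat.{u} R := fun k => ModuleCat.of R (I k ⧸ LinearMap.range (a k))
    let b : ∀ k, I k →ₗ[R] Q k := fun k => (LinearMap.range (a k)).mkQ
    have hb : ∀ k, Function.Surjective (b k) := fun k => Submodule.mkQ_surjective _
    have hab : ∀ k, Function.Exact (a k) (b k) := fun k => LinearMap.exact_map_mkQ_range _
    refine ExtZero.of_lift (A := ModuleCat.of R (∀ k, X k)) (B := ModuleCat.of R (∀ k, I k))
      (C := ModuleCat.of R (∀ k, Q k)) (piMap_injective ha) (piMap_exact hab)
      (piMap_surjective hb)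
      (extZero_of_injective (inferInstanceAs (Module.Injective R (∀ k, I k))) 0) fun h' => ?_
    choose l hl using fun k => ExtZero.exists_lift (ha k) (hab k) (hb k) (h k)
      ((LinearMap.proj k : (∀ k, Q k) →ₗ[R] Q k) ∘ₗ h')
    exact ⟨LinearMap.pi l, LinearMap.ext fun x => funext fun k => LinearMap.congr_fun (hl k) x⟩
  | succ i ih =>
    choose I a hI ha using fun k => exists_injective_embedding (X k)
    let Q : ι → ModuleCat.{u} R := fun k => ModuleCat.of R (I k ⧸ LinearMap.range (a k))
    let b : ∀ k, I k →ₗ[R] Q k := fun k => (LinearMap.range (a k)).mkQ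
    have hb : ∀ k, Function.Surjective (b k) := fun k => Submodule.mkQ_surjective _
    have hab : ∀ k, Function.Exact (a k) (b k) := fun k => LinearMap.exact_map_mkQ_range _
    exact ExtZero.right₁ (A := ModuleCat.of R (∀ k, X k)) (B := ModuleCat.of R (∀ k, I k))
      (C := ModuleCat.of R (∀ k, Q k)) (piMap_injective ha) (piMap_exact hab)
      (piMap_surjective hb)
      (ih Q fun k => ExtZero.right₃ (ha k) (hab k) (hb k) (extZero_of_injective (hI k) _) (h k))
      (extZero_of_injective (inferInstanceAs (Module.Injective R (∀ k, I k))) _)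

/-! ### The class `^⊥ C` -/

theorem LeftPerp.extZero (h : LeftPerp X M) (i : ℕ) : ExtZero M X (i + 1) :=
  h (i + 1) (Nat.le_add_left 1 i)

theorem leftPerp_of_extZero (h : ∀ i, ExtZero M X (i + 1)) : LeftPerp X M := by
  intro i hi
  obtain ⟨i, rfl⟩ := Nat.exists_eq_add_of_le' hi
  exact h i

theorem leftPerp_of_injective (hX : Module.Injective R X) : LeftPerp X M :=
  leftPerp_of_extZero fun i => extZero_of_injective hX i

theorem LeftPerp.of_isSummand_right {X' : ModuleCat.{u} R} (h : IsSummand X X')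
    (hX : LeftPerp X' M) : LeftPerp X M :=
  leftPerp_of_extZero fun i => (hX.extZero i).of_isSummand_right h

theorem LeftPerp.of_isSummand_left {M' : ModuleCat.{u} R} (h : IsSummand M M')
    (hX : LeftPerp X M') : LeftPerp X M :=
  leftPerp_of_extZero fun i => (hX.extZero i).of_isSummand_left h

theorem leftPerp_pi {ι : Type u} {X : ι → ModuleCat.{u} R} (h : ∀ k, LeftPerp (X k) M) :
    LeftPerp (ModuleCat.of R (∀ k, X k)) M :=
  leftPerp_of_extZero fun i => extZero_pi i X fun k => (h k).extZero i

theorem LeftPerp.of_inProd (hX : LeftPerp X M) {X' : ModuleCat.{u} R} (h : InProd X X') :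
    LeftPerp X' M := by
  obtain ⟨κ, h⟩ := h
  exact (leftPerp_pi fun _ : κ => hX).of_isSummand_right h

theorem LeftPerp.right₃ (hf : Function.Injective f) (hfg : Function.Exact f g)
    (hg : Function.Surjective g) (hB : LeftPerp B M) (hA : LeftPerp A M) : LeftPerp C M :=
  leftPerp_of_extZero fun i => ExtZero.right₃ hf hfg hg (hB.extZero i) (hA.extZero _)

end ExtVanishing

/-! ### Essential submodules and injective hulls -/

section Essential

variable {R : Type u} [CommRing R]

section Unbundled

variable {M N P : Type u} [AddCommGroup M] [Module R M] [AddCommGroup N] [Module R N]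
  [AddCommGroup P] [Module R P]

theorem isEssential_iff {S : Submodule R M} :
    IsEssential S ↔ ∀ x : M, x ≠ 0 → ∃ r : R, r • x ∈ S ∧ r • x ≠ 0 := by
  constructor
  · intro h x hx
    by_contra! H
    refine hx ?_
    have : Submodule.span R {x} = ⊥ := h _ (by
      rw [eq_bot_iff]
      rintro y ⟨hy, hyS⟩
      obtain ⟨r, rfl⟩ := Submodule.mem_span_singleton.1 hy
      exact H r hyS)
    simpa using this
  · intro h K hK
    rw [eq_bot_iff]
    intro x hx
    by_contra hx0
    obtain ⟨r, hrS, hr0⟩ := h x hx0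
    exact hr0 ((Submodule.mem_bot R).1 (hK ▸ ⟨K.smul_mem r hx, hrS⟩))

/-- The kernel of `g` meets the essential image of `f` trivially. -/
theorem injective_of_comp_essential {f : M →ₗ[R] N} (hf : IsEssential (LinearMap.range f))
    {g : N →ₗ[R] P} (hgf : Function.Injective (g ∘ₗ f)) : Function.Injective g := by
  rw [injective_iff_map_eq_zero]
  intro x hx
  by_contra hx0
  obtain ⟨r, ⟨y, hy⟩, hr0⟩ := isEssential_iff.1 hf x hx0
  refine hr0 ?_
  have : y = 0 := hgf (by simp [hy, hx])
  rw [← hy, this, map_zero]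

/-- A retraction of `f` exists by injectivity of `M`, and it is itself injective because `f` has
essential range. -/
theorem surjective_of_essential_range {f : M →ₗ[R] N} (hf : IsEssential (LinearMap.range f))
    (hM : Module.Injective R M) (hinj : Function.Injective f) : Function.Surjective f := by
  obtain ⟨r, hr⟩ := hM.out f hinj LinearMap.id
  have : Function.Injective r := injective_of_comp_essential hf (by
    have : r ∘ₗ f = LinearMap.id := LinearMap.ext hr
    rw [this]; exact Function.injective_id)
  intro y
  exact ⟨r y, this (hr (r y))⟩

theorem injective_of_leftInverse {f : M →ₗ[R] N} {g : N →ₗ[R] M} (h : g ∘ₗ f = LinearMap.id)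
    (hN : Module.Injective R N) : Module.Injective R M where
  out X Y _ _ _ _ i hi k := by
    obtain ⟨l, hl⟩ := hN.out i hi (f ∘ₗ k)
    refine ⟨g ∘ₗ l, fun x => ?_⟩
    simp only [LinearMap.comp_apply, hl]
    exact LinearMap.congr_fun h (k x)

theorem injective_of_linearEquiv (e : M ≃ₗ[R] N) (hN : Module.Injective R N) :
    Module.Injective R M :=
  injective_of_leftInverse (f := e.toLinearMap) (g := e.symm.toLinearMap) (by ext; simp) hN

theorem injective_of_subsingleton [Subsingleton M] : Module.Injective R M where
  out _ _ _ _ _ _ _ _ _ := ⟨0, fun _ => Subsingleton.elim _ _⟩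

theorem injective_prod (hM : Module.Injective R M) (hN : Module.Injective R N) :
    Module.Injective R (M × N) where
  out X Y _ _ _ _ i hi k := by
    obtain ⟨a, ha⟩ := hM.out i hi (LinearMap.fst R M N ∘ₗ k)
    obtain ⟨b, hb⟩ := hN.out i hi (LinearMap.snd R M N ∘ₗ k)
    exact ⟨a.prod b, fun x => Prod.ext (ha x) (hb x)⟩

/-- A maximal essential extension inside an injective module is injective. -/
theorem exists_injective_essential {E : Type u} [AddCommGroup E] [Module R E]
    (hE : Module.Injective R E) (S : Submodule R E) :
    ∃ T : Submodule R E, S ≤ T ∧ Module.Injective R T ∧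
      ∀ x ∈ T, x ≠ 0 → ∃ r : R, r • x ∈ S ∧ r • x ≠ 0 := by
  obtain ⟨T, hST, hT⟩ := zorn_le_nonempty₀
    {T : Submodule R E | S ≤ T ∧ ∀ x ∈ T, x ≠ 0 → ∃ r : R, r • x ∈ S ∧ r • x ≠ 0}
    (fun c hc hchain T₀ hT₀ => by
      refine ⟨sSup c, ⟨(hc hT₀).1.trans (le_sSup hT₀), fun x hx hx0 => ?_⟩, fun z hz => le_sSup hz⟩
      obtain ⟨T, hT, hxT⟩ := (Submodule.mem_sSup_of_directed ⟨T₀, hT₀⟩ hchain.directedOn).1 hx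
      exact (hc hT).2 x hxT hx0)
    S ⟨le_rfl, fun x hx hx0 => ⟨1, by simpa, by simpa⟩⟩
  have hTmem := hT.prop
  refine ⟨T, hST, ?_, hTmem.2⟩
  -- With `K` maximal among the submodules meeting `T` trivially, `T` becomes essential in `E ⧸ K`.
  -- The inclusion of `T` then extends to an embedding of `E ⧸ K` into `E`.
  obtain ⟨K, -, hK⟩ := zorn_le_nonempty₀ {K : Submodule R E | K ⊓ T = ⊥}
    (fun c hc hchain K₀ hK₀ => by
      refine ⟨sSup c, ?_, fun z hz => le_sSup hz⟩
      rw [Set.mem_ofPred_eq, eq_bot_iff]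
      rintro x ⟨hx, hxT⟩
      obtain ⟨K, hK, hxK⟩ := (Submodule.mem_sSup_of_directed ⟨K₀, hK₀⟩ hchain.directedOn).1 hx
      exact (hc hK).le ⟨hxK, hxT⟩)
    ⊥ (bot_inf_eq T)
  let j : T →ₗ[R] E ⧸ K := K.mkQ ∘ₗ T.subtype
  have hj : Function.Injective j := by
    rw [injective_iff_map_eq_zero]
    intro x hx
    have : (x : E) ∈ K := (Submodule.Quotient.mk_eq_zero _).1 hx
    have : (x : E) ∈ K ⊓ T := ⟨this, x.2⟩
    rw [hK.prop] at this
    exact Subtype.ext ((Submodule.mem_bot R).1 this)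
  have hjess : IsEssential (LinearMap.range j) := by
    intro L hL
    have h1 : L.comap K.mkQ ⊓ T = ⊥ := by
      rw [eq_bot_iff]
      rintro x ⟨hxL, hxT⟩
      have : j ⟨x, hxT⟩ ∈ L ⊓ LinearMap.range j := ⟨hxL, ⟨_, rfl⟩⟩
      rw [hL] at this
      have := hj (((Submodule.mem_bot R).1 this).trans (map_zero j).symm)
      simpa using congrArg Subtype.val this
    have h2 : L.comap K.mkQ ≤ K := hK.le_of_ge h1 (by
      intro x hx
      have : K.mkQ x = 0 := (Submodule.Quotient.mk_eq_zero _).2 hx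
      simp [this])
    rw [eq_bot_iff]
    intro y hy
    obtain ⟨x, rfl⟩ := K.mkQ_surjective y
    exact (Submodule.mem_bot R).2 ((Submodule.Quotient.mk_eq_zero _).2 (h2 hy))
  obtain ⟨g, hg⟩ := hE.out j hj T.subtype
  have hginj : Function.Injective g := injective_of_comp_essential hjess (by
    have : g ∘ₗ j = T.subtype := LinearMap.ext hg
    rw [this]; exact T.subtype_injective)
  have hTg : T ≤ LinearMap.range g := fun x hx => ⟨j ⟨x, hx⟩, hg _⟩
  -- The image of `g` is still essential over `S`, so maximality of `T` leaves no room for it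
  -- outside `T`; thus `g` yields a retraction of `E` onto `T`.
  have hgT : LinearMap.range g ≤ T := hT.le_of_ge ⟨hST.trans hTg, by
    rintro _ ⟨y, rfl⟩ hy0
    have hy : y ≠ 0 := fun h => hy0 (by rw [h, map_zero])
    obtain ⟨r, ⟨t, ht⟩, hr0⟩ := isEssential_iff.1 hjess y hy
    have ht0 : (t : E) ≠ 0 := fun h => hr0 (by
      rw [← ht, (Subtype.ext h : t = 0), map_zero])
    obtain ⟨s, hsS, hs0⟩ := hTmem.2 t t.2 ht0
    have : (s * r) • g y = s • (t : E) := by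
      rw [mul_smul, ← map_smul, ← ht, hg]; rfl
    exact ⟨s * r, by rwa [this], by rwa [this]⟩⟩ hTg
  refine injective_of_leftInverse (f := T.subtype)
    (g := (g ∘ₗ K.mkQ).codRestrict T fun x => hgT ⟨_, rfl⟩) ?_ hE
  ext x
  exact hg x

end Unbundled

/-! ### Injective hulls, direct summands and cosyzygies -/

variable {X N G Z : ModuleCat.{u} R}

theorem exists_isInjectiveHull (X : ModuleCat.{u} R) : ∃ E, IsInjectiveHull X E := by
  obtain ⟨I, f, hI, hf⟩ := exists_injective_embedding X
  obtain ⟨T, hST, hT, hess⟩ := exists_injective_essential hI (LinearMap.range f)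
  refine ⟨ModuleCat.of R T, hT, f.codRestrict T fun x => hST ⟨x, rfl⟩, ?_, ?_⟩
  · intro x y h
    exact hf (congrArg Subtype.val h)
  · rw [isEssential_iff]
    rintro ⟨x, hx⟩ hx0
    obtain ⟨r, ⟨y, hy⟩, hr0⟩ := hess x hx (fun h => hx0 (Subtype.ext h))
    exact ⟨r, ⟨y, Subtype.ext hy⟩, fun h => hr0 (congrArg Subtype.val h)⟩

/-- A chosen injective hull. -/
noncomputable def hull (X : ModuleCat.{u} R) : ModuleCat.{u} R := (exists_isInjectiveHull X).choose

theorem hull_injective (X : ModuleCat.{u} R) : Module.Injective R (hull X) :=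
  (exists_isInjectiveHull X).choose_spec.1

/-- The inclusion in the injective hull. -/
noncomputable def hullι (X : ModuleCat.{u} R) : X →ₗ[R] hull X :=
  (exists_isInjectiveHull X).choose_spec.2.choose

theorem hullι_injective (X : ModuleCat.{u} R) : Function.Injective (hullι X) :=
  (exists_isInjectiveHull X).choose_spec.2.choose_spec.1

theorem hullι_essential (X : ModuleCat.{u} R) : IsEssential (LinearMap.range (hullι X)) :=
  (exists_isInjectiveHull X).choose_spec.2.choose_spec.2

theorem isInjectiveHull_hull (X : ModuleCat.{u} R) : IsInjectiveHull X (hull X) :=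
  (exists_isInjectiveHull X).choose_spec

/-- The first cosyzygy of `X`. -/
noncomputable def mho (X : ModuleCat.{u} R) : ModuleCat.{u} R :=
  ModuleCat.of R (hull X ⧸ LinearMap.range (hullι X))

/-- The projection onto the first cosyzygy. -/
noncomputable def mhoπ (X : ModuleCat.{u} R) : hull X →ₗ[R] mho X :=
  (LinearMap.range (hullι X)).mkQ

theorem mhoπ_surjective (X : ModuleCat.{u} R) : Function.Surjective (mhoπ X) :=
  Submodule.mkQ_surjective _

theorem hullι_mhoπ_exact (X : ModuleCat.{u} R) : Function.Exact (hullι X) (mhoπ X) :=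
  LinearMap.exact_map_mkQ_range _

/-- A map of short exact sequences induced on cokernels. -/
theorem exists_map_coker {A B C A' B' C' : ModuleCat.{u} R} {f : A →ₗ[R] B} {g : B →ₗ[R] C}
    (hfg : Function.Exact f g) (hg : Function.Surjective g) {f' : A' →ₗ[R] B'} {g' : B' →ₗ[R] C'}
    (hfg' : Function.Exact f' g') (a : A →ₗ[R] A') (b : B →ₗ[R] B') (hab : b ∘ₗ f = f' ∘ₗ a) :
    ∃ c : C →ₗ[R] C', c ∘ₗ g = g' ∘ₗ b := by
  have hker : LinearMap.ker g ≤ LinearMap.ker (g' ∘ₗ b) := by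
    intro x hx
    obtain ⟨y, rfl⟩ := (hfg x).1 hx
    have := LinearMap.congr_fun hab y
    simp only [LinearMap.comp_apply] at this
    simp [this, hfg'.apply_apply_eq_zero]
  refine ⟨(LinearMap.ker g).liftQ (g' ∘ₗ b) hker ∘ₗ
    (g.quotKerEquivOfSurjective hg).symm.toLinearMap, ?_⟩
  ext x
  have : (g.quotKerEquivOfSurjective hg).symm (g x) = (LinearMap.ker g).mkQ x := by
    rw [LinearEquiv.symm_apply_eq]; rfl
  simp [this]

theorem IsSummand.refl (X : ModuleCat.{u} R) : IsSummand X X := ⟨.id, .id, rfl⟩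

theorem IsSummand.trans (h : IsSummand X N) (h' : IsSummand N G) : IsSummand X G := by
  obtain ⟨i, r, h⟩ := h
  obtain ⟨i', r', h'⟩ := h'
  refine ⟨i' ∘ₗ i, r ∘ₗ r', ?_⟩
  rw [LinearMap.comp_assoc, ← LinearMap.comp_assoc i i' r', h', LinearMap.id_comp, h]

theorem isSummand_of_equiv (e : X ≃ₗ[R] N) : IsSummand X N :=
  ⟨e.toLinearMap, e.symm.toLinearMap, by ext; simp⟩

/-- An automorphism `r ∘ₗ i` can be corrected to the identity by composing `r` with its inverse. -/
theorem isSummand_of_bijective (i : X →ₗ[R] N) (r : N →ₗ[R] X)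
    (h : Function.Bijective (r ∘ₗ i)) : IsSummand X N := by
  let e := LinearEquiv.ofBijective (r ∘ₗ i) h
  refine ⟨i, e.symm.toLinearMap ∘ₗ r, ?_⟩
  ext x
  exact e.symm_apply_apply x

theorem isSummand_of_injective (hX : Module.Injective R X) (f : X →ₗ[R] N)
    (hf : Function.Injective f) : IsSummand X N := by
  obtain ⟨r, hr⟩ := hX.out f hf LinearMap.id
  exact ⟨f, r, LinearMap.ext hr⟩

theorem IsSummand.injective_module (h : IsSummand X N) (hN : Module.Injective R N) :
    Module.Injective R X := by
  obtain ⟨i, r, h⟩ := h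
  exact injective_of_leftInverse h hN

theorem IsSummand.exists_injective (h : IsSummand X N) :
    ∃ f : X →ₗ[R] N, Function.Injective f := by
  obtain ⟨i, r, h⟩ := h
  exact ⟨i, fun x y hxy => by
    have := congrArg r hxy
    rwa [← LinearMap.comp_apply, ← LinearMap.comp_apply, h] at this⟩

/-- Direct summands have complements. -/
theorem IsSummand.exists_compl (h : IsSummand X N) :
    ∃ X' : ModuleCat.{u} R, Nonempty (N ≃ₗ[R] (X × X')) := by
  obtain ⟨i, r, h⟩ := h
  have h' : ∀ x, r (i x) = x := LinearMap.congr_fun h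
  refine ⟨ModuleCat.of R (LinearMap.ker r), ⟨LinearEquiv.ofBijective
    (r.prod ((LinearMap.id - i ∘ₗ r).codRestrict (LinearMap.ker r) fun x => by simp [h'])) ⟨?_, ?_⟩⟩⟩
  · rw [injective_iff_map_eq_zero]
    intro x hx
    have h1 : r x = 0 := congrArg Prod.fst hx
    have h2 : x - i (r x) = 0 := congrArg Subtype.val (congrArg Prod.snd hx)
    simpa [h1] using h2
  · rintro ⟨x, ⟨y, hy⟩⟩
    have hy : r y = 0 := hy
    refine ⟨i x + y, Prod.ext (by simp [h', hy]) (Subtype.ext ?_)⟩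
    simp [h', hy]

theorem isSummand_snd (X N : ModuleCat.{u} R) : IsSummand N (ModuleCat.of R (X × N)) :=
  ⟨LinearMap.inr R X N, LinearMap.snd R X N, by ext; simp⟩

theorem isSummand_prod {X N X' N' : ModuleCat.{u} R} (h : IsSummand X X') (h' : IsSummand N N') :
    IsSummand (ModuleCat.of R (X × N)) (ModuleCat.of R (X' × N')) := by
  obtain ⟨i, r, h⟩ := h
  obtain ⟨i', r', h'⟩ := h'
  refine ⟨i.prodMap i', r.prodMap r', ?_⟩
  ext x
  · exact LinearMap.congr_fun h x
  · simp
  · simp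
  · exact LinearMap.congr_fun h' x

/-- If `X` is a direct summand of `N`, then the minimal cosyzygy of `X` is a direct summand of any
cosyzygy of `N`. -/
theorem IsSummand.mho_of_exact (h : IsSummand X N) {f : N →ₗ[R] G} {g : G →ₗ[R] Z}
    (hG : Module.Injective R G) (hf : Function.Injective f) (hfg : Function.Exact f g)
    (hg : Function.Surjective g) : IsSummand (mho X) Z := by
  obtain ⟨i, r, hri⟩ := h
  obtain ⟨a, ha⟩ := hG.out (hullι X) (hullι_injective X) (f ∘ₗ i)
  obtain ⟨b, hb⟩ := (hull_injective X).out f hf (hullι X ∘ₗ r)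
  obtain ⟨a', ha'⟩ := exists_map_coker (hullι_mhoπ_exact X) (mhoπ_surjective X) hfg i a
    (LinearMap.ext ha)
  obtain ⟨b', hb'⟩ := exists_map_coker hfg hg (hullι_mhoπ_exact X) r b (LinearMap.ext hb)
  -- Since `b ∘ₗ a` fixes `X` inside its hull, it is an automorphism of the hull; the induced
  -- composite on cosyzygies is then bijective too.
  have hba : ∀ x, b (a (hullι X x)) = hullι X x := fun x => by
    rw [ha, LinearMap.comp_apply, hb, LinearMap.comp_apply, ← LinearMap.comp_apply r, hri]; rfl
  have hinj : Function.Injective (b ∘ₗ a) := injective_of_comp_essential (hullι_essential X) (by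
    have : (b ∘ₗ a) ∘ₗ hullι X = hullι X := LinearMap.ext hba
    rw [this]; exact hullι_injective X)
  have hsurj : Function.Surjective (b ∘ₗ a) := by
    refine surjective_of_essential_range ?_ (hull_injective X) hinj
    rw [isEssential_iff]
    intro x hx
    obtain ⟨s, ⟨y, hy⟩, hs⟩ := isEssential_iff.1 (hullι_essential X) x hx
    exact ⟨s, ⟨hullι X y, (hba y).trans hy⟩, hs⟩
  have hcomm : ∀ x, b' (a' (mhoπ X x)) = mhoπ X (b (a x)) := fun x => by
    rw [← LinearMap.comp_apply a', ha', LinearMap.comp_apply, ← LinearMap.comp_apply b', hb',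
      LinearMap.comp_apply]
  refine isSummand_of_bijective a' b' ⟨?_, ?_⟩
  · rw [injective_iff_map_eq_zero]
    intro y hy
    obtain ⟨x, rfl⟩ := mhoπ_surjective X y
    rw [LinearMap.comp_apply, hcomm] at hy
    obtain ⟨z, hz⟩ := (hullι_mhoπ_exact X _).1 hy
    have : x = hullι X z := hinj (((hba z).trans hz).symm)
    rw [this, (hullι_mhoπ_exact X).apply_apply_eq_zero]
  · intro y
    obtain ⟨x, rfl⟩ := mhoπ_surjective X y
    obtain ⟨z, rfl⟩ := hsurj x
    exact ⟨mhoπ X z, hcomm z⟩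

theorem IsSummand.mho (h : IsSummand X N) : IsSummand (mho X) (mho N) :=
  h.mho_of_exact (hull_injective N) (hullι_injective N) (hullι_mhoπ_exact N) (mhoπ_surjective N)

/-- The cosyzygy of `X` may be computed from any injective hull of `X`. -/
theorem mho_equiv_of_exact {f : X →ₗ[R] G} {g : G →ₗ[R] Z}
    (hG : Module.Injective R G) (hf : Function.Injective f) (hess : IsEssential (LinearMap.range f))
    (hfg : Function.Exact f g) (hg : Function.Surjective g) : Nonempty (MinCotilt.mho X ≃ₗ[R] Z) := by
  obtain ⟨a, ha⟩ := hG.out (hullι X) (hullι_injective X) f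
  have hinj : Function.Injective a := injective_of_comp_essential (hullι_essential X) (by
    have : a ∘ₗ hullι X = f := LinearMap.ext ha
    rwa [this])
  have hsurj : Function.Surjective a := by
    refine surjective_of_essential_range ?_ (hull_injective X) hinj
    rw [isEssential_iff]
    intro x hx
    obtain ⟨s, ⟨y, hy⟩, hs⟩ := isEssential_iff.1 hess x hx
    exact ⟨s, ⟨hullι X y, (ha y).trans hy⟩, hs⟩
  obtain ⟨a', ha'⟩ := exists_map_coker (hullι_mhoπ_exact X) (mhoπ_surjective X) hfg .id a
    (LinearMap.ext ha)
  have ha' : ∀ x, a' (mhoπ X x) = g (a x) := LinearMap.congr_fun ha'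
  refine ⟨LinearEquiv.ofBijective a' ⟨?_, ?_⟩⟩
  · rw [injective_iff_map_eq_zero]
    intro y hy
    obtain ⟨x, rfl⟩ := mhoπ_surjective X y
    rw [ha'] at hy
    obtain ⟨z, hz⟩ := (hfg _).1 hy
    have : x = hullι X z := hinj (((ha z).trans hz).symm)
    rw [this, (hullι_mhoπ_exact X).apply_apply_eq_zero]
  · intro y
    obtain ⟨x, rfl⟩ := hg y
    obtain ⟨z, rfl⟩ := hsurj x
    exact ⟨mhoπ X z, ha' z⟩

/-- Injective hulls are unique. -/
theorem hull_equiv {Y : ModuleCat.{u} R} {G G' : ModuleCat.{u} R} (h : IsInjectiveHull Y G)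
    (h' : IsInjectiveHull Y G') : Nonempty (G ≃ₗ[R] G') := by
  obtain ⟨hG, f, hf, hess⟩ := h
  obtain ⟨hG', f', hf', hess'⟩ := h'
  obtain ⟨a, ha⟩ := hG'.out f hf f'
  have hinj : Function.Injective a := injective_of_comp_essential hess (by
    have : a ∘ₗ f = f' := LinearMap.ext ha
    rwa [this])
  refine ⟨LinearEquiv.ofBijective a ⟨hinj, surjective_of_essential_range ?_ hG hinj⟩⟩
  rw [isEssential_iff]
  intro x hx
  obtain ⟨s, ⟨y, hy⟩, hs⟩ := isEssential_iff.1 hess' x hx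
  exact ⟨s, ⟨f y, (ha y).trans hy⟩, hs⟩

theorem mho_equiv (e : X ≃ₗ[R] N) : Nonempty (MinCotilt.mho X ≃ₗ[R] MinCotilt.mho N) := by
  refine mho_equiv_of_exact (f := hullι N ∘ₗ e.toLinearMap) (g := mhoπ N) (hull_injective N)
    ((hullι_injective N).comp e.injective) ?_ ?_ (mhoπ_surjective N)
  · rw [LinearMap.range_comp, LinearEquiv.range, Submodule.map_top]
    exact hullι_essential N
  · intro y
    rw [hullι_mhoπ_exact N y]
    exact ⟨fun ⟨x, hx⟩ => ⟨e.symm x, by simpa using hx⟩, fun ⟨x, hx⟩ => ⟨e x, by simpa using hx⟩⟩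

theorem mho_prod_equiv (X N : ModuleCat.{u} R) :
    Nonempty (MinCotilt.mho (ModuleCat.of R (X × N)) ≃ₗ[R]
      ModuleCat.of R (MinCotilt.mho X × MinCotilt.mho N)) := by
  refine mho_equiv_of_exact (G := ModuleCat.of R (hull X × hull N))
    (Z := ModuleCat.of R (MinCotilt.mho X × MinCotilt.mho N))
    (f := (hullι X).prodMap (hullι N)) (g := (mhoπ X).prodMap (mhoπ N))
    (injective_prod (hull_injective X) (hull_injective N))
    ((hullι_injective X).prodMap (hullι_injective N)) ?_ ?_
    ((mhoπ_surjective X).prodMap (mhoπ_surjective N))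
  · rw [isEssential_iff]
    rintro ⟨x, y⟩ hxy
    by_cases hx : x = 0
    · subst hx
      have hy : y ≠ 0 := fun h => hxy (by rw [h]; rfl)
      obtain ⟨r, ⟨z, hz⟩, hr⟩ := isEssential_iff.1 (hullι_essential N) y hy
      exact ⟨r, ⟨(0, z), by simp [hz]⟩, fun h => hr (congrArg Prod.snd h)⟩
    -- Move the first coordinate into the image, then the second; the extra multiple keeps the first
    -- one there.
    · obtain ⟨r, ⟨z, hz⟩, hr⟩ := isEssential_iff.1 (hullι_essential X) x hx
      by_cases hy : r • y = 0
      · exact ⟨r, ⟨(z, 0), by simp [hz, hy]⟩, fun h => hr (congrArg Prod.fst h)⟩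
      · obtain ⟨s, ⟨w, hw⟩, hs⟩ := isEssential_iff.1 (hullι_essential N) _ hy
        refine ⟨s * r, ⟨(s • z, w), ?_⟩, fun h => hs ?_⟩
        · simp [hz, hw, mul_smul]
        · rw [← mul_smul]; exact congrArg Prod.snd h
  · rintro ⟨x, y⟩
    constructor
    · intro h
      obtain ⟨a, ha⟩ := (hullι_mhoπ_exact X x).1 (congrArg Prod.fst h)
      obtain ⟨b, hb⟩ := (hullι_mhoπ_exact N y).1 (congrArg Prod.snd h)
      exact ⟨(a, b), by simp [ha, hb]⟩
    · rintro ⟨⟨a, b⟩, h⟩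
      rw [← h]
      exact Prod.ext ((hullι_mhoπ_exact X).apply_apply_eq_zero a)
        ((hullι_mhoπ_exact N).apply_apply_eq_zero b)

/-- The product of hulls need not be a hull of the product, but `IsSummand.mho_of_exact` accepts any
injective extension of the larger module. -/
theorem InProd.mho (h : InProd N X) : InProd (MinCotilt.mho N) (MinCotilt.mho X) := by
  obtain ⟨κ, h⟩ := h
  have := hull_injective N
  exact ⟨κ, h.mho_of_exact (N := ModuleCat.of R (κ → N)) (G := ModuleCat.of R (κ → hull N))
    (Z := ModuleCat.of R (κ → MinCotilt.mho N)) (inferInstanceAs (Module.Injective R (κ → hull N)))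
    (piMap_injective fun _ => hullι_injective N) (piMap_exact fun _ => hullι_mhoπ_exact N)
    (piMap_surjective fun _ => mhoπ_surjective N)⟩

/-- The cosyzygy of an injective module vanishes. -/
theorem subsingleton_mho (hX : Module.Injective R X) : Subsingleton (MinCotilt.mho X) := by
  obtain ⟨e⟩ := mho_equiv_of_exact (Z := ModuleCat.of R PUnit) (f := LinearMap.id) (g := 0) hX
    Function.injective_id (by rw [LinearMap.range_id]; exact fun K hK => by simpa using hK)
    (fun y => by simp) (fun y => ⟨0, Subsingleton.elim _ _⟩)
  exact e.toEquiv.subsingleton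

theorem injective_of_subsingleton_mho (h : Subsingleton (MinCotilt.mho X)) :
    Module.Injective R X := by
  have : Function.Surjective (hullι X) := fun y =>
    (hullι_mhoπ_exact X y).1 (Subsingleton.elim (α := MinCotilt.mho X) _ _)
  exact injective_of_linearEquiv (LinearEquiv.ofBijective _ ⟨hullι_injective X, this⟩)
    (hull_injective X)

/-- The iterated cosyzygies of `X`. -/
noncomputable def mhoN : ℕ → ModuleCat.{u} R → ModuleCat.{u} R
  | 0, X => X
  | j + 1, X => MinCotilt.mho (mhoN j X)

theorem mhoN_succ' (j : ℕ) (X : ModuleCat.{u} R) : mhoN (j + 1) X = mhoN j (MinCotilt.mho X) := by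
  induction j with
  | zero => rfl
  | succ j ih => exact congrArg MinCotilt.mho ih

theorem mhoN_equiv (e : X ≃ₗ[R] N) (j : ℕ) : Nonempty (mhoN j X ≃ₗ[R] mhoN j N) := by
  induction j with
  | zero => exact ⟨e⟩
  | succ j ih => exact ih.elim fun e => mho_equiv e

theorem mhoN_prod_equiv (X N : ModuleCat.{u} R) (j : ℕ) :
    Nonempty (mhoN j (ModuleCat.of R (X × N)) ≃ₗ[R] ModuleCat.of R (mhoN j X × mhoN j N)) := by
  induction j with
  | zero => exact ⟨LinearEquiv.refl R _⟩
  | succ j ih =>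
    obtain ⟨e⟩ := ih
    obtain ⟨e'⟩ := mho_equiv (N := ModuleCat.of R (mhoN j X × mhoN j N)) e
    obtain ⟨e''⟩ := mho_prod_equiv (mhoN j X) (mhoN j N)
    exact ⟨e'.trans e''⟩

theorem InProd.mhoN (h : InProd N X) (j : ℕ) : InProd (MinCotilt.mhoN j N) (MinCotilt.mhoN j X) := by
  induction j with
  | zero => exact h
  | succ j ih => exact ih.mho

end Essential

/-! ### Associated primes and Matlis' structure theorem -/

section Matlis

variable {R : Type u} [CommRing R]

section AnnEq

variable {M N : Type u} [AddCommGroup M] [Module R M] [AddCommGroup N] [Module R N]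

/-- The annihilator of `z` is `p`. -/
def AnnEq (p : PrimeSpectrum R) (z : M) : Prop := ∀ r : R, r • z = 0 ↔ r ∈ p.asIdeal

/-- All associated primes of `M` belong to `Y`. -/
def AssIn (Y : Set (PrimeSpectrum R)) (M : Type u) [AddCommGroup M] [Module R M] : Prop :=
  ∀ (p : PrimeSpectrum R) (z : M), AnnEq p z → p ∈ Y

theorem AnnEq.ne_zero {p : PrimeSpectrum R} {z : M} (h : AnnEq p z) : z ≠ 0 := by
  rintro rfl
  exact p.2.ne_top ((Ideal.eq_top_iff_one _).2 ((h 1).1 (smul_zero _)))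

theorem AnnEq.eq {p q : PrimeSpectrum R} {z : M} (h : AnnEq p z) (h' : AnnEq q z) : p = q :=
  PrimeSpectrum.ext (Ideal.ext fun r => (h r).symm.trans (h' r))

theorem AnnEq.smul {p : PrimeSpectrum R} {z : M} (h : AnnEq p z) {r : R} (hr : r • z ≠ 0) :
    AnnEq p (r • z) := fun s => by
  rw [← mul_smul, h, p.2.mul_mem_iff_mem_or_mem, or_iff_left fun hrp => hr ((h r).2 hrp)]

theorem AnnEq.map {p : PrimeSpectrum R} {z : M} (h : AnnEq p z) {f : M →ₗ[R] N}
    (hf : Function.Injective f) : AnnEq p (f z) := fun r => by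
  rw [← map_smul, map_eq_zero_iff f hf, h]

theorem AnnEq.of_map {p : PrimeSpectrum R} {z : M} {f : M →ₗ[R] N} (h : AnnEq p (f z))
    (hf : Function.Injective f) : AnnEq p z := fun r => by
  rw [← h r, ← map_smul, map_eq_zero_iff f hf]

theorem AssIn.of_injective {Y : Set (PrimeSpectrum R)} (h : AssIn Y N) {f : M →ₗ[R] N}
    (hf : Function.Injective f) : AssIn Y M := fun p z hz => h p (f z) (hz.map hf)

theorem AssIn.mono {Y Y' : Set (PrimeSpectrum R)} (h : AssIn Y M) (hY : Y ⊆ Y') : AssIn Y' M :=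
  fun p z hz => hY (h p z hz)

theorem AssIn.of_essential {Y : Set (PrimeSpectrum R)} (h : AssIn Y M) {f : M →ₗ[R] N}
    (hf : Function.Injective f) (hess : IsEssential (LinearMap.range f)) : AssIn Y N := by
  intro p z hz
  obtain ⟨r, ⟨y, hy⟩, hr⟩ := isEssential_iff.1 hess z hz.ne_zero
  exact h p y (AnnEq.of_map (hy ▸ hz.smul hr) hf)

/-- If the annihilator of `x` is larger than `p`, some element `r` outside `p` kills `x`, and then
`r • y` carries the annihilator `p`. -/
theorem AssIn.prod {Y : Set (PrimeSpectrum R)} (hM : AssIn Y M) (hN : AssIn Y N) :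
    AssIn Y (M × N) := by
  rintro p ⟨x, y⟩ h
  by_cases hx : AnnEq p x
  · exact hM p x hx
  · have h' : ∀ r ∈ p.asIdeal, r • x = 0 ∧ r • y = 0 := fun r hr => by
      have := (h r).2 hr
      exact ⟨congrArg Prod.fst this, congrArg Prod.snd this⟩
    obtain ⟨r, hr⟩ := not_forall.1 hx
    have hrp : r ∉ p.asIdeal := fun hrp => hr ⟨fun _ => hrp, fun _ => (h' r hrp).1⟩
    have hrx : r • x = 0 := by
      by_contra hrx
      exact hr ⟨fun h => (hrx h).elim, fun h => (hrp h).elim⟩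
    have hry : r • (x, y) ≠ 0 := fun h0 => hrp ((h r).1 h0)
    refine hN p (r • y) fun s => ?_
    rw [← h.smul hry s]
    simp [hrx]

/-- The nonzero cyclic module generated by `z` has an associated prime, realized by a multiple of
`z`. -/
theorem exists_annEq [IsNoetherianRing R] {z : M} (hz : z ≠ 0) :
    ∃ (r : R) (p : PrimeSpectrum R), AnnEq p (r • z) := by
  have : Nontrivial (Submodule.span R {z}) :=
    ⟨⟨⟨z, Submodule.mem_span_singleton_self z⟩, 0, fun h => hz (congrArg Subtype.val h)⟩⟩
  obtain ⟨P, hP⟩ := associatedPrimes.nonempty R (Submodule.span R {z})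
  obtain ⟨hprime, ⟨x, hx⟩, hPx⟩ := isAssociatedPrime_iff.1 hP
  obtain ⟨r, rfl⟩ := Submodule.mem_span_singleton.1 hx
  refine ⟨r, ⟨P, hprime⟩, fun s => ?_⟩
  change _ ↔ s ∈ P
  rw [hPx, Submodule.mem_colon_singleton, Submodule.mem_bot, Subtype.ext_iff]
  rfl

theorem mem_associatedPrimes_iff [IsNoetherianRing R] {p : PrimeSpectrum R} :
    p.asIdeal ∈ associatedPrimes R M ↔ ∃ z : M, AnnEq p z := by
  rw [AssociatedPrimes.mem_iff, isAssociatedPrime_iff, and_iff_right p.2]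
  refine exists_congr fun z => ?_
  rw [SetLike.ext_iff]
  refine forall_congr' fun r => ?_
  rw [Submodule.mem_colon_singleton, Submodule.mem_bot]
  exact Iff.comm

theorem AssIn.subsingleton_of_empty [IsNoetherianRing R] (h : AssIn (∅ : Set (PrimeSpectrum R)) M) :
    Subsingleton M := by
  refine subsingleton_of_forall_eq 0 fun z => ?_
  by_contra hz
  obtain ⟨r, p, hp⟩ := exists_annEq (R := R) hz
  exact h p _ hp

/-- An associated prime of a product need not be one of a factor, but it is contained in one: a
nonzero coordinate has a multiple with prime annihilator `q` ⊇ `p`. This is where closure under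
generalization enters. -/
theorem AssIn.pi [IsNoetherianRing R] {ι : Type u} {X : ι → ModuleCat.{u} R}
    {Y : Set (PrimeSpectrum R)} (hY : IsLowerSet Y) (h : ∀ i, AssIn Y (X i)) :
    AssIn Y (∀ i, X i) := by
  intro p z hz
  obtain ⟨i, hi⟩ : ∃ i, z i ≠ 0 := by
    by_contra! H
    exact hz.ne_zero (funext H)
  obtain ⟨r, q, hq⟩ := exists_annEq (R := R) hi
  refine hY (fun s hs => ?_) (h i q _ hq)
  have : s • z = 0 := (hz s).2 hs
  exact (hq s).1 (by rw [smul_comm, show s • z i = 0 from congrFun this i, smul_zero])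

theorem AssIn.quotient (p : PrimeSpectrum R) {x : R ⧸ p.asIdeal} (hx : x ≠ 0) : AnnEq p x := by
  obtain ⟨a, rfl⟩ := Submodule.Quotient.mk_surjective _ x
  intro r
  have ha : a ∉ p.asIdeal := fun h => hx ((Submodule.Quotient.mk_eq_zero _).2 h)
  rw [← Submodule.Quotient.mk_smul, Submodule.Quotient.mk_eq_zero, smul_eq_mul,
    p.2.mul_mem_iff_mem_or_mem, or_iff_left ha]

end AnnEq

/-! ### The indecomposable injectives E(R/p) -/

section Hulls

variable {p : PrimeSpectrum R} {E : ModuleCat.{u} R}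

/-- Every nonzero element of `E(R/p)` has a multiple with annihilator `p`. -/
theorem IsInjectiveHull.exists_annEq_smul
    (h : IsInjectiveHull (ModuleCat.of R (R ⧸ p.asIdeal)) E) {x : E} (hx : x ≠ 0) :
    ∃ r : R, AnnEq p (r • x) := by
  obtain ⟨-, f, hf, hess⟩ := h
  obtain ⟨r, ⟨y, hy⟩, hr⟩ := isEssential_iff.1 hess x hx
  refine ⟨r, hy ▸ AnnEq.map (AssIn.quotient p ?_) hf⟩
  rintro rfl
  exact hr (by rw [← hy, map_zero])

theorem IsInjectiveHull.exists_annEq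
    (h : IsInjectiveHull (ModuleCat.of R (R ⧸ p.asIdeal)) E) : ∃ x : E, AnnEq p x := by
  obtain ⟨-, f, hf, -⟩ := h
  have : Nontrivial (R ⧸ p.asIdeal) := Ideal.Quotient.nontrivial_iff.2 p.2.ne_top
  exact ⟨f (1 : R ⧸ p.asIdeal), AnnEq.map (AssIn.quotient p one_ne_zero) hf⟩

theorem IsInjectiveHull.annEq_eq {q : PrimeSpectrum R}
    (h : IsInjectiveHull (ModuleCat.of R (R ⧸ p.asIdeal)) E) {x : E} (hx : AnnEq q x) : q = p := by
  obtain ⟨r, hr⟩ := h.exists_annEq_smul hx.ne_zero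
  exact (hx.smul hr.ne_zero).eq hr

/-- `E(R/p)` is uniform. -/
theorem IsInjectiveHull.exists_smul_eq
    (h : IsInjectiveHull (ModuleCat.of R (R ⧸ p.asIdeal)) E) {x y : E} (hx : x ≠ 0) (hy : y ≠ 0) :
    ∃ r s : R, r • x = s • y ∧ r • x ≠ 0 := by
  obtain ⟨-, f, hf, hess⟩ := h
  obtain ⟨r, ⟨a, ha⟩, hr⟩ := isEssential_iff.1 hess x hx
  obtain ⟨s, ⟨b, hb⟩, hs⟩ := isEssential_iff.1 hess y hy
  have ha0 : a ≠ 0 := by rintro rfl; exact hr (by rw [← ha, map_zero])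
  have hb0 : b ≠ 0 := by rintro rfl; exact hs (by rw [← hb, map_zero])
  obtain ⟨a', rfl⟩ := Submodule.Quotient.mk_surjective p.asIdeal a
  obtain ⟨b', rfl⟩ := Submodule.Quotient.mk_surjective p.asIdeal b
  have hb' : b' ∉ p.asIdeal := fun h => hb0 ((Submodule.Quotient.mk_eq_zero _).2 h)
  refine ⟨b' * r, a' * s, ?_, fun h0 => hb' ?_⟩
  · rw [mul_smul, mul_smul, ← ha, ← hb, ← map_smul, ← map_smul]
    refine congrArg f ?_
    rw [← Submodule.Quotient.mk_smul, ← Submodule.Quotient.mk_smul, smul_eq_mul, smul_eq_mul,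
      mul_comm]
  · rw [mul_smul, ← ha, ← map_smul, map_eq_zero_iff f hf] at h0
    exact (AssIn.quotient p ha0 b').1 h0

/-- A map out of `E(R/p)` that does not shrink the annihilator `p` of one element is injective. -/
theorem IsInjectiveHull.injective_of_annEq {Z : ModuleCat.{u} R}
    (h : IsInjectiveHull (ModuleCat.of R (R ⧸ p.asIdeal)) E) {f : E →ₗ[R] Z} {x : E}
    (hx : AnnEq p x) (hfx : AnnEq p (f x)) : Function.Injective f := by
  rw [injective_iff_map_eq_zero]
  intro y hy
  by_contra hy0
  obtain ⟨r, s, hrs, hr⟩ := h.exists_smul_eq hx.ne_zero hy0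
  have h1 : r • f x = 0 := by rw [← map_smul, hrs, map_smul, hy, smul_zero]
  exact hr ((hx r).2 ((hfx r).1 h1))

end Hulls

/-! ### Direct sums, their injectivity and their associated primes -/

section DirectSum

variable {ι : Type u} {E : ι → ModuleCat.{u} R}

/-- The projection of a direct sum to a factor. -/
noncomputable def dproj (E : ι → ModuleCat.{u} R) (i : ι) : dsum E →ₗ[R] E i :=
  DirectSum.component R ι (fun i => E i) i

open Classical in
/-- The inclusion of a factor in a direct sum. -/
noncomputable def dincl (E : ι → ModuleCat.{u} R) (i : ι) : E i →ₗ[R] dsum E :=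
  DirectSum.lof R ι (fun i => E i) i

open Classical in
/-- The map out of a direct sum defined by a family of maps. -/
noncomputable def dlift {Z : ModuleCat.{u} R} (f : ∀ i, E i →ₗ[R] Z) : dsum E →ₗ[R] Z :=
  DirectSum.toModule R ι Z f

theorem dproj_dincl (i : ι) (x : E i) : dproj E i (dincl E i x) = x := by
  classical
  exact DirectSum.component.lof_self R (M := fun i => E i) i x

theorem dproj_dincl_ne {i j : ι} (h : j ≠ i) (x : E j) : dproj E i (dincl E j x) = 0 := by
  classical
  exact (DirectSum.component.of R (M := fun i => E i) i j x).trans (dif_neg h)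

theorem dlift_dincl {Z : ModuleCat.{u} R} (f : ∀ i, E i →ₗ[R] Z) (i : ι) (x : E i) :
    dlift f (dincl E i x) = f i x := by
  classical
  exact DirectSum.toModule_lof R (M := fun i => E i) i x

theorem dsum_ext {x y : dsum E} (h : ∀ i, dproj E i x = dproj E i y) : x = y :=
  DirectSum.ext_component R h

theorem dsum_hom_ext {Z : ModuleCat.{u} R} {f g : dsum E →ₗ[R] Z}
    (h : ∀ i, f ∘ₗ dincl E i = g ∘ₗ dincl E i) : f = g := by
  classical
  exact DirectSum.linearMap_ext R h

/-- The map of direct sums induced by a family of maps. -/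
noncomputable def dmap {X X' : ι → ModuleCat.{u} R} (f : ∀ i, X i →ₗ[R] X' i) :
    dsum X →ₗ[R] dsum X' :=
  dlift fun i => dincl X' i ∘ₗ f i

theorem dproj_dmap {X X' : ι → ModuleCat.{u} R} (f : ∀ i, X i →ₗ[R] X' i)
    (x : dsum X) (i : ι) : dproj X' i (dmap f x) = f i (dproj X i x) := by
  have : dproj X' i ∘ₗ dmap f = f i ∘ₗ dproj X i := by
    refine dsum_hom_ext fun j => LinearMap.ext fun v => ?_
    simp only [LinearMap.comp_apply, dmap, dlift_dincl]
    by_cases hji : j = i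
    · subst hji; rw [dproj_dincl, dproj_dincl]
    · rw [dproj_dincl_ne hji, dproj_dincl_ne hji, map_zero]
  exact LinearMap.congr_fun this x

theorem dmap_injective {X X' : ι → ModuleCat.{u} R} {f : ∀ i, X i →ₗ[R] X' i}
    (hf : ∀ i, Function.Injective (f i)) : Function.Injective (dmap f) := fun x y hxy => by
  refine dsum_ext fun i => hf i ?_
  rw [← dproj_dmap, hxy, dproj_dmap]

theorem dincl_injective (i : ι) : Function.Injective (dincl E i) := fun x y h => by
  rw [← dproj_dincl i x, h, dproj_dincl]

theorem finite_support (x : dsum E) : ∃ s : Finset ι, ∀ i ∉ s, dproj E i x = 0 := by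
  classical
  exact ⟨DFinsupp.support x, fun i hi => DFinsupp.notMem_support_iff.1 hi⟩

/-- The truncation of a family to a finite set. -/
theorem exists_truncation (s : Finset ι) (e : ∀ i, E i) :
    ∃ x : dsum E, (∀ i ∈ s, dproj E i x = e i) ∧ ∀ i ∉ s, dproj E i x = 0 := by
  classical
  refine ⟨∑ i ∈ s, dincl E i (e i), fun i hi => ?_, fun i hi => ?_⟩
  · rw [map_sum, Finset.sum_eq_single i (fun j _ hj => dproj_dincl_ne hj _) (fun h => (h hi).elim),
      dproj_dincl]
  · rw [map_sum]
    exact Finset.sum_eq_zero fun j hj => dproj_dincl_ne (by rintro rfl; exact hi hj) _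

/-- Direct sums of injective modules over a noetherian ring are injective. -/
theorem injective_dsum [IsNoetherianRing R] (h : ∀ i, Module.Injective R (E i)) :
    Module.Injective R (dsum E) := by
  classical
  refine Module.Baer.injective fun I g => ?_
  have hI : I.FG := IsNoetherian.noetherian I
  choose e he using fun i => Module.Baer.of_injective (h i) I (dproj E i ∘ₗ g)
  -- The ideal is finitely generated, so `g` has only finitely many nonzero coordinates and the
  -- coordinatewise extensions can be truncated.
  obtain ⟨s, hs⟩ : ∃ s : Finset ι, ∀ i ∉ s, ∀ a : I, dproj E i (g a) = 0 := by
    obtain ⟨t, ht⟩ := (Module.Finite.iff_fg.2 hI : Module.Finite R I).1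
    choose s hs using fun a : I => finite_support (g a)
    refine ⟨t.biUnion s, fun i hi a => ?_⟩
    have : (⊤ : Submodule R I) ≤ LinearMap.ker (dproj E i ∘ₗ g) := by
      rw [← ht, Submodule.span_le]
      intro a ha
      exact hs a i fun h => hi (Finset.mem_biUnion.2 ⟨a, ha, h⟩)
    exact this (Submodule.mem_top (x := a))
  obtain ⟨x, hx, hx'⟩ := exists_truncation s fun i => e i 1
  refine ⟨LinearMap.toSpanSingleton R _ x, fun a ha => dsum_ext fun i => ?_⟩
  rw [LinearMap.toSpanSingleton_apply, map_smul]
  by_cases hi : i ∈ s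
  · rw [hx i hi, ← map_smul, smul_eq_mul, mul_one]
    exact he i a ha
  · rw [hx' i hi, hs i hi, smul_zero]

/-- An element of a direct sum with prime annihilator `q` has a component with annihilator `q`. -/
theorem AnnEq.exists_dproj {q : PrimeSpectrum R} {z : dsum E} (h : AnnEq q z) :
    ∃ i, AnnEq q (dproj E i z) := by
  classical
  obtain ⟨s, hs⟩ := finite_support z
  by_contra! H
  -- Otherwise each coordinate is killed by an element outside `q`; the product over the finite
  -- support kills `z` and so lies in `q`, contradicting primality.
  have hq : ∀ i, ∃ r, r ∉ q.asIdeal ∧ r • dproj E i z = 0 := fun i => by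
    obtain ⟨r, hr⟩ := not_forall.1 (H i)
    have hrq : r ∉ q.asIdeal := fun hrq => hr ⟨fun _ => hrq, fun _ => by
      rw [← map_smul, (h r).2 hrq, map_zero]⟩
    refine ⟨r, hrq, ?_⟩
    by_contra h0
    exact hr ⟨fun h => (h0 h).elim, fun h => (hrq h).elim⟩
  choose r hr hr0 using hq
  have hprod : (∏ i ∈ s, r i) ∈ q.asIdeal := (h _).1 (dsum_ext fun i => by
    rw [map_smul, map_zero]
    by_cases hi : i ∈ s
    · rw [← Finset.prod_erase_mul s r hi, mul_smul, hr0, smul_zero]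
    · rw [hs i hi, smul_zero])
  obtain ⟨i, -, hi⟩ := (q.2.prod_mem_iff).1 hprod
  exact hr i hi

theorem AssIn.dsum {Y : Set (PrimeSpectrum R)} (h : ∀ i, AssIn Y (E i)) : AssIn Y (dsum E) := by
  intro q z hz
  obtain ⟨i, hi⟩ := hz.exists_dproj
  exact h i q _ hi

/-- The direct sum of essential monomorphisms. -/
theorem dsum_essential {E' : ι → ModuleCat.{u} R} (f : ∀ i, E i →ₗ[R] E' i)
    (hf : ∀ i, IsEssential (LinearMap.range (f i))) :
    IsEssential (LinearMap.range (dmap f)) := by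
  classical
  rw [isEssential_iff]
  intro z hz
  -- The finitely many nonzero coordinates are moved into the images one at a time, without killing
  -- the element.
  have key : ∀ s : Finset ι, ∃ r : R, r • z ≠ 0 ∧
      ∀ i ∈ s, dproj E' i (r • z) ∈ LinearMap.range (f i) := by
    intro s
    induction s using Finset.induction_on with
    | empty => exact ⟨1, by simpa, by simp⟩
    | insert i s his ih =>
      obtain ⟨r, hr, hs⟩ := ih
      by_cases hi : dproj E' i (r • z) = 0
      · refine ⟨r, hr, fun j hj => ?_⟩
        obtain rfl | hj := Finset.mem_insert.1 hj
        · rw [hi]; exact zero_mem _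
        · exact hs j hj
      · obtain ⟨t, ht, ht0⟩ := isEssential_iff.1 (hf i) _ hi
        refine ⟨t * r, fun h => ht0 ?_, fun j hj => ?_⟩
        · rw [← map_smul, ← mul_smul, h, map_zero]
        · rw [mul_smul, map_smul]
          obtain rfl | hj := Finset.mem_insert.1 hj
          · exact ht
          · exact Submodule.smul_mem _ _ (hs j hj)
  obtain ⟨s, hs⟩ := finite_support z
  obtain ⟨r, hr, hrs⟩ := key s
  refine ⟨r, ?_, hr⟩
  have hall : ∀ i, ∃ x, f i x = dproj E' i (r • z) := fun i => by
    by_cases hi : i ∈ s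
    · exact hrs i hi
    · exact ⟨0, by rw [map_zero, map_smul, hs i hi, smul_zero]⟩
  choose x hx using hall
  obtain ⟨y, hy, hy'⟩ := exists_truncation s x
  refine ⟨y, dsum_ext fun i => ?_⟩
  rw [dproj_dmap]
  by_cases hi : i ∈ s
  · rw [hy i hi, hx]
  · rw [hy' i hi, map_zero, map_smul, hs i hi, smul_zero]

end DirectSum

end Matlis

/-! ### Matlis' decomposition and the description of 𝓘(Y) -/

section Decomposition

variable {R : Type u} [CommRing R]

theorem sSupIndep_union_singleton {M : Type u} [AddCommGroup M] [Module R M]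
    {s : Set (Submodule R M)} (hs : sSupIndep s) {a : Submodule R M} (ha : Disjoint a (sSup s)) :
    sSupIndep (s ∪ {a}) := by
  intro x hx
  rw [Set.mem_union, Set.mem_singleton_iff] at hx
  obtain rfl | xa := eq_or_ne x a
  · simp only [Set.mem_singleton, Set.insert_sdiff_of_mem, Set.union_singleton]
    exact ha.mono_right (sSup_le_sSup Set.sdiff_subset)
  · have h : (s ∪ {a}) \ {x} = s \ {x} ∪ {a} := by
      simp only [Set.union_singleton]
      rw [Set.insert_sdiff_of_notMem]
      rw [Set.mem_singleton_iff]
      exact Ne.symm xa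
    rw [h, sSup_union, sSup_singleton]
    apply (hs (hx.resolve_right xa)).disjoint_sup_right_of_disjoint_sup_left
      (ha.mono_right _).symm
    rw [← sSup_insert, Set.insert_sdiff_singleton, Set.insert_eq_of_mem (hx.resolve_right xa)]

/-- The submodule generated by an element with annihilator `p` is a copy of `R/p`. -/
theorem AnnEq.quotient_equiv_span {M : Type u} [AddCommGroup M] [Module R M]
    {p : PrimeSpectrum R} {z : M} (h : AnnEq p z) :
    Nonempty ((R ⧸ p.asIdeal) ≃ₗ[R] Submodule.span R {z}) := by
  have hker : LinearMap.ker (LinearMap.toSpanSingleton R M z) = p.asIdeal := by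
    ext r
    rw [LinearMap.mem_ker, LinearMap.toSpanSingleton_apply, h]
  exact ⟨(Submodule.quotEquivOfEq _ _ hker.symm).trans
    ((LinearMap.toSpanSingleton R M z).quotKerEquivRange.trans
      (LinearEquiv.ofEq _ _ (LinearMap.range_toSpanSingleton z)))⟩

theorem IsInjectiveHull.of_equiv {X X' E : ModuleCat.{u} R} (h : IsInjectiveHull X E)
    (e : X' ≃ₗ[R] X) : IsInjectiveHull X' E := by
  obtain ⟨hE, f, hf, hess⟩ := h
  refine ⟨hE, f ∘ₗ e.toLinearMap, hf.comp e.injective, ?_⟩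
  rwa [LinearMap.range_comp, LinearEquiv.range, Submodule.map_top]

/-- Matlis: an injective module over a noetherian ring is a direct sum of modules `E(R/p)`. -/
theorem exists_isSumOfHulls [IsNoetherianRing R] {E : ModuleCat.{u} R} (hE : Module.Injective R E) :
    ∃ (ι : Type u) (p : ι → PrimeSpectrum R), IsSumOfHulls p E ∧ ∀ k, ∃ z : E, AnnEq (p k) z := by
  classical
  -- Take a maximal independent family of cyclic submodules isomorphic to some R/p. Its sum is
  -- essential in `E`, so `E` is the hull of that sum, which is the direct sum of the hulls.
  obtain ⟨S, hS⟩ := zorn_subset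
    {S : Set (Submodule R E) | sSupIndep S ∧
      ∀ N ∈ S, ∃ (p : PrimeSpectrum R) (z : E), AnnEq p z ∧ N = Submodule.span R {z}}
    fun c hc hchain => ⟨⋃₀ c, ⟨iSupIndep_sUnion_of_directed hchain.directedOn fun s hs => (hc hs).1,
      fun N ⟨s, hs, hN⟩ => (hc hs).2 N hN⟩, fun _ => Set.subset_sUnion_of_mem⟩
  obtain ⟨hind, hprime⟩ := hS.prop
  choose p z hz hspan using fun N : S => hprime N N.2
  let X : S → ModuleCat.{u} R := fun N => ModuleCat.of R (N : Submodule R E)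
  let f : dsum X →ₗ[R] E := dlift fun N => (N : Submodule R E).subtype
  have hf : Function.Injective f := @iSupIndep.dfinsupp_lsum_injective _ R E (fun _ _ => Classical.propDecidable _) _ _ _ _
    ((sSupIndep_iff S).1 hind)
  have hle : sSup S ≤ LinearMap.range f := sSup_le fun N hN x hx =>
    ⟨dincl X ⟨N, hN⟩ ⟨x, hx⟩, dlift_dincl _ _ _⟩
  have hess : IsEssential (LinearMap.range f) := by
    rw [isEssential_iff]
    intro x hx
    obtain ⟨r, q, hq⟩ := exists_annEq (R := R) hx
    have hnd : ¬ Disjoint (Submodule.span R {r • x}) (sSup S) := fun hd => by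
      have hmem : Submodule.span R {r • x} ∈ S := hS.le_of_ge
        ⟨sSupIndep_union_singleton hind hd, fun N hN => ?_⟩ Set.subset_union_left
          (Set.mem_union_right _ rfl)
      · have := hd.le_bot ⟨Submodule.mem_span_singleton_self _,
          le_sSup hmem (Submodule.mem_span_singleton_self _)⟩
        exact hq.ne_zero ((Submodule.mem_bot R).1 this)
      · obtain hN | rfl := hN
        · exact hprime N hN
        · exact ⟨q, _, hq, rfl⟩
    rw [Submodule.disjoint_def] at hnd
    push Not at hnd
    obtain ⟨y, hy, hyS, hy0⟩ := hnd
    obtain ⟨t, rfl⟩ := Submodule.mem_span_singleton.1 hy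
    rw [← mul_smul] at hyS hy0
    exact ⟨t * r, hle hyS, hy0⟩
  have hhull : IsInjectiveHull (dsum X) (dsum fun N => hull (X N)) :=
    ⟨injective_dsum fun N => hull_injective _, _,
      dmap_injective fun N => hullι_injective (X N), dsum_essential (fun N => hullι (X N))
        fun N => hullι_essential _⟩
  obtain ⟨e⟩ := hull_equiv (Y := dsum X) ⟨hE, f, hf, hess⟩ hhull
  refine ⟨S, p, ⟨fun N => hull (X N), fun N => ?_, ⟨e⟩⟩, fun N => ⟨z N, hz N⟩⟩
  obtain ⟨e'⟩ := (hz N).quotient_equiv_span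
  exact (isInjectiveHull_hull (X N)).of_equiv (e'.trans (LinearEquiv.ofEq _ _ (hspan N).symm))

theorem IsSumOfHulls.injective [IsNoetherianRing R] {ι : Type u} {p : ι → PrimeSpectrum R} {M : ModuleCat.{u} R}
    (h : IsSumOfHulls p M) : Module.Injective R M := by
  obtain ⟨E, hE, ⟨e⟩⟩ := h
  exact injective_of_linearEquiv e (injective_dsum fun i => (hE i).1)

theorem IsSumOfHulls.assIn {ι : Type u} {p : ι → PrimeSpectrum R} {M : ModuleCat.{u} R}
    (h : IsSumOfHulls p M) {Y : Set (PrimeSpectrum R)} (hY : ∀ k, p k ∈ Y) : AssIn Y M := by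
  obtain ⟨E, hE, ⟨e⟩⟩ := h
  refine AssIn.of_injective (AssIn.dsum fun i => ?_) (f := e.toLinearMap) e.injective
  intro q z hz
  rw [(hE i).annEq_eq hz]
  exact hY i

/-- The direct sum of the chosen hulls `E(R/p)`. -/
theorem exists_sumOfHulls {ι : Type u} (p : ι → PrimeSpectrum R) :
    ∃ M : ModuleCat.{u} R, IsSumOfHulls p M :=
  ⟨dsum fun i => hull (ModuleCat.of R (R ⧸ (p i).asIdeal)), _, fun _ => isInjectiveHull_hull _,
    ⟨LinearEquiv.refl R _⟩⟩

/-- A sum of hulls contains each of its summands, and projects to it. -/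
theorem IsSumOfHulls.exists_embedding {ι : Type u} {p : ι → PrimeSpectrum R} {M : ModuleCat.{u} R}
    (h : IsSumOfHulls p M) (k : ι) {E : ModuleCat.{u} R}
    (hE : IsInjectiveHull (ModuleCat.of R (R ⧸ (p k).asIdeal)) E) :
    ∃ f : E →ₗ[R] M, Function.Injective f := by
  obtain ⟨E', hE', ⟨e⟩⟩ := h
  obtain ⟨e'⟩ := hull_equiv hE (hE' k)
  exact ⟨e.symm.toLinearMap ∘ₗ dincl E' k ∘ₗ e'.toLinearMap,
    e.symm.injective.comp ((dincl_injective k).comp e'.injective)⟩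

/-- Each Matlis summand E(R/p) of `E` embeds in one copy of `X`; injectivity of `E` splits the
resulting embedding into a sum of copies. -/
theorem inAdd_of_assIn [IsNoetherianRing R] {Y : Set (PrimeSpectrum R)} {X E : ModuleCat.{u} R}
    (hX : IsSumOfHulls (fun p : Y => (p : PrimeSpectrum R)) X) (hE : Module.Injective R E)
    (hEY : AssIn Y E) : InAdd X E := by
  obtain ⟨ι, p, ⟨F, hF, ⟨e⟩⟩, hp⟩ := exists_isSumOfHulls hE
  have hpY : ∀ k, p k ∈ Y := fun k => (hp k).elim fun z hz => hEY _ z hz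
  choose f hf using fun k => hX.exists_embedding ⟨p k, hpY k⟩ (hF k)
  exact ⟨ι, isSummand_of_injective hE (dmap f ∘ₗ e.toLinearMap)
    ((dmap_injective (X' := fun _ => X) hf).comp e.injective)⟩

/-- `𝓘(Y)` consists of the injective modules with associated primes in `Y`. -/
theorem injClass_iff [IsNoetherianRing R] {Y : Set (PrimeSpectrum R)} {E : ModuleCat.{u} R} :
    InjClass Y E ↔ Module.Injective R E ∧ AssIn Y E := by
  constructor
  · rintro ⟨X, hX, κ, h⟩
    refine ⟨h.injective_module (injective_dsum fun _ => hX.injective), ?_⟩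
    obtain ⟨f, hf⟩ := h.exists_injective
    exact (AssIn.dsum fun _ => hX.assIn fun p => p.2).of_injective hf
  · rintro ⟨hE, hEY⟩
    obtain ⟨X, hX⟩ := exists_sumOfHulls fun p : Y => (p : PrimeSpectrum R)
    exact ⟨X, hX, inAdd_of_assIn hX hE hEY⟩

end Decomposition

/-! ### Sums of E(R/p) over an antichain of primes -/

section Antichain

variable {R : Type u} [CommRing R] {S : Set (PrimeSpectrum R)}
  {E : S → ModuleCat.{u} R}

/-- In the direct sum of the modules `E(R/p)`, where `p` runs through an antichain, an element with
prime annihilator is concentrated in one component. -/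
theorem AnnEq.eq_dincl (hS : IsAntichain (· ≤ ·) S)
    (hE : ∀ p : S, IsInjectiveHull (ModuleCat.of R (R ⧸ p.1.asIdeal)) (E p))
    {q : PrimeSpectrum R} {z : dsum E} (hz : AnnEq q z) :
    ∃ p : S, p.1 = q ∧ z = dincl E p (dproj E p z) := by
  obtain ⟨p, hp⟩ := hz.exists_dproj
  obtain rfl := (hE p).annEq_eq hp
  refine ⟨p, rfl, dsum_ext fun p' => ?_⟩
  by_cases hpp : p = p'
  · subst hpp; rw [dproj_dincl]
  · rw [dproj_dincl_ne hpp]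
    by_contra h0
    -- A nonzero component at `p'` would be killed by `p`, giving `p` ⊆ `p'` for distinct members of
    -- the antichain.
    obtain ⟨r, hr⟩ := (hE p').exists_annEq_smul h0
    refine hS p.2 p'.2 (fun h => hpp (Subtype.ext h)) fun s hs => (hr s).1 ?_
    rw [smul_comm, ← map_smul, (hz s).2 hs, map_zero, smul_zero]

/-- A map out of the direct sum of the modules `E(R/p)`, where `p` runs through an antichain, is
injective if it is injective on each summand. -/
theorem injective_dlift_of_antichain [IsNoetherianRing R] (hS : IsAntichain (· ≤ ·) S)
    (hE : ∀ p : S, IsInjectiveHull (ModuleCat.of R (R ⧸ p.1.asIdeal)) (E p))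
    {Z : ModuleCat.{u} R} {f : ∀ p, E p →ₗ[R] Z} (hf : ∀ p, Function.Injective (f p)) :
    Function.Injective (dlift f) := by
  rw [injective_iff_map_eq_zero]
  intro x hx
  by_contra hx0
  obtain ⟨r, q, hq⟩ := exists_annEq (R := R) hx0
  obtain ⟨p, -, hp⟩ := hq.eq_dincl hS hE
  have h0 : dlift f (r • x) = 0 := by rw [map_smul, hx, smul_zero]
  rw [hp, dlift_dincl, map_eq_zero_iff _ (hf p)] at h0
  rw [h0, map_zero] at hp
  exact hq.ne_zero hp

/-- The direct sum of the modules `E(R/p)`, where `p` runs through an antichain, has no room for a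
further injective module. -/
theorem subsingleton_of_prod_embedding [IsNoetherianRing R] (hS : IsAntichain (· ≤ ·) S)
    {K F : ModuleCat.{u} R} (hK : IsSumOfHulls (fun p : S => (p : PrimeSpectrum R)) K)
    (f : (K × F) →ₗ[R] K) (hf : Function.Injective f) : Subsingleton F := by
  obtain ⟨E, hE, ⟨e⟩⟩ := hK
  refine subsingleton_of_forall_eq 0 fun z => ?_
  by_contra hz
  obtain ⟨r, q, hq⟩ := exists_annEq (R := R) hz
  let g : (K × F) →ₗ[R] dsum E := e.toLinearMap ∘ₗ f
  have hg : Function.Injective g := e.injective.comp hf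
  have h1 : AnnEq q (g (0, r • z)) :=
    (hq.map (f := LinearMap.inr R K F) LinearMap.inr_injective).map hg
  obtain ⟨p, rfl, hp⟩ := h1.eq_dincl hS hE
  obtain ⟨x, hx⟩ := (hE p).exists_annEq
  have h2 : AnnEq p.1 (g (e.symm (dincl E p x), 0)) :=
    (((hx.map (dincl_injective p)).map (f := e.symm.toLinearMap) e.symm.injective).map
      (f := LinearMap.inl R K F) LinearMap.inl_injective).map hg
  obtain ⟨p', hpp, hp'⟩ := h2.eq_dincl hS hE
  obtain rfl : p' = p := Subtype.ext hpp
  have n1 : dproj E p' (g (0, r • z)) ≠ 0 := fun h => h1.ne_zero (by rw [hp, h, map_zero])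
  have n2 : dproj E p' (g (e.symm (dincl E p' x), 0)) ≠ 0 :=
    fun h => h2.ne_zero (by rw [hp', h, map_zero])
  -- Both images sit in the single uniform summand at `p'`, so they have a common nonzero multiple,
  -- although they come from complementary summands of `K × F`.
  obtain ⟨a, b, hab, ha⟩ := (hE p').exists_smul_eq n1 n2
  have : g (a • (0, r • z)) = g (b • (e.symm (dincl E p' x), 0)) := by
    rw [map_smul, map_smul, hp, hp', ← map_smul (dincl E p'), hab, map_smul]
  have := congrArg Prod.snd (hg this)
  have h3 : a • r • z = 0 := this.trans (smul_zero b)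
  refine ha ?_
  rw [← map_smul, ← map_smul]
  have : a • ((0 : K), r • z) = 0 := Prod.ext (by simp) h3
  rw [this, map_zero, map_zero]

end Antichain

/-! ### Reduced modules and injective covers -/

section Reduced

variable {R : Type u} [CommRing R]

/-- No nonzero injective module embeds in `X`. -/
def Red (X : ModuleCat.{u} R) : Prop :=
  ∀ F : ModuleCat.{u} R, Module.Injective R F → ∀ f : F →ₗ[R] X, Function.Injective f →
    Subsingleton F

theorem Red.of_injective {X X' : ModuleCat.{u} R} (h : Red X') (f : X →ₗ[R] X')
    (hf : Function.Injective f) : Red X :=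
  fun F hF g hg => h F hF (f ∘ₗ g) (hf.comp hg)

/-- A map from an injective module to a reduced module is nowhere injective. -/
theorem Red.exists_smul {X F : ModuleCat.{u} R} (hX : Red X) (hF : Module.Injective R F)
    (g : F →ₗ[R] X) {z : F} (hz : z ≠ 0) : ∃ r : R, r • z ≠ 0 ∧ g (r • z) = 0 := by
  -- Inside `F` take an injective hull of the cyclic submodule of `z`; `g` cannot be injective on it
  -- unless it is zero, and any kernel element has a nonzero multiple in the cyclic submodule.
  obtain ⟨T, hzT, hT, hess⟩ := exists_injective_essential hF (Submodule.span R {z})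
  have hzT : z ∈ T := hzT (Submodule.mem_span_singleton_self z)
  have hninj : ¬ Function.Injective (g ∘ₗ T.subtype) := fun h => by
    have : Subsingleton T := hX (ModuleCat.of R T) hT _ h
    exact hz (congrArg Subtype.val (Subsingleton.elim (⟨z, hzT⟩ : T) 0))
  rw [injective_iff_map_eq_zero] at hninj
  push Not at hninj
  obtain ⟨⟨y, hy⟩, hgy, hy0⟩ := hninj
  obtain ⟨s, hs, hs0⟩ := hess y hy (fun h => hy0 (Subtype.ext h))
  obtain ⟨r, hr⟩ := Submodule.mem_span_singleton.1 hs
  refine ⟨r, by rwa [hr], ?_⟩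
  rw [hr, map_smul, show g y = 0 from hgy, smul_zero]

/-- If `F → A × B` is injective, `F` is injective and `B` is reduced, then `F → A` is injective. -/
theorem Red.injective_of_jointly {A B F : ModuleCat.{u} R} (hB : Red B)
    (hF : Module.Injective R F) (f : F →ₗ[R] A) (g : F →ₗ[R] B)
    (h : ∀ z, f z = 0 → g z = 0 → z = 0) : Function.Injective f := by
  rw [injective_iff_map_eq_zero]
  intro z hz
  by_contra hz0
  obtain ⟨r, hr, hgr⟩ := hB.exists_smul hF g hz0
  exact hr (h _ (by rw [map_smul, hz, smul_zero]) hgr)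

theorem Red.prod {A B : ModuleCat.{u} R} (hA : Red A) (hB : Red B) :
    Red (ModuleCat.of R (A × B)) := by
  intro F hF f hf
  refine hA F hF (LinearMap.fst R A B ∘ₗ f) (hB.injective_of_jointly hF _
    (LinearMap.snd R A B ∘ₗ f) fun z h1 h2 => ?_)
  exact (map_eq_zero_iff f hf).1 (Prod.ext h1 h2)

theorem Red.of_subsingleton {A : ModuleCat.{u} R} (hA : Subsingleton A) : Red A :=
  fun _ _ _ hf => hf.subsingleton

/-- With `r = id - g`, the geometric series in `r` is finite at each element and inverts `g`. -/
theorem bijective_of_locally_nilpotent {E : Type u} [AddCommGroup E] [Module R E]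
    {g : E →ₗ[R] E} (h : ∀ y, ∃ n : ℕ, ((LinearMap.id - g : Module.End R E) ^ n) y = 0) :
    Function.Bijective g := by
  set r : Module.End R E := LinearMap.id - g with hr
  have hg : ∀ x, g x = x - r x := fun x => by simp [hr]
  constructor
  · rw [injective_iff_map_eq_zero]
    intro x hx
    have hrx : r x = x := by
      have := hg x
      rw [hx] at this
      exact (sub_eq_zero.1 this.symm).symm
    obtain ⟨n, hn⟩ := h x
    have : (r ^ n) x = x := by
      clear hn
      induction n with
      | zero => rfl
      | succ n ih => rw [pow_succ, Module.End.mul_apply, hrx, ih]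
    rw [← this, hn]
  · intro y
    obtain ⟨n, hn⟩ := h y
    refine ⟨(∑ i ∈ Finset.range n, r ^ i) y, ?_⟩
    have key : (∑ i ∈ Finset.range n, r ^ i) y - r ((∑ i ∈ Finset.range n, r ^ i) y) =
        y - (r ^ n) y := LinearMap.congr_fun (mul_neg_geom_sum r n) y
    rw [hg, key, hn, sub_zero]

/-- A precover by an injective module with reduced kernel is a cover. -/
theorem isCover_of_red_ker [IsNoetherianRing R] {𝒞 : ObjectProperty (ModuleCat.{u} R)}
    {E M : ModuleCat.{u} R} {f : E →ₗ[R] M} (hE : Module.Injective R E) (hf : IsPrecover 𝒞 f)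
    (hker : Red (ModuleCat.of R (LinearMap.ker f))) : IsCover 𝒞 f := by
  refine ⟨hf, fun g hg => bijective_of_locally_nilpotent fun y => ?_⟩
  set r : Module.End R E := LinearMap.id - g with hr
  have hfr : ∀ x, f (r x) = 0 := fun x => by
    have := LinearMap.congr_fun hg x
    simp only [LinearMap.comp_apply] at this
    simp [hr, ← this]
  -- The annihilators of the elements `(r ^ n) y` increase, hence stabilize. If `(r ^ n) y` were
  -- nonzero at the stable stage, reducedness of the kernel would give a nonzero multiple of it
  -- killed by `r`, enlarging the annihilator.
  let J : ℕ →o Ideal R :=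
    { toFun := fun n => LinearMap.ker (LinearMap.toSpanSingleton R E ((r ^ n) y))
      monotone' := monotone_nat_of_le_succ fun n s hs => by
        rw [LinearMap.mem_ker, LinearMap.toSpanSingleton_apply] at hs ⊢
        rw [pow_succ', Module.End.mul_apply, ← map_smul, hs, map_zero] }
  obtain ⟨n, hn⟩ := monotone_stabilizes_iff_noetherian.2 ‹IsNoetherianRing R› J
  refine ⟨n, ?_⟩
  by_contra h0
  obtain ⟨s, hs, hs0⟩ := hker.exists_smul hE
    (r.codRestrict (LinearMap.ker f) hfr : E →ₗ[R] LinearMap.ker f) h0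
  have h1 : s ∈ J (n + 1) := by
    change s • (r ^ (n + 1)) y = 0
    rw [pow_succ', Module.End.mul_apply, ← map_smul]
    exact congrArg Subtype.val hs0
  rw [← hn (n + 1) n.le_succ] at h1
  exact hs h1

/-- The kernel of a cover by an injective module is reduced. -/
theorem IsCover.red_ker {𝒞 : ObjectProperty (ModuleCat.{u} R)} {E M : ModuleCat.{u} R}
    {f : E →ₗ[R] M} (hf : IsCover 𝒞 f) : Red (ModuleCat.of R (LinearMap.ker f)) := by
  intro F hF j hj
  obtain ⟨r, hr⟩ := hF.out ((LinearMap.ker f).subtype ∘ₗ j)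
    ((LinearMap.ker f).subtype_injective.comp hj) LinearMap.id
  -- Subtracting the projection onto the copy of `F` does not change `f`, so the cover property
  -- makes the difference bijective; but it kills that copy.
  have hg := hf.2 (LinearMap.id - (LinearMap.ker f).subtype ∘ₗ j ∘ₗ r) (LinearMap.ext fun x => by
    simp)
  refine subsingleton_of_forall_eq 0 fun z => hj ?_
  rw [map_zero]
  refine Subtype.ext (hg.1 ?_)
  have : r (j z : E) = z := hr z
  simp [this]

/-- The union of a chain of injective submodules is injective. -/
theorem injective_sSup_chain [IsNoetherianRing R] {E : Type u} [AddCommGroup E] [Module R E]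
    {c : Set (Submodule R E)} (hne : c.Nonempty) (hchain : IsChain (· ≤ ·) c)
    (hc : ∀ N ∈ c, Module.Injective R N) : Module.Injective R (sSup c : Submodule R E) := by
  refine Module.Baer.injective fun I g => ?_
  have hdir := hchain.directedOn
  -- By finite generation of the ideal, the whole image of `g` already lies in one member of the
  -- chain.
  obtain ⟨N, hN, hgN⟩ : ∃ N ∈ c, ∀ a : I, (g a : E) ∈ N := by
    obtain ⟨t, ht⟩ := (Module.Finite.iff_fg.2 (IsNoetherian.noetherian I) : Module.Finite R I).1
    have key : ∀ s : Finset I, ∃ N ∈ c, ∀ a ∈ s, (g a : E) ∈ N := by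
      classical
      intro s
      induction s using Finset.induction_on with
      | empty => exact hne.imp fun N hN => ⟨hN, by simp⟩
      | insert a s has ih =>
        obtain ⟨N, hN, hs⟩ := ih
        obtain ⟨N', hN', ha⟩ := (Submodule.mem_sSup_of_directed hne hdir).1 (g a).2
        obtain ⟨N'', hN'', h1, h2⟩ := hdir N hN N' hN'
        refine ⟨N'', hN'', fun b hb => ?_⟩
        obtain rfl | hb := Finset.mem_insert.1 hb
        · exact h2 ha
        · exact h1 (hs b hb)
    obtain ⟨N, hN, h⟩ := key t
    refine ⟨N, hN, fun a => ?_⟩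
    have : (⊤ : Submodule R I) ≤ N.comap ((sSup c).subtype ∘ₗ g) := by
      rw [← ht, Submodule.span_le]
      exact fun a ha => h a ha
    exact this (Submodule.mem_top (x := a))
  obtain ⟨g', hg'⟩ := Module.Baer.of_injective (hc N hN) I
    (((sSup c).subtype ∘ₗ g).codRestrict N hgN)
  refine ⟨Submodule.inclusion (le_sSup hN) ∘ₗ g', fun x hx => Subtype.ext ?_⟩
  exact congrArg (fun y : N => (y : E)) (hg' x hx)

/-- Every module has an `𝓘(Y)`-precover. -/
theorem exists_isPrecover [IsNoetherianRing R] (Y : Set (PrimeSpectrum R)) (M : ModuleCat.{u} R) :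
    ∃ (E : ModuleCat.{u} R) (f : E →ₗ[R] M), IsPrecover (InjClass Y) f := by
  obtain ⟨X, hX⟩ := exists_sumOfHulls fun p : Y => (p : PrimeSpectrum R)
  -- One copy of `X` for every homomorphism `X → M`, with the evaluation map.
  refine ⟨dsum fun _ : X →ₗ[R] M => X, dlift fun h => h, ⟨X, hX, _, IsSummand.refl _⟩,
    fun E' hE' f' => ?_⟩
  obtain ⟨hinj, hass⟩ := injClass_iff.1 hE'
  obtain ⟨κ, i, r, hri⟩ := inAdd_of_assIn hX hinj hass
  refine ⟨dlift (fun k => dincl (fun _ : X →ₗ[R] M => X)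
    (f' ∘ₗ r ∘ₗ dincl (fun _ => X) k)) ∘ₗ i, ?_⟩
  have : dlift (fun h => h) ∘ₗ dlift (fun k => dincl (fun _ : X →ₗ[R] M => X)
      (f' ∘ₗ r ∘ₗ dincl (fun _ => X) k)) = f' ∘ₗ r := by
    refine dsum_hom_ext (E := fun _ => X) fun k => LinearMap.ext fun x => ?_
    simp only [LinearMap.comp_apply]
    rw [dlift_dincl (E := fun _ => X), dlift_dincl (E := fun _ => X)]
    rfl
  rw [← LinearMap.comp_assoc, this, LinearMap.comp_assoc, hri, LinearMap.comp_id]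

/-- Every module has an `𝓘(Y)`-cover. -/
theorem exists_isCover [IsNoetherianRing R] (Y : Set (PrimeSpectrum R)) (M : ModuleCat.{u} R) :
    ∃ (E : ModuleCat.{u} R) (f : E →ₗ[R] M), IsCover (InjClass Y) f := by
  obtain ⟨E, f, hEY, hf⟩ := exists_isPrecover Y M
  obtain ⟨hE, hass⟩ := injClass_iff.1 hEY
  -- Split off from the precover a maximal injective submodule `N` of its kernel; the remaining
  -- summand is still a precover, now with reduced kernel.
  obtain ⟨N, -, hN⟩ := zorn_le_nonempty₀
    {N : Submodule R E | Module.Injective R N ∧ N ≤ LinearMap.ker f}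
    (fun c hc hchain N hN => ⟨sSup c,
      ⟨injective_sSup_chain ⟨N, hN⟩ hchain fun N hN => (hc hN).1, sSup_le fun N hN => (hc hN).2⟩,
      fun _ => le_sSup⟩)
    ⊥ ⟨injective_of_subsingleton, bot_le⟩
  obtain ⟨hNinj, hNker⟩ := hN.prop
  obtain ⟨ρ, hρ⟩ := hNinj.out N.subtype N.subtype_injective LinearMap.id
  have hρ : ∀ x : N, ρ x = x := hρ
  let E' : ModuleCat.{u} R := ModuleCat.of R (LinearMap.ker ρ)
  let f' : E' →ₗ[R] M := f ∘ₗ (LinearMap.ker ρ).subtype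
  let π : E →ₗ[R] E' := (LinearMap.id - N.subtype ∘ₗ ρ).codRestrict (LinearMap.ker ρ) fun x => by
    simp [hρ]
  have hE' : IsSummand E' E := ⟨(LinearMap.ker ρ).subtype, π, by
    refine LinearMap.ext fun x => Subtype.ext ?_
    have hx : ρ x.1 = 0 := x.2
    change x.1 - (ρ x.1 : E) = x.1
    rw [hx, ZeroMemClass.coe_zero, sub_zero]⟩
  have hE'inj := hE'.injective_module hE
  refine ⟨E', f', isCover_of_red_ker hE'inj
    ⟨injClass_iff.2 ⟨hE'inj, hass.of_injective (LinearMap.ker ρ).subtype_injective⟩,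
      fun E'' hE'' f'' => ?_⟩ fun F hF j hj => ?_⟩
  · obtain ⟨g, rfl⟩ := hf E'' hE'' f''
    refine ⟨π ∘ₗ g, LinearMap.ext fun x => ?_⟩
    have : f (ρ (g x) : E) = 0 := hNker (ρ (g x)).2
    change f (g x) = f (g x - (ρ (g x) : E))
    rw [map_sub, this, sub_zero]
  · let k : F →ₗ[R] E := (LinearMap.ker ρ).subtype ∘ₗ (LinearMap.ker f').subtype ∘ₗ j
    have hk : Function.Injective k := (Submodule.subtype_injective _).comp
      ((Submodule.subtype_injective _).comp hj)
    have hρk : ∀ x, ρ (k x) = 0 := fun x => (j x).1.2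
    have hfk : ∀ x, f (k x) = 0 := fun x => (j x).2
    let l : (N × F) →ₗ[R] E := N.subtype.coprod k
    have hl : Function.Injective l := by
      rw [injective_iff_map_eq_zero]
      rintro ⟨x, y⟩ hxy
      have hxy : (x : E) + k y = 0 := by simpa [l] using hxy
      have hx : x = 0 := by
        have := congrArg ρ hxy
        rwa [map_add, hρ, hρk, add_zero, map_zero] at this
      rw [hx] at hxy ⊢
      have : k y = 0 := by simpa using hxy
      rw [(map_eq_zero_iff k hk).1 this]
      rfl
    -- An injective `F` in the remaining kernel would make `N ⊕ F` an injective submodule of `ker f`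
    -- containing `N`.
    have hle : LinearMap.range l ≤ N := hN.le_of_ge
      ⟨injective_of_linearEquiv (LinearEquiv.ofInjective l hl).symm (injective_prod hNinj hF), by
        rintro _ ⟨⟨x, y⟩, rfl⟩
        have : f (x : E) = 0 := hNker x.2
        simp [l, hfk, this]⟩
      fun x hx => ⟨(⟨x, hx⟩, 0), by simp [l]⟩
    refine subsingleton_of_forall_eq 0 fun z => hk ?_
    have hz : k z ∈ N := hle ⟨(0, z), by simp [l]⟩
    have := hρ ⟨k z, hz⟩
    rw [map_zero]
    have h0 : ρ (k z) = ⟨k z, hz⟩ := this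
    rw [hρk] at h0
    exact (congrArg Subtype.val h0).symm

/-- If no nonzero injective module with associated primes in
`Y` embeds in `K`, the kernel of any map `E → K` with `E ∈ 𝓘(Y)` is essential. -/
theorem ker_essential_of_injClass [IsNoetherianRing R] {Y : Set (PrimeSpectrum R)}
    {E K : ModuleCat.{u} R} (hE : InjClass Y E) (f : E →ₗ[R] K)
    (hK : ∀ F : ModuleCat.{u} R, InjClass Y F → ∀ g : F →ₗ[R] K, Function.Injective g →
      Subsingleton F) : IsEssential (LinearMap.ker f) := by
  obtain ⟨hE, hass⟩ := injClass_iff.1 hE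
  intro L hL
  -- A hull `T` of `L` in `E` still avoids the kernel, so `f` embeds it in `K`, and its associated
  -- primes are among those of `E`.
  obtain ⟨T, hLT, hT, hess⟩ := exists_injective_essential hE L
  have hinj : Function.Injective (f ∘ₗ T.subtype) := by
    rw [injective_iff_map_eq_zero]
    rintro ⟨x, hx⟩ hfx
    by_contra h0
    obtain ⟨r, hrL, hr⟩ := hess x hx (fun h => h0 (Subtype.ext h))
    refine hr ((Submodule.mem_bot R).1 (hL ▸ ⟨hrL, ?_⟩))
    exact (LinearMap.ker f).smul_mem r hfx
  have := hK (ModuleCat.of R T) (injClass_iff.2 ⟨hT, hass.of_injective T.subtype_injective⟩) _ hinj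
  rw [eq_bot_iff]
  intro x hx
  exact (Submodule.mem_bot R).2
    (congrArg Subtype.val (Subsingleton.elim (α := T) ⟨x, hLT hx⟩ 0))

end Reduced

/-! ### The classes `𝒞(Y₀, Y₁, …)` in terms of cosyzygies -/

section CosyzygyClass

variable {R : Type u} [CommRing R]

/-- The first `k` cosyzygies of `X` have their associated primes in `Y 0, …, Y (k - 1)`. -/
def Cc : ℕ → (ℕ → Set (PrimeSpectrum R)) → ModuleCat.{u} R → Prop
  | 0, _, _ => True
  | k + 1, Y, X => AssIn (Y 0) X ∧ Cc k (fun i => Y (i + 1)) (mho X)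

/-- All cosyzygies of `X` have their associated primes in `Y 0, Y 1, …`. -/
def CcA (Y : ℕ → Set (PrimeSpectrum R)) (X : ModuleCat.{u} R) : Prop := ∀ k, Cc k Y X

variable {Y : ℕ → Set (PrimeSpectrum R)} {A B C X X' I : ModuleCat.{u} R}

theorem Cc.of_isSummand {k : ℕ} (h : IsSummand X X') (hX : Cc k Y X') : Cc k Y X := by
  induction k generalizing X X' Y with
  | zero => trivial
  | succ k ih =>
    obtain ⟨f, hf⟩ := h.exists_injective
    exact ⟨hX.1.of_injective hf, ih h.mho hX.2⟩

theorem CcA.of_isSummand (h : IsSummand X X') (hX : CcA Y X') : CcA Y X :=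
  fun k => (hX k).of_isSummand h

theorem CcA.of_equiv (e : X ≃ₗ[R] X') (hX : CcA Y X') : CcA Y X :=
  hX.of_isSummand (isSummand_of_equiv e)

theorem Cc.mono {Y' : ℕ → Set (PrimeSpectrum R)} (hY : ∀ i, Y i ⊆ Y' i) {k : ℕ} (h : Cc k Y X) :
    Cc k Y' X := by
  induction k generalizing X Y Y' with
  | zero => trivial
  | succ k ih => exact ⟨h.1.mono (hY 0), ih (fun i => hY (i + 1)) h.2⟩

theorem Cc.of_subsingleton (hX : Subsingleton X) (k : ℕ) : Cc k Y X := by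
  induction k generalizing X Y with
  | zero => trivial
  | succ k ih =>
    exact ⟨fun p z hz => (hz.ne_zero (Subsingleton.elim z 0)).elim,
      ih (subsingleton_mho injective_of_subsingleton)⟩

theorem ccA_iff : CcA Y X ↔ AssIn (Y 0) X ∧ CcA (fun i => Y (i + 1)) (mho X) :=
  ⟨fun h => ⟨(h 1).1, fun k => (h (k + 1)).2⟩, fun h k => by
    cases k with
    | zero => trivial
    | succ k => exact ⟨h.1, h.2 k⟩⟩

theorem CcA.mono {Y' : ℕ → Set (PrimeSpectrum R)} (hY : ∀ i, Y i ⊆ Y' i) (h : CcA Y X) :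
    CcA Y' X := fun k => (h k).mono hY

theorem CcA.assIn_mhoN (h : CcA Y X) (i : ℕ) : AssIn (Y i) (mhoN i X) := by
  induction i generalizing X Y with
  | zero => exact (ccA_iff.1 h).1
  | succ i ih =>
    rw [mhoN_succ']
    exact ih (Y := fun i => Y (i + 1)) (ccA_iff.1 h).2

theorem ccA_of_assIn_mhoN (h : ∀ i, AssIn (Y i) (mhoN i X)) : CcA Y X := by
  intro k
  induction k generalizing X Y with
  | zero => trivial
  | succ k ih => exact ⟨h 0, ih fun i => mhoN_succ' i X ▸ h (i + 1)⟩

theorem ccA_of_injective (hX : Module.Injective R X) (h : AssIn (Y 0) X) : CcA Y X :=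
  ccA_iff.2 ⟨h, fun k => Cc.of_subsingleton (subsingleton_mho hX) k⟩

/-- The classes may be tested on arbitrary injective coresolutions. -/
theorem Cc.of_exact {f : A →ₗ[R] I} {g : I →ₗ[R] B} (hf : Function.Injective f)
    (hfg : Function.Exact f g) (hg : Function.Surjective g) (hI : Module.Injective R I)
    (hass : AssIn (Y 0) I) {k : ℕ} (hB : Cc k (fun i => Y (i + 1)) B) : Cc (k + 1) Y A :=
  ⟨hass.of_injective hf, hB.of_isSummand ((IsSummand.refl A).mho_of_exact hI hf hfg hg)⟩

theorem CcA.of_exact {f : A →ₗ[R] I} {g : I →ₗ[R] B} (hf : Function.Injective f)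
    (hfg : Function.Exact f g) (hg : Function.Surjective g) (hI : Module.Injective R I)
    (hass : AssIn (Y 0) I) (hB : CcA (fun i => Y (i + 1)) B) : CcA Y A := fun k => by
  cases k with
  | zero => trivial
  | succ k => exact Cc.of_exact hf hfg hg hI hass (hB k)

theorem AssIn.hull {Y : Set (PrimeSpectrum R)} (h : AssIn Y X) : AssIn Y (hull X) :=
  h.of_essential (hullι_injective X) (hullι_essential X)

/-- The classes are closed under extensions. -/
theorem Cc.ext {f : A →ₗ[R] B} {g : B →ₗ[R] C} (hf : Function.Injective f)
    (hfg : Function.Exact f g) (hg : Function.Surjective g) {k : ℕ} (hA : Cc k Y A)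
    (hC : Cc k Y C) : Cc k Y B := by
  induction k generalizing A B C Y with
  | zero => trivial
  | succ k ih =>
    obtain ⟨a, ha⟩ := (hull_injective A).out f hf (hullι A)
    -- Horseshoe construction: the cokernel of `j` is an extension of `mho C` by `mho A`, so
    -- induction applies. The coresolution obtained need not be minimal.
    let j : B →ₗ[R] hull A × hull C := a.prod (hullι C ∘ₗ g)
    have hj : Function.Injective j := by
      rw [injective_iff_map_eq_zero]
      intro x hx
      have h2 : hullι C (g x) = 0 := congrArg Prod.snd hx
      obtain ⟨y, rfl⟩ := (hfg x).1 ((map_eq_zero_iff _ (hullι_injective C)).1 h2)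
      have h1 : a (f y) = 0 := congrArg Prod.fst hx
      rw [ha, map_eq_zero_iff _ (hullι_injective A)] at h1
      rw [h1, map_zero]
    let Z : ModuleCat.{u} R := ModuleCat.of R ((hull A × hull C) ⧸ LinearMap.range j)
    let π : (hull A × hull C) →ₗ[R] Z := (LinearMap.range j).mkQ
    have hπ : Function.Surjective π := Submodule.mkQ_surjective _
    have hjπ : Function.Exact j π := LinearMap.exact_map_mkQ_range _
    obtain ⟨s, hs⟩ := exists_map_coker (B' := ModuleCat.of R (hull A × hull C)) (C' := Z)
      (hullι_mhoπ_exact A) (mhoπ_surjective A) hjπ f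
      (LinearMap.inl R (hull A) (hull C)) (LinearMap.ext fun x => by
        have : g (f x) = 0 := hfg.apply_apply_eq_zero x
        exact Prod.ext (ha x).symm (by simp [j, this]))
    obtain ⟨t, ht⟩ := exists_map_coker (B := ModuleCat.of R (hull A × hull C)) (C := Z)
      hjπ hπ (hullι_mhoπ_exact C) g (LinearMap.snd R (hull A) (hull C)) rfl
    have hs : ∀ x, s (mhoπ A x) = π (x, 0) := LinearMap.congr_fun hs
    have ht : ∀ x, t (π x) = mhoπ C x.2 := LinearMap.congr_fun ht
    refine Cc.of_exact (I := ModuleCat.of R (hull A × hull C)) (B := Z) hj hjπ hπ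
      (injective_prod (hull_injective A) (hull_injective C)) (hA.1.hull.prod hC.1.hull)
      (ih (f := s) (g := t) ?_ ?_ ?_ hA.2 hC.2)
    · rw [injective_iff_map_eq_zero]
      intro x hx
      obtain ⟨x, rfl⟩ := mhoπ_surjective A x
      rw [hs] at hx
      obtain ⟨b, hb⟩ := (hjπ _).1 hx
      have h2 : hullι C (g b) = 0 := congrArg Prod.snd hb
      obtain ⟨y, rfl⟩ := (hfg b).1 ((map_eq_zero_iff _ (hullι_injective C)).1 h2)
      have h1 : a (f y) = x := congrArg Prod.fst hb
      rw [ha] at h1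
      rw [← h1, (hullι_mhoπ_exact A).apply_apply_eq_zero]
    · intro z
      obtain ⟨⟨x, y⟩, rfl⟩ := hπ z
      rw [ht]
      constructor
      · intro h
        obtain ⟨c, hc⟩ := (hullι_mhoπ_exact C _).1 h
        obtain ⟨b, rfl⟩ := hg c
        refine ⟨mhoπ A (x - a b), ?_⟩
        rw [hs, ← sub_eq_zero, ← map_sub]
        refine (hjπ _).2 ⟨-b, Prod.ext ?_ ?_⟩
        · simp [j]
        · have hc : hullι C (g b) = y := hc
          simp [j, hc]
      · rintro ⟨w, hw⟩
        obtain ⟨w, rfl⟩ := mhoπ_surjective A w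
        rw [hs] at hw
        rw [← ht (x, y), ← hw, ht, map_zero]
    · intro z
      obtain ⟨y, rfl⟩ := mhoπ_surjective C z
      exact ⟨π (0, y), ht _⟩

/-- Kernels of epimorphisms. -/
theorem Cc.ker {f : A →ₗ[R] B} {g : B →ₗ[R] C} (hf : Function.Injective f)
    (hfg : Function.Exact f g) (hg : Function.Surjective g) {k : ℕ} (hB : Cc (k + 1) Y B)
    (hC : Cc k (fun i => Y (i + 1)) C) : Cc (k + 1) Y A := by
  -- The cokernel of `A → hull B` is an extension of `mho B` by `C`, both of which belong to the
  -- shifted class.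
  let j : A →ₗ[R] hull B := hullι B ∘ₗ f
  have hj : Function.Injective j := (hullι_injective B).comp hf
  let Z : ModuleCat.{u} R := ModuleCat.of R (hull B ⧸ LinearMap.range j)
  let π : hull B →ₗ[R] Z := (LinearMap.range j).mkQ
  have hπ : Function.Surjective π := Submodule.mkQ_surjective _
  have hjπ : Function.Exact j π := LinearMap.exact_map_mkQ_range _
  obtain ⟨s, hs⟩ := exists_map_coker (C' := Z) hfg hg hjπ LinearMap.id (hullι B) rfl
  obtain ⟨t, ht⟩ := exists_map_coker (C := Z) hjπ hπ (hullι_mhoπ_exact B) f LinearMap.id rfl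
  have hs : ∀ x, s (g x) = π (hullι B x) := LinearMap.congr_fun hs
  have ht : ∀ x, t (π x) = mhoπ B x := LinearMap.congr_fun ht
  refine Cc.of_exact hj hjπ hπ (hull_injective B) hB.1.hull (Cc.ext (f := s) (g := t) ?_ ?_ ?_ hC hB.2)
  · rw [injective_iff_map_eq_zero]
    intro x hx
    obtain ⟨x, rfl⟩ := hg x
    rw [hs] at hx
    obtain ⟨y, hy⟩ := (hjπ _).1 hx
    rw [← hullι_injective B hy, hfg.apply_apply_eq_zero]
  · intro z
    obtain ⟨x, rfl⟩ := hπ z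
    rw [ht]
    constructor
    · intro h
      obtain ⟨b, rfl⟩ := (hullι_mhoπ_exact B x).1 h
      exact ⟨g b, hs b⟩
    · rintro ⟨c, hc⟩
      obtain ⟨b, rfl⟩ := hg c
      rw [← ht, ← hc, hs, ht, (hullι_mhoπ_exact B).apply_apply_eq_zero]
  · intro z
    obtain ⟨x, rfl⟩ := mhoπ_surjective B z
    exact ⟨π x, ht x⟩

theorem CcA.ker {f : A →ₗ[R] B} {g : B →ₗ[R] C} (hf : Function.Injective f)
    (hfg : Function.Exact f g) (hg : Function.Surjective g) (hB : CcA Y B)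
    (hC : CcA (fun i => Y (i + 1)) C) : CcA Y A := fun k => by
  cases k with
  | zero => trivial
  | succ k => exact Cc.ker hf hfg hg (hB _) (hC _)

section Noetherian

variable [IsNoetherianRing R]

/-- Products of hulls give an injective coresolution step, and `Cc.of_exact` does not ask for
minimality; closure under generalization controls the associated primes of the products. -/
theorem Cc.pi (hY : ∀ i, IsLowerSet (Y i)) {ι : Type u} {X : ι → ModuleCat.{u} R} {k : ℕ}
    (h : ∀ i, Cc k Y (X i)) : Cc k Y (ModuleCat.of R (∀ i, X i)) := by
  induction k generalizing X Y with
  | zero => trivial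
  | succ k ih =>
    have := fun i => hull_injective (X i)
    exact Cc.of_exact (A := ModuleCat.of R (∀ i, X i)) (I := ModuleCat.of R (∀ i, hull (X i)))
      (B := ModuleCat.of R (∀ i, mho (X i)))
      (piMap_injective fun i => hullι_injective (X i)) (piMap_exact fun i => hullι_mhoπ_exact (X i))
      (piMap_surjective fun i => mhoπ_surjective (X i))
      (inferInstanceAs (Module.Injective R (∀ i, hull (X i))))
      (AssIn.pi (X := fun i => hull (X i)) (hY 0) fun i => (h i).1.hull)
      (ih (fun i => hY (i + 1)) fun i => (h i).2)

theorem CcA.pi (hY : ∀ i, IsLowerSet (Y i)) {ι : Type u} {X : ι → ModuleCat.{u} R}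
    (h : ∀ i, CcA Y (X i)) : CcA Y (ModuleCat.of R (∀ i, X i)) :=
  fun k => Cc.pi hY fun i => h i k

theorem Cc.dsum {ι : Type u} {X : ι → ModuleCat.{u} R} {k : ℕ}
    (h : ∀ i, Cc k Y (X i)) : Cc k Y (dsum X) := by
  induction k generalizing X Y with
  | zero => trivial
  | succ k ih =>
    refine Cc.of_exact (I := MinCotilt.dsum fun i => hull (X i))
      (B := MinCotilt.dsum fun i => mho (X i)) (f := dmap fun i => hullι (X i))
      (g := dmap fun i => mhoπ (X i)) ?_ ?_ ?_ (injective_dsum fun i => hull_injective (X i))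
      (AssIn.dsum fun i => (h i).1.hull) (ih fun i => (h i).2)
    · exact dmap_injective fun i => hullι_injective (X i)
    · intro y
      constructor
      · intro hy
        obtain ⟨s, hs⟩ := finite_support y
        have hex : ∀ i, ∃ x, hullι (X i) x = dproj _ i y := fun i => by
          refine (hullι_mhoπ_exact (X i) _).1 ?_
          rw [← dproj_dmap (fun i => mhoπ (X i)), hy, map_zero]
        choose x hx using hex
        obtain ⟨z, hz, hz'⟩ := exists_truncation s x
        refine ⟨z, dsum_ext fun i => ?_⟩
        rw [dproj_dmap]
        by_cases hi : i ∈ s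
        · rw [hz i hi, hx]
        · rw [hz' i hi, hs i hi, map_zero]
      · rintro ⟨x, rfl⟩
        refine dsum_ext fun i => ?_
        rw [dproj_dmap, dproj_dmap, (hullι_mhoπ_exact (X i)).apply_apply_eq_zero, map_zero]
    · intro y
      obtain ⟨s, hs⟩ := finite_support y
      choose x hx using fun i => mhoπ_surjective (X i) (dproj (fun i => mho (X i)) i y)
      obtain ⟨z, hz, hz'⟩ := exists_truncation s x
      refine ⟨z, dsum_ext fun i => ?_⟩
      rw [dproj_dmap]
      by_cases hi : i ∈ s
      · rw [hz i hi, hx]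
      · rw [hz' i hi, hs i hi, map_zero]

/-- If `R` belongs to the class, then every module is a quotient of a projective module in the
class. -/
theorem exists_projective_ccA (hR : CcA Y (ModuleCat.of R R)) (X : ModuleCat.{u} R) :
    ∃ (P : ModuleCat.{u} R) (f : P →ₗ[R] X), Module.Projective R P ∧ CcA Y P ∧
      Function.Surjective f := by
  classical
  refine ⟨dsum fun _ : X => ModuleCat.of R R, dlift fun x => LinearMap.toSpanSingleton R X x,
    ?_, fun k => Cc.dsum fun _ => hR k, fun x => ⟨dincl (fun _ => ModuleCat.of R R) x (1 : R), ?_⟩⟩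
  · exact inferInstanceAs (Module.Projective R (DirectSum X fun _ => R))
  · rw [dlift_dincl]
    exact one_smul R x

end Noetherian

end CosyzygyClass

/-! ### The minimal injective coresolution as a complex -/

section MinimalResolution

variable {R : Type u} [CommRing R]

theorem function_exact_of_exact {A B C : ModuleCat.{u} R} {f : A ⟶ B} {g : B ⟶ C} {w : f ≫ g = 0}
    (h : (ShortComplex.mk f g w).Exact) : Function.Exact f.hom g.hom :=
  (ShortComplex.ShortExact.moduleCat_exact_iff_function_exact _).1 h

/-- The cosyzygies of a minimal injective coresolution. -/
theorem cosyzygy_equiv {X : ModuleCat.{u} R} (I : InjectiveResolution X)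
    (hI : IsMinimalResolution I) (i : ℕ) : Nonempty (mhoN i X ≃ₗ[R] cosyzygy I i) := by
  induction i with
  | zero =>
    have hex := function_exact_of_exact I.exact₀
    have hinj : Function.Injective (I.ι.f 0).hom :=
      (ModuleCat.mono_iff_injective _).1 inferInstance
    let e := ((HomologicalComplex.singleObjXSelf (ComplexShape.up ℕ) 0 X).symm).toLinearEquiv
    refine ⟨e.trans (LinearEquiv.ofBijective ((I.ι.f 0).hom.codRestrict (cosyzygy I 0)
      fun x => hex.apply_apply_eq_zero x) ⟨?_, ?_⟩)⟩
    · intro x y h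
      exact hinj (congrArg Subtype.val h)
    · rintro ⟨y, hy⟩
      obtain ⟨x, hx⟩ := (hex y).1 hy
      exact ⟨x, Subtype.ext hx⟩
  | succ i ih =>
    obtain ⟨e⟩ := ih
    obtain ⟨e'⟩ := mho_equiv (N := ModuleCat.of R (cosyzygy I i)) e
    have hex := function_exact_of_exact (I.exact_succ i)
    let d : I.cocomplex.X i →ₗ[R] cosyzygy I (i + 1) :=
      (I.cocomplex.d i (i + 1)).hom.codRestrict (cosyzygy I (i + 1))
        fun x => hex.apply_apply_eq_zero x
    have hexact : Function.Exact (cosyzygy I i).subtype d := fun x =>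
      ⟨fun h => ⟨⟨x, congrArg Subtype.val h⟩, rfl⟩, by rintro ⟨y, rfl⟩; exact Subtype.ext y.2⟩
    have hsurj : Function.Surjective d := by
      rintro ⟨y, hy⟩
      obtain ⟨x, hx⟩ := (hex y).1 hy
      exact ⟨x, Subtype.ext hx⟩
    obtain ⟨e''⟩ := mho_equiv_of_exact (X := ModuleCat.of R (cosyzygy I i)) (G := I.cocomplex.X i)
      (Z := ModuleCat.of R (cosyzygy I (i + 1))) (f := (cosyzygy I i).subtype) (g := d)
      ((Module.injective_iff_injective_object R _).2 (I.injective i))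
      (Submodule.subtype_injective _) (by rw [Submodule.range_subtype]; exact hI i) hexact hsurj
    exact ⟨e'.trans e''⟩

/-- The differential of the minimal injective coresolution. -/
noncomputable def minD (X : ModuleCat.{u} R) (i : ℕ) : hull (mhoN i X) ⟶ hull (mhoN (i + 1) X) :=
  ModuleCat.ofHom (hullι (mhoN (i + 1) X) ∘ₗ mhoπ (mhoN i X))

theorem ker_minD (X : ModuleCat.{u} R) (i : ℕ) :
    LinearMap.ker (minD X i).hom = LinearMap.range (hullι (mhoN i X)) := by
  ext x
  rw [LinearMap.mem_ker]
  change hullι _ (mhoπ _ x) = 0 ↔ _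
  rw [map_eq_zero_iff _ (hullι_injective _)]
  exact hullι_mhoπ_exact (mhoN i X) x

theorem minD_exact (X : ModuleCat.{u} R) (i : ℕ) :
    Function.Exact (minD X i).hom (minD X (i + 1)).hom := by
  intro x
  rw [← LinearMap.mem_ker, ker_minD]
  constructor
  · rintro ⟨y, rfl⟩
    obtain ⟨z, rfl⟩ := mhoπ_surjective (mhoN i X) y
    exact ⟨z, rfl⟩
  · rintro ⟨z, rfl⟩
    exact ⟨mhoπ (mhoN i X) z, rfl⟩

theorem minD_comp (X : ModuleCat.{u} R) (i : ℕ) : minD X i ≫ minD X (i + 1) = 0 := by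
  ext x
  exact (minD_exact X i).apply_apply_eq_zero x

/-- The minimal injective coresolution, as a complex. -/
noncomputable def minComplex (X : ModuleCat.{u} R) : CochainComplex (ModuleCat.{u} R) ℕ :=
  CochainComplex.of (fun i => hull (mhoN i X)) (minD X) (minD_comp X)

theorem minComplex_d (X : ModuleCat.{u} R) (i : ℕ) : (minComplex X).d i (i + 1) = minD X i :=
  CochainComplex.of_d (fun i => hull (mhoN i X)) (minD X) i

theorem minComplex_exactAt (X : ModuleCat.{u} R) (i : ℕ) : (minComplex X).ExactAt (i + 1) := by
  rw [HomologicalComplex.exactAt_iff' _ i (i + 1) (i + 1 + 1) (by simp) (by simp),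
    ShortComplex.ShortExact.moduleCat_exact_iff_function_exact]
  change Function.Exact ((minComplex X).d i (i + 1)).hom ((minComplex X).d (i + 1) (i + 1 + 1)).hom
  rw [minComplex_d, minComplex_d]
  exact minD_exact X i

theorem hullι_comp_d (X : ModuleCat.{u} R) :
    ModuleCat.ofHom (hullι X) ≫ (minComplex X).d 0 1 = 0 := by
  rw [minComplex_d X 0]
  ext x
  change hullι _ (mhoπ X (hullι X x)) = 0
  rw [(hullι_mhoπ_exact X).apply_apply_eq_zero, map_zero]

/-- The minimal injective coresolution. -/
noncomputable def minResolution (X : ModuleCat.{u} R) : InjectiveResolution X where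
  cocomplex := minComplex X
  injective i := (Module.injective_iff_injective_object R _).1 (hull_injective (mhoN i X))
  ι := (CochainComplex.fromSingle₀Equiv _ _).symm ⟨ModuleCat.ofHom (hullι X), hullι_comp_d X⟩
  quasiIso := ⟨fun n => by
    cases n
    -- In degree zero the condition amounts to exactness of 0 → X → hull X → hull (mho X).
    · rw [CochainComplex.quasiIsoAt₀_iff, ShortComplex.quasiIso_iff_of_zeros]
      · refine (ShortComplex.exact_and_mono_f_iff_of_iso
          (S₂ := ShortComplex.mk _ _ (hullι_comp_d X)) ?_).2 ⟨?_, ?_⟩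
        · exact ShortComplex.isoMk (Iso.refl _) (Iso.refl _) (Iso.refl _)
            ((Category.id_comp _).trans
              ((CochainComplex.fromSingle₀Equiv_symm_apply_f_zero (C := minComplex X)
                (ModuleCat.ofHom (hullι X)) (hullι_comp_d X)).symm.trans
                (Category.comp_id (((CochainComplex.fromSingle₀Equiv (minComplex X) X).symm
                  ⟨ModuleCat.ofHom (hullι X), hullι_comp_d X⟩).f 0)).symm))
            ((Category.id_comp _).trans (Category.comp_id _).symm)
        · refine (ShortComplex.ShortExact.moduleCat_exact_iff_function_exact _).2 ?_
          change Function.Exact (hullι X) ((minComplex X).d 0 1).hom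
          rw [minComplex_d X 0]
          intro x
          exact SetLike.ext_iff.1 (ker_minD X 0) x
        · exact (ModuleCat.mono_iff_injective _).2 (hullι_injective X)
      all_goals rfl
    · rw [quasiIsoAt_iff_exactAt]
      · apply minComplex_exactAt
      · apply CochainComplex.exactAt_succ_single_obj⟩

theorem cosyzygy_minResolution (X : ModuleCat.{u} R) (i : ℕ) :
    cosyzygy (minResolution X) i = LinearMap.range (hullι (mhoN i X)) := by
  change LinearMap.ker ((minComplex X).d i (i + 1)).hom = _
  rw [minComplex_d]
  exact ker_minD X i

theorem isMinimalResolution_minResolution (X : ModuleCat.{u} R) :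
    IsMinimalResolution (minResolution X) := fun i => by
  rw [cosyzygy_minResolution]
  exact hullι_essential (mhoN i X)

/-- The class `𝒞(𝒴)` in terms of the associated primes of cosyzygies. -/
theorem cotiltClass_iff [IsNoetherianRing R] {Y : ℕ → Set (PrimeSpectrum R)} {X : ModuleCat.{u} R} :
    CotiltClass Y X ↔ CcA Y X := by
  constructor
  · rintro ⟨I, hI, h⟩
    refine ccA_of_assIn_mhoN fun i => ?_
    obtain ⟨ι, p, hp, hsum⟩ := h i
    obtain ⟨e⟩ := cosyzygy_equiv I hI i
    exact (hsum.assIn hp).of_injective (f := (cosyzygy I i).subtype ∘ₗ e.toLinearMap)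
      ((Submodule.subtype_injective _).comp e.injective)
  · intro h
    refine ⟨minResolution X, isMinimalResolution_minResolution X, fun i => ?_⟩
    obtain ⟨ι, p, hsum, hp⟩ := exists_isSumOfHulls (hull_injective (mhoN i X))
    exact ⟨ι, p, fun k => (hp k).elim fun z hz => (h.assIn_mhoN i).hull _ z hz, hsum⟩

/-- The condition on the associated primes of the cosyzygies of R says precisely that R belongs to
the class. -/
theorem IsCotiltSequence.ccA_self [IsNoetherianRing R] {n : ℕ} {Y : ℕ → Set (PrimeSpectrum R)}
    (hY : IsCotiltSequence n Y) : CcA Y (ModuleCat.of R R) := by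
  refine ccA_of_assIn_mhoN fun i p z hz => ?_
  refine hY.ass _ (isMinimalResolution_minResolution _) i p ?_
  obtain ⟨e⟩ := cosyzygy_equiv _ (isMinimalResolution_minResolution (ModuleCat.of R R)) i
  exact mem_associatedPrimes_iff.2 ⟨e z, hz.map (f := e.toLinearMap) e.injective⟩

end MinimalResolution

/-! ### Iterated kernels of injective covers -/

section IteratedKernel

variable {R : Type u} [CommRing R]

/-- The sequence `Y` shifted by `l`. -/
def sh (l : ℕ) (Y : ℕ → Set (PrimeSpectrum R)) : ℕ → Set (PrimeSpectrum R) := fun i => Y (i + l)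

theorem sh_succ (l : ℕ) (Y : ℕ → Set (PrimeSpectrum R)) :
    (fun i => sh l Y (i + 1)) = sh (l + 1) Y :=
  funext fun i => congrArg Y (by omega)

theorem sh_apply_zero (l : ℕ) (Y : ℕ → Set (PrimeSpectrum R)) : sh l Y 0 = Y l :=
  congrArg Y (zero_add l)

/-- Increasing sequences such that `R ∈ 𝒞(𝒴)`. -/
structure Good (Y : ℕ → Set (PrimeSpectrum R)) : Prop where
  mono : Monotone Y
  self : CcA Y (ModuleCat.of R R)

theorem IsCotiltSequence.good [IsNoetherianRing R] {n : ℕ} {Y : ℕ → Set (PrimeSpectrum R)}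
    (hY : IsCotiltSequence n Y) : Good Y :=
  ⟨hY.mono, hY.ccA_self⟩

/-- `K` belongs to the right orthogonal class of `𝒞(𝒴)`. -/
def QPerp (Y : ℕ → Set (PrimeSpectrum R)) (K : ModuleCat.{u} R) : Prop :=
  ∀ M, CcA Y M → LeftPerp K M

variable {Y : ℕ → Set (PrimeSpectrum R)} {l : ℕ} {E K C M X Z : ModuleCat.{u} R}

theorem QPerp.of_isSummand (h : IsSummand K Z) (hZ : QPerp Y Z) : QPerp Y K :=
  fun M hM => (hZ M hM).of_isSummand_right h

theorem CcA.sh_le (hY : Monotone Y) {l l' : ℕ} (hl : l ≤ l') (h : CcA (sh l Y) M) :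
    CcA (sh l' Y) M :=
  h.mono fun _ => hY (by omega)

theorem ker_exact (φ : E →ₗ[R] K) : Function.Exact (LinearMap.ker φ).subtype φ :=
  LinearMap.exact_subtype_ker_map φ

theorem injClass_hull [IsNoetherianRing R] {Y : Set (PrimeSpectrum R)} (h : AssIn Y M) :
    InjClass Y (hull M) :=
  injClass_iff.2 ⟨hull_injective M, h.hull⟩

/-- The cosyzygy of `M` lies in the class shifted by `l + 1`, so a map `M → K` extends to the hull
of `M`. That hull is in 𝓘(Y_l), and the extension factors through the precover. -/
theorem QPerp.exists_lift [IsNoetherianRing R] (hK : QPerp (sh (l + 1) Y) K) {φ : E →ₗ[R] K}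
    (hφ : IsPrecover (InjClass (Y l)) φ) (hM : CcA (sh l Y) M) (h : M →ₗ[R] K) :
    ∃ k : M →ₗ[R] E, φ ∘ₗ k = h := by
  obtain ⟨hass, hmho⟩ := ccA_iff.1 hM
  rw [sh_succ] at hmho
  rw [sh_apply_zero] at hass
  obtain ⟨h', hh'⟩ := ExtZero.exists_extend (hullι_injective M) (hullι_mhoπ_exact M)
    (mhoπ_surjective M) ((hK _ hmho).extZero 0) h
  obtain ⟨g, hg⟩ := hφ.2 _ (injClass_hull hass) h'
  exact ⟨g ∘ₗ hullι M, by rw [← LinearMap.comp_assoc, ← hg, hh']⟩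

/-- R itself is in the class, so the map `R → K` hitting a given element lifts. -/
theorem QPerp.surjective [IsNoetherianRing R] (hY : Good Y) (hK : QPerp (sh (l + 1) Y) K)
    {φ : E →ₗ[R] K} (hφ : IsPrecover (InjClass (Y l)) φ) : Function.Surjective φ := fun x => by
  obtain ⟨k, hk⟩ := hK.exists_lift hφ (hY.self.sh_le (l := 0) hY.mono l.zero_le)
    (LinearMap.toSpanSingleton R K x)
  refine ⟨k (1 : R), ?_⟩
  have := LinearMap.congr_fun hk (1 : R)
  rw [LinearMap.comp_apply, LinearMap.toSpanSingleton_apply, one_smul] at this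
  exact this

/-- Degree one is the lifting property of `QPerp.exists_lift`. Higher degrees are dimension
shifting, using that the classes grow with the shift. -/
theorem QPerp.ker [IsNoetherianRing R] (hY : Monotone Y) (hK : QPerp (sh (l + 1) Y) K)
    {φ : E →ₗ[R] K} (hφ : IsPrecover (InjClass (Y l)) φ) (hsurj : Function.Surjective φ) :
    QPerp (sh l Y) (ModuleCat.of R (LinearMap.ker φ)) := by
  have hE := (injClass_iff.1 hφ.1).1
  intro M hM
  refine leftPerp_of_extZero fun i => ?_
  cases i with
  | zero =>
    exact ExtZero.of_lift (A := ModuleCat.of R (LinearMap.ker φ)) (Submodule.subtype_injective _)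
      (ker_exact φ) hsurj (extZero_of_injective hE 0) fun h => hK.exists_lift hφ hM h
  | succ i =>
    exact ExtZero.right₁ (A := ModuleCat.of R (LinearMap.ker φ)) (Submodule.subtype_injective _)
      (ker_exact φ) hsurj ((hK M (hM.sh_le hY l.le_succ)).extZero i) (extZero_of_injective hE _)

theorem exists_isIteratedKernel [IsNoetherianRing R] (hY : Good Y) (j : ℕ) {K : ModuleCat.{u} R}
    (hK : QPerp (sh j Y) K) : ∃ C, IsIteratedKernel Y j K C := by
  induction j generalizing K with
  | zero => exact ⟨K, ⟨LinearEquiv.refl R K⟩⟩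
  | succ j ih =>
    obtain ⟨E, φ, hφ⟩ := exists_isCover (Y j) K
    have hsurj := hK.surjective hY hφ.1
    obtain ⟨C, hC⟩ := ih (hK.ker hY.mono hφ.1 hsurj)
    exact ⟨C, E, φ, hφ, hsurj, hC⟩

theorem IsIteratedKernel.qPerp [IsNoetherianRing R] (hY : Monotone Y) {j : ℕ}
    {K C : ModuleCat.{u} R} (h : IsIteratedKernel Y j K C) (hK : QPerp (sh j Y) K) :
    QPerp Y C := by
  induction j generalizing K with
  | zero => exact h.elim fun e => QPerp.of_isSummand (isSummand_of_equiv e) hK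
  | succ j ih =>
    obtain ⟨E, φ, hφ, hsurj, h⟩ := h
    exact ih h (hK.ker hY hφ.1 hsurj)

/-- The terms of the covers are injective with associated primes in the right sets, and the classes
can be read off from any injective coresolution. -/
theorem IsIteratedKernel.ccA [IsNoetherianRing R] {j : ℕ} {K C : ModuleCat.{u} R}
    (h : IsIteratedKernel Y j K C) (hK : CcA (sh j Y) K) : CcA Y C := by
  induction j generalizing K with
  | zero => exact h.elim fun e => hK.of_equiv e
  | succ j ih =>
    obtain ⟨E, φ, hφ, hsurj, h⟩ := h
    obtain ⟨hE, hass⟩ := injClass_iff.1 hφ.1.1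
    refine ih h (CcA.of_exact (A := ModuleCat.of R (LinearMap.ker φ))
      (Submodule.subtype_injective _) (ker_exact φ) hsurj hE ?_ ?_)
    · rwa [sh_apply_zero]
    · rwa [sh_succ]

/-- Each cover contributes one injective term and so raises the degree bound by one. -/
theorem IsIteratedKernel.extZero [IsNoetherianRing R] {j m : ℕ} {K C : ModuleCat.{u} R}
    (h : IsIteratedKernel Y j K C) (hK : ∀ (M : ModuleCat.{u} R) i, m ≤ i → ExtZero M K (i + 1))
    (M : ModuleCat.{u} R) (i : ℕ) (hi : m + j ≤ i) : ExtZero M C (i + 1) := by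
  induction j generalizing K m with
  | zero => exact h.elim fun e => (hK M i hi).of_isSummand_right (isSummand_of_equiv e)
  | succ j ih =>
    obtain ⟨E, φ, hφ, hsurj, h⟩ := h
    refine ih (m := m + 1) h (fun M i hi => ?_) (by omega)
    obtain ⟨i, rfl⟩ := Nat.exists_eq_add_of_le' (show 1 ≤ i by omega)
    exact ExtZero.right₁ (A := ModuleCat.of R (LinearMap.ker φ)) (Submodule.subtype_injective _)
      (ker_exact φ) hsurj (hK M i (by omega))
      (extZero_of_injective (injClass_iff.1 hφ.1.1).1 _)

/-- The sequence of covers defining an iterated kernel is a minimal injective coresolution with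
reduced inner cosyzygies. -/
theorem IsIteratedKernel.mhoN [IsNoetherianRing R] {j : ℕ} {K C : ModuleCat.{u} R}
    (h : IsIteratedKernel Y j K C) (hK : ∀ F : ModuleCat.{u} R, InjClass (prev Y j) F →
      ∀ g : F →ₗ[R] K, Function.Injective g → Subsingleton F) :
    Nonempty (mhoN j C ≃ₗ[R] K) ∧ ∀ i < j, Red (mhoN i C) := by
  induction j generalizing K with
  | zero => exact ⟨h, fun i hi => (Nat.not_lt_zero i hi).elim⟩
  | succ j ih =>
    obtain ⟨E, φ, hφ, hsurj, h⟩ := h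
    have hred : Red (ModuleCat.of R (LinearMap.ker φ)) := hφ.red_ker
    -- For the inner covers the hypothesis on embedded injectives is supplied by reducedness of the
    -- kernel; only the outermost target needs the separate assumption.
    obtain ⟨⟨e⟩, hlt⟩ := ih h fun F hF g hg => hred F (injClass_iff.1 hF).1 g hg
    constructor
    · obtain ⟨e'⟩ := mho_equiv e
      obtain ⟨e''⟩ := mho_equiv_of_exact (X := ModuleCat.of R (LinearMap.ker φ))
        (injClass_iff.1 hφ.1.1).1 (Submodule.subtype_injective _)
        (by
          rw [Submodule.range_subtype]
          exact ker_essential_of_injClass hφ.1.1 φ hK) (ker_exact φ) hsurj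
      exact ⟨e'.trans e''⟩
    · intro i hi
      obtain rfl | hi := Nat.eq_or_lt_of_le (Nat.le_of_lt_succ hi)
      · exact hred.of_injective e.toLinearMap e.injective
      · exact hlt i hi

/-- Present `M` as P/N with P projective in the class; then N lies in the class shifted by only `l`.
Shifting dimension in both variables reduces Ext(M, mho Z) to Ext(N, Z) in the same positive degree.
-/
theorem QPerp.mho [IsNoetherianRing R] (hY : Good Y) (hZ : QPerp (sh l Y) Z) :
    QPerp (sh (l + 1) Y) (mho Z) := by
  intro M hM
  obtain ⟨P, f, hP, hPY, hf⟩ :=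
    exists_projective_ccA (hY.self.sh_le (l := 0) hY.mono l.zero_le) M
  have hN : CcA (sh l Y) (ModuleCat.of R (LinearMap.ker f)) :=
    CcA.ker (A := ModuleCat.of R (LinearMap.ker f)) (Submodule.subtype_injective _) (ker_exact f)
      hf hPY (by rwa [sh_succ])
  exact leftPerp_of_extZero fun i => ExtZero.right₃ (hullι_injective Z) (hullι_mhoπ_exact Z)
    (mhoπ_surjective Z) (extZero_of_injective (hull_injective Z) i)
    (ExtZero.left₃ (A := ModuleCat.of R (LinearMap.ker f)) (Submodule.subtype_injective _)
      (ker_exact f) hf ((hZ _ hN).extZero i) (extZero_of_projective hP _))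

theorem QPerp.mhoN [IsNoetherianRing R] (hY : Good Y) (hZ : QPerp Y Z) (j : ℕ) :
    QPerp (sh j Y) (mhoN j Z) := by
  induction j with
  | zero => exact hZ
  | succ j ih => exact ih.mho hY

/-- Modules in 𝓘(Y_l) belong to the class, so Ext¹ from them to `Z` vanishes and their maps to the
cosyzygy lift. -/
theorem QPerp.isPrecover_mhoπ [IsNoetherianRing R] (hZ : QPerp (sh l Y) Z)
    (hass : AssIn (Y l) Z) : IsPrecover (InjClass (Y l)) (mhoπ Z) := by
  refine ⟨injClass_hull hass, fun E' hE' f' => ?_⟩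
  obtain ⟨hinj, hE'⟩ := injClass_iff.1 hE'
  obtain ⟨k, hk⟩ := ExtZero.exists_lift (hullι_injective Z) (hullι_mhoπ_exact Z)
    (mhoπ_surjective Z) ((hZ E' (ccA_of_injective hinj (by rwa [sh_apply_zero]))).extZero 0) f'
  exact ⟨k, hk.symm⟩

/-- The kernel of a cover of a direct summand is a direct summand of the kernel of a precover. -/
theorem IsCover.isSummand_ker {𝒞 : ObjectProperty (ModuleCat.{u} R)} {I : ModuleCat.{u} R}
    {φ : E →ₗ[R] K} (hφ : IsCover 𝒞 φ) {f : X →ₗ[R] I} {ψ : I →ₗ[R] Z} (hψ : IsPrecover 𝒞 ψ)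
    (hf : Function.Injective f) (hfψ : Function.Exact f ψ) (h : IsSummand K Z) :
    IsSummand (ModuleCat.of R (LinearMap.ker φ)) X := by
  obtain ⟨α, β, hβα⟩ := h
  obtain ⟨a, ha⟩ := hψ.2 E hφ.1.1 (α ∘ₗ φ)
  obtain ⟨b, hb⟩ := hφ.1.2 I hψ.1 (β ∘ₗ ψ)
  have ha : ∀ x, α (φ x) = ψ (a x) := LinearMap.congr_fun ha
  have hb : ∀ x, β (ψ x) = φ (b x) := LinearMap.congr_fun hb
  have hβα : ∀ x, β (α x) = x := LinearMap.congr_fun hβα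
  have hba : ∀ x, φ (b (a x)) = φ x := fun x => by rw [← hb, ← ha, hβα]
  -- The round trip through the precover commutes with `φ`, hence is an automorphism of `E`; it
  -- restricts to an automorphism of `ker φ` that factors through `X`.
  have hbij := hφ.2 (b ∘ₗ a) (LinearMap.ext fun x => (hba x).symm)
  have hmem : ∀ x : LinearMap.ker φ, a x ∈ LinearMap.range f := fun x =>
    (hfψ _).1 (by rw [← ha, show φ x = 0 from x.2, map_zero])
  let a' : LinearMap.ker φ →ₗ[R] X := (LinearEquiv.ofInjective f hf).symm.toLinearMap ∘ₗ
    (a ∘ₗ (LinearMap.ker φ).subtype).codRestrict (LinearMap.range f) hmem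
  let b' : X →ₗ[R] LinearMap.ker φ := (b ∘ₗ f).codRestrict (LinearMap.ker φ) fun x => by
    rw [LinearMap.mem_ker, LinearMap.comp_apply, ← hb, hfψ.apply_apply_eq_zero, map_zero]
  have hfa : ∀ x, f (a' x) = a x := fun x =>
    congrArg Subtype.val ((LinearEquiv.ofInjective f hf).apply_symm_apply ⟨a x, hmem x⟩)
  have hb'a' : ∀ x, (b' (a' x) : E) = b (a x) := fun x => by
    change b (f (a' x)) = _
    rw [hfa]
  refine isSummand_of_bijective (X := ModuleCat.of R (LinearMap.ker φ)) a' b' ⟨?_, ?_⟩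
  · intro x y hxy
    refine Subtype.ext (hbij.1 ?_)
    have := congrArg Subtype.val hxy
    change (b' (a' x) : E) = b' (a' y) at this
    rwa [hb'a', hb'a'] at this
  · intro y
    obtain ⟨x, hx⟩ := hbij.2 (y : E)
    have hx : b (a x) = y := hx
    refine ⟨⟨x, ?_⟩, Subtype.ext ((hb'a' _).trans hx)⟩
    rw [LinearMap.mem_ker, ← hba, hx]
    exact y.2

/-- The minimal coresolution of `D` is made of precovers, so a summand of its j-th cosyzygy can be
pulled back one cover at a time. -/
theorem IsIteratedKernel.isSummand [IsNoetherianRing R] (hY : Good Y) {D : ModuleCat.{u} R}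
    (hD : CcA Y D) (hDperp : QPerp Y D) {j : ℕ} {K C : ModuleCat.{u} R}
    (h : IsIteratedKernel Y j K C) (hK : IsSummand K (MinCotilt.mhoN j D)) : IsSummand C D := by
  induction j generalizing K with
  | zero => exact h.elim fun e => (isSummand_of_equiv e).trans hK
  | succ j ih =>
    obtain ⟨E, φ, hφ, hsurj, h⟩ := h
    exact ih h (hφ.isSummand_ker ((hDperp.mhoN hY j).isPrecover_mhoπ (hD.assIn_mhoN j))
      (hullι_injective _) (hullι_mhoπ_exact _) hK)

end IteratedKernel

/-! ### Finite resolutions by `Prod C` and cotilting modules -/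

section Resolutions

variable {R : Type u} [CommRing R] {A B C D M X X' : ModuleCat.{u} R}

theorem inProd_of_isSummand (h : IsSummand X C) : InProd C X :=
  ⟨PUnit, h.trans (isSummand_of_equiv (N := ModuleCat.of R (PUnit.{u + 1} → C))
    (LinearEquiv.funUnique PUnit.{u + 1} R C).symm)⟩

theorem InProd.of_isSummand (h : IsSummand X X') (hX : InProd C X') : InProd C X := by
  obtain ⟨κ, hX⟩ := hX
  exact ⟨κ, h.trans hX⟩

theorem IsSummand.pi (h : IsSummand X C) (κ : Type u) :
    IsSummand (ModuleCat.of R (κ → X)) (ModuleCat.of R (κ → C)) := by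
  obtain ⟨i, r, h⟩ := h
  exact ⟨piMap fun _ => i, piMap fun _ => r,
    LinearMap.ext fun x => funext fun k => LinearMap.congr_fun h (x k)⟩

theorem InProd.prod (h : InProd C X) (h' : InProd C X') : InProd C (ModuleCat.of R (X × X')) := by
  obtain ⟨κ, h⟩ := h
  obtain ⟨κ', h'⟩ := h'
  refine ⟨κ ⊕ κ', (isSummand_prod h h').trans (isSummand_of_equiv
    (N := ModuleCat.of R (κ ⊕ κ' → C)) (LinearEquiv.sumArrowLequivProdArrow κ κ' R C).symm)⟩

theorem inProd_of_subsingleton (hX : Subsingleton X) : InProd C X :=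
  inProd_of_isSummand ⟨0, 0, LinearMap.ext fun _ => Subsingleton.elim _ _⟩

theorem HasProdResolution.of_equiv {r : ℕ} (h : HasProdResolution C r X) (e : X ≃ₗ[R] X') :
    HasProdResolution C r X' := by
  cases r with
  | zero => exact InProd.of_isSummand (isSummand_of_equiv e.symm) h
  | succ r =>
    obtain ⟨C₀, f, hC₀, hf, h⟩ := h
    refine ⟨C₀, e.toLinearMap ∘ₗ f, hC₀, e.surjective.comp hf, ?_⟩
    rwa [LinearEquiv.ker_comp]

theorem HasProdResolution.succ {r : ℕ} (h : HasProdResolution C r X) :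
    HasProdResolution C (r + 1) X := by
  induction r generalizing X with
  | zero =>
    refine ⟨X, LinearMap.id, h, Function.surjective_id, inProd_of_subsingleton ?_⟩
    rw [LinearMap.ker_id]
    exact inferInstanceAs (Subsingleton (⊥ : Submodule R X))
  | succ r ih =>
    obtain ⟨C₀, f, hC₀, hf, h⟩ := h
    exact ⟨C₀, f, hC₀, hf, ih h⟩

theorem HasProdResolution.mono {r s : ℕ} (h : HasProdResolution C r X) (hrs : r ≤ s) :
    HasProdResolution C s X := by
  induction s, hrs using Nat.le_induction with
  | base => exact h
  | succ s _ ih => exact ih.succ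

theorem HasProdResolution.leftPerp {r : ℕ} (h : HasProdResolution C r X) (hM : LeftPerp C M) :
    LeftPerp X M := by
  induction r generalizing X with
  | zero => exact hM.of_inProd h
  | succ r ih =>
    obtain ⟨C₀, f, hC₀, hf, h⟩ := h
    exact LeftPerp.right₃ (A := ModuleCat.of R (LinearMap.ker f)) (Submodule.subtype_injective _)
      (ker_exact f) hf (hM.of_inProd hC₀) (ih h)

theorem InProd.leftPerp (hC : ∀ κ : Type u, LeftPerp C (ModuleCat.of R (κ → C)))
    (h : InProd C M) : LeftPerp C M := by
  obtain ⟨κ, h⟩ := h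
  exact (hC κ).of_isSummand_left h

/-- Modules with finite `Prod C`-resolutions are closed under extensions. -/
theorem HasProdResolution.ext (hC : ∀ κ : Type u, LeftPerp C (ModuleCat.of R (κ → C))) {r : ℕ}
    {f : A →ₗ[R] B} {g : B →ₗ[R] X} (hf : Function.Injective f) (hfg : Function.Exact f g)
    (hg : Function.Surjective g) (hA : HasProdResolution C r A) (hX : HasProdResolution C r X) :
    HasProdResolution C r B := by
  induction r generalizing A B X with
  | zero =>
    -- Ext¹ vanishes between modules of Prod C, so the sequence splits.
    obtain ⟨l, hl⟩ := ExtZero.exists_lift hf hfg hg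
      ((hA.leftPerp (InProd.leftPerp hC hX)).extZero 0) LinearMap.id
    have hl : ∀ x, g (l x) = x := LinearMap.congr_fun hl
    let φ : (A × X) →ₗ[R] B := f.coprod l
    have hφ : Function.Bijective φ := by
      constructor
      · rw [injective_iff_map_eq_zero]
        rintro ⟨a, x⟩ h
        have h : f a + l x = 0 := by simpa [φ] using h
        have hx : x = 0 := by
          have := congrArg g h
          rwa [map_add, hl, hfg.apply_apply_eq_zero, zero_add, map_zero] at this
        rw [hx, map_zero, add_zero, map_eq_zero_iff f hf] at h
        rw [h, hx]; rfl
      · intro b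
        obtain ⟨a, ha⟩ := (hfg (b - l (g b))).1 (by rw [map_sub, hl, sub_self])
        exact ⟨(a, g b), by simp [φ, ha]⟩
    exact InProd.of_isSummand (isSummand_of_equiv (N := ModuleCat.of R (A × X))
      (LinearEquiv.ofBijective φ hφ).symm) (InProd.prod hA hX)
  | succ r ih =>
    have hA' := hA
    obtain ⟨P, a, hP, ha, hA⟩ := hA
    obtain ⟨Q, b, hQ, hb, hX⟩ := hX
    -- Horseshoe: `A` is right orthogonal to Prod C, so `Q → X` lifts to `B`, and the kernels form a
    -- shorter instance.
    obtain ⟨l, hl⟩ := ExtZero.exists_lift hf hfg hg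
      ((hA'.leftPerp (InProd.leftPerp hC hQ)).extZero 0) b
    have hl : ∀ x, g (l x) = b x := LinearMap.congr_fun hl
    let φ : (P × Q) →ₗ[R] B := (f ∘ₗ a).coprod l
    have hφ : ∀ x, φ x = f (a x.1) + l x.2 := fun x => rfl
    have hφs : Function.Surjective φ := by
      intro y
      obtain ⟨q, hq⟩ := hb (g y)
      obtain ⟨z, hz⟩ := (hfg (y - l q)).1 (by rw [map_sub, hl, hq, sub_self])
      obtain ⟨p, rfl⟩ := ha z
      exact ⟨(p, q), by rw [hφ, hz]; simp⟩
    have hgφ : ∀ x, g (φ x) = b x.2 := fun x => by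
      rw [hφ, map_add, hl, hfg.apply_apply_eq_zero, zero_add]
    refine ⟨ModuleCat.of R (P × Q), φ, InProd.prod hP hQ, hφs, ?_⟩
    let s : LinearMap.ker a →ₗ[R] LinearMap.ker φ :=
      (LinearMap.inl R P Q ∘ₗ (LinearMap.ker a).subtype).codRestrict _ fun x => by
        have hx : a (x : P) = 0 := x.2
        rw [LinearMap.mem_ker, hφ]
        simp [hx]
    let t : LinearMap.ker φ →ₗ[R] LinearMap.ker b :=
      (LinearMap.snd R P Q ∘ₗ (LinearMap.ker φ).subtype).codRestrict _ fun x => by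
        have hx : φ (x : P × Q) = 0 := x.2
        rw [LinearMap.mem_ker]
        change b (x : P × Q).2 = 0
        rw [← hgφ, hx, map_zero]
    refine ih (A := ModuleCat.of R (LinearMap.ker a)) (B := ModuleCat.of R (LinearMap.ker φ))
      (X := ModuleCat.of R (LinearMap.ker b)) (f := s) (g := t) ?_ ?_ ?_ hA hX
    · intro x y h
      exact Subtype.ext (congrArg Prod.fst (congrArg Subtype.val h))
    · rintro ⟨⟨p, q⟩, hpq⟩
      constructor
      · intro h
        obtain rfl : q = 0 := congrArg Subtype.val h
        have hpq : f (a p) + l 0 = 0 := hpq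
        rw [map_zero, add_zero, map_eq_zero_iff f hf] at hpq
        exact ⟨⟨p, hpq⟩, rfl⟩
      · rintro ⟨x, hx⟩
        refine Subtype.ext ?_
        exact (congrArg Prod.snd (congrArg Subtype.val hx)).symm
    · rintro ⟨q, hq⟩
      have hq : b q = 0 := hq
      obtain ⟨z, hz⟩ := (hfg (l q)).1 (by rw [hl, hq])
      obtain ⟨p, rfl⟩ := ha z
      refine ⟨⟨(-p, q), ?_⟩, rfl⟩
      rw [LinearMap.mem_ker, hφ]
      simp [hz]

/-- `X` has a finite resolution by modules from `Prod C`. -/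
def Res (C X : ModuleCat.{u} R) : Prop := ∃ r, HasProdResolution C r X

theorem Res.of_equiv (h : Res C X) (e : X ≃ₗ[R] X') : Res C X' :=
  h.imp fun _ h => h.of_equiv e

theorem Res.ext (hC : ∀ κ : Type u, LeftPerp C (ModuleCat.of R (κ → C)))
    {f : A →ₗ[R] B} {g : B →ₗ[R] X} (hf : Function.Injective f) (hfg : Function.Exact f g)
    (hg : Function.Surjective g) (hA : Res C A) (hX : Res C X) : Res C B := by
  obtain ⟨r, hA⟩ := hA
  obtain ⟨s, hX⟩ := hX
  exact ⟨max r s, HasProdResolution.ext hC hf hfg hg (hA.mono (le_max_left _ _))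
    (hX.mono (le_max_right _ _))⟩

theorem Res.prod (hC : ∀ κ : Type u, LeftPerp C (ModuleCat.of R (κ → C))) (hX : Res C X)
    (hX' : Res C X') : Res C (ModuleCat.of R (X × X')) :=
  Res.ext (B := ModuleCat.of R (X × X')) hC (f := LinearMap.inl R X X') (g := LinearMap.snd R X X')
    LinearMap.inl_injective .inl_snd LinearMap.snd_surjective hX hX'

/-- Modules with finite `Prod C`-resolutions are closed under cokernels of monomorphisms. -/
theorem Res.coker (hC : ∀ κ : Type u, LeftPerp C (ModuleCat.of R (κ → C)))
    {f : A →ₗ[R] B} {g : B →ₗ[R] X} (hf : Function.Injective f) (hfg : Function.Exact f g)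
    (hg : Function.Surjective g) (hA : Res C A) (hB : Res C B) : Res C X := by
  have hker : Nonempty (A ≃ₗ[R] LinearMap.ker g) :=
    ⟨(LinearEquiv.ofInjective f hf).trans (LinearEquiv.ofEq _ _ hfg.linearMap_ker_eq.symm)⟩
  obtain ⟨e⟩ := hker
  have hA : Res C (ModuleCat.of R (LinearMap.ker g)) := hA.of_equiv e
  obtain ⟨s, hB⟩ := hB
  cases s with
  | zero =>
    obtain ⟨r, hA⟩ := hA
    exact ⟨r + 1, B, g, hB, hg, hA⟩
  | succ s =>
    obtain ⟨P, b, hP, hb, hB⟩ := hB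
    -- This kernel is an extension of `ker g ≅ A` by `ker b`.
    obtain ⟨r, h⟩ : Res C (ModuleCat.of R (LinearMap.ker (g ∘ₗ b))) := by
      refine Res.ext (A := ModuleCat.of R (LinearMap.ker b))
        (X := ModuleCat.of R (LinearMap.ker g)) hC
        (f := Submodule.inclusion (LinearMap.ker_le_ker_comp b g))
        (g := (b ∘ₗ (LinearMap.ker (g ∘ₗ b)).subtype).codRestrict (LinearMap.ker g) fun x => x.2)
        (Submodule.inclusion_injective _) ?_ ?_ ⟨s, hB⟩ hA
      · rintro ⟨x, hx⟩
        constructor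
        · intro h
          exact ⟨⟨x, congrArg Subtype.val h⟩, rfl⟩
        · rintro ⟨y, hy⟩
          refine Subtype.ext ?_
          have : (y : P) = x := congrArg Subtype.val hy
          change b x = 0
          rw [← this]
          exact y.2
      · rintro ⟨y, hy⟩
        obtain ⟨x, rfl⟩ := hb y
        exact ⟨⟨x, hy⟩, rfl⟩
    exact ⟨r + 1, P, g ∘ₗ b, hP, hg.comp hb, h⟩

/-- Eilenberg swindle. -/
theorem Res.of_isSummand (hC : ∀ κ : Type u, LeftPerp C (ModuleCat.of R (κ → C)))
    (h : IsSummand X X') (hX : Res C (ModuleCat.of R (ℕ → X'))) : Res C X := by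
  obtain ⟨i, r, hri⟩ := h
  have hri : ∀ x, r (i x) = x := LinearMap.congr_fun hri
  let e : X' →ₗ[R] X' := i ∘ₗ r
  have he : ∀ x, e (e x) = e x := fun x => congrArg i (hri (r x))
  have hre : ∀ x, r (e x) = r x := fun x => hri (r x)
  -- The map `s` shifts the `X`-parts one place to the right and leaves the complementary parts
  -- where they are. It is injective, and its cokernel is the `X`-part at place 0.
  let s : (ℕ → X') →ₗ[R] (ℕ → X') := LinearMap.pi fun n => match n with
    | 0 => (LinearMap.id - e) ∘ₗ LinearMap.proj 0
    | n + 1 => e ∘ₗ LinearMap.proj n + (LinearMap.id - e) ∘ₗ LinearMap.proj (n + 1)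
  have hs0 : ∀ x, s x 0 = x 0 - e (x 0) := fun x => rfl
  have hs1 : ∀ x n, s x (n + 1) = e (x n) + (x (n + 1) - e (x (n + 1))) := fun x n => rfl
  refine Res.coker (A := ModuleCat.of R (ℕ → X')) (B := ModuleCat.of R (ℕ → X')) hC (f := s)
    (g := r ∘ₗ LinearMap.proj 0) ?_ ?_ (fun x => ⟨fun _ => i x, hri x⟩) hX hX
  · rw [injective_iff_map_eq_zero]
    intro x hx
    have h1 : ∀ n, e (x n) = 0 := fun n => by
      have h : s x (n + 1) = 0 := congrFun hx (n + 1)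
      rw [hs1] at h
      have := congrArg e h
      rwa [map_add, map_sub, he, he, sub_self, add_zero, map_zero] at this
    funext n
    cases n with
    | zero =>
      have h : s x 0 = 0 := congrFun hx 0
      rwa [hs0, h1, sub_zero] at h
    | succ n =>
      have h : s x (n + 1) = 0 := congrFun hx (n + 1)
      rwa [hs1, h1, h1, zero_add, sub_zero] at h
  · intro y
    constructor
    · intro hy
      have hy : r (y 0) = 0 := hy
      have hy0 : e (y 0) = 0 := by
        change i (r (y 0)) = 0
        rw [hy, map_zero]
      let x : ℕ → X' := fun n => e (y (n + 1)) + (y n - e (y n))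
      have hx : ∀ n, x n = e (y (n + 1)) + (y n - e (y n)) := fun n => rfl
      have hex : ∀ n, e (x n) = e (y (n + 1)) := fun n => by
        rw [hx, map_add, map_sub, he, he, sub_self, add_zero]
      refine ⟨x, funext fun n => ?_⟩
      cases n with
      | zero => rw [hs0, hex, hx, hy0]; abel
      | succ n => rw [hs1, hex, hex, hx]; abel
    · rintro ⟨x, rfl⟩
      change r (s x 0) = 0
      rw [hs0, map_sub, hre, sub_self]

/-! ### Cotilting modules -/

/-- A module in `^⊥ D` embeds in a product of copies of `D`, with cokernel in `^⊥ D`. -/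
theorem IsCotilting.exists_embedding (hD : IsCotilting D) (hM : LeftPerp D M) :
    ∃ (κ : Type u) (Q : ModuleCat.{u} R) (f : M →ₗ[R] (κ → D)) (g : (κ → D) →ₗ[R] Q),
      Function.Injective f ∧ Function.Exact f g ∧ Function.Surjective g ∧ LeftPerp D Q := by
  let f : M →ₗ[R] ((M →ₗ[R] D) → D) := LinearMap.pi fun h => h
  let Q : ModuleCat.{u} R := ModuleCat.of R (((M →ₗ[R] D) → D) ⧸ LinearMap.range f)
  let g : ((M →ₗ[R] D) → D) →ₗ[R] Q := (LinearMap.range f).mkQ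
  have hfg : Function.Exact f g := LinearMap.exact_map_mkQ_range f
  have hg : Function.Surjective g := Submodule.mkQ_surjective _
  -- The kernel of the canonical map `f` is annihilated by all maps into Prod D. Maps into the
  -- cogenerator `W` lift to Prod D, so they annihilate it as well and it is zero.
  have hprod : ∀ {P : ModuleCat.{u} R}, InProd D P → ∀ (h : M →ₗ[R] P) (x : M), f x = 0 →
      h x = 0 := by
    rintro P ⟨κ, hP⟩ h x hx
    obtain ⟨i, hi⟩ := hP.exists_injective
    refine (map_eq_zero_iff i hi).1 (funext fun k => ?_)
    exact congrFun hx ((LinearMap.proj k : (κ → D) →ₗ[R] D) ∘ₗ i ∘ₗ h)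
  have hf : Function.Injective f := by
    rw [injective_iff_map_eq_zero]
    intro x hx
    obtain ⟨r, W, hW, hcog, hres⟩ := hD.exists_resolution
    have hzero : ∀ h : M →ₗ[R] W, h x = 0 := by
      intro h
      cases r with
      | zero => exact hprod hres h x hx
      | succ r =>
        obtain ⟨P, a, hP, ha, hres⟩ := hres
        obtain ⟨k, rfl⟩ := ExtZero.exists_lift (A := ModuleCat.of R (LinearMap.ker a))
          (Submodule.subtype_injective _) (ker_exact a) ha
          ((hres.leftPerp hM).extZero 0) h
        rw [LinearMap.comp_apply, hprod hP k x hx, map_zero]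
    have := (isCoseparator_def W).1 hcog
      (ModuleCat.ofHom (LinearMap.toSpanSingleton R M x) : ModuleCat.of R R ⟶ M) 0 fun h => by
        rw [Limits.zero_comp]
        ext
        change h.hom ((1 : R) • x) = 0
        rw [one_smul]
        exact hzero h.hom
    have := congrArg (fun k => k.hom (1 : R)) this
    change (1 : R) • x = 0 at this
    rwa [one_smul] at this
  refine ⟨M →ₗ[R] D, Q, f, g, hf, hfg, hg, leftPerp_of_extZero fun i => ?_⟩
  have hκ := hD.ext_eq_zero (M →ₗ[R] D)
  cases i with
  | zero =>
    -- Every map `M → D` is a coordinate of `f`, so it extends to the power.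
    exact ExtZero.of_extend (B := ModuleCat.of R ((M →ₗ[R] D) → D)) hf hfg hg (hκ.extZero 0)
      fun h => ⟨LinearMap.proj h, rfl⟩
  | succ i =>
    exact ExtZero.left₃ (B := ModuleCat.of R ((M →ₗ[R] D) → D)) hf hfg hg (hM.extZero i)
      (hκ.extZero _)

theorem IsCotilting.self_leftPerp (hD : IsCotilting D) : LeftPerp D D :=
  InProd.leftPerp hD.ext_eq_zero (inProd_of_isSummand (IsSummand.refl D))

/-- The kernel of a cotilting class is `Prod D`. -/
theorem IsCotilting.inProd (hD : IsCotilting D) (hM : LeftPerp D M)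
    (hM' : ∀ N, LeftPerp D N → LeftPerp M N) : InProd D M := by
  obtain ⟨κ, Q, f, g, hf, hfg, hg, hQ⟩ := hD.exists_embedding hM
  obtain ⟨k, hk⟩ := ExtZero.exists_extend (B := ModuleCat.of R (κ → D)) hf hfg hg
    ((hM' Q hQ).extZero 0) LinearMap.id
  exact ⟨κ, f, k, hk⟩

/-- If a cotilting module belongs to `𝒞(𝒴)`, then so does its left orthogonal class. -/
theorem IsCotilting.ccA [IsNoetherianRing R] {Y : ℕ → Set (PrimeSpectrum R)} (hY : Monotone Y)
    (hlow : ∀ i, IsLowerSet (Y i)) (hD : IsCotilting D) (hDY : CcA Y D) (hM : LeftPerp D M) :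
    CcA Y M := by
  intro k
  -- The cokernel of an embedding into a power of `D` stays in ^⊥D, so induction covers it;
  -- monotonicity of `Y` passes to the shifted sequence needed by `Cc.ker`.
  induction k generalizing M with
  | zero => trivial
  | succ k ih =>
    obtain ⟨κ, Q, f, g, hf, hfg, hg, hQ⟩ := hD.exists_embedding hM
    exact Cc.ker (B := ModuleCat.of R (κ → D)) hf hfg hg
      (Cc.pi (X := fun _ : κ => D) hlow fun _ => hDY _)
      ((ih hQ).mono fun i => hY (Nat.le_succ i))

end Resolutions

/-! ### Resolutions of injective modules -/

section InjectiveResolution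

variable {R : Type u} [CommRing R] {S : Set (PrimeSpectrum R)} {A C J K M X : ModuleCat.{u} R}
  {Y : ℕ → Set (PrimeSpectrum R)}

/-- The cyclic submodule of `w` is R/q, which maps onto the copy of R/p in `A`; injectivity of `A`
extends this map to `X`. -/
theorem AnnEq.exists_hom [IsNoetherianRing R] {q p : PrimeSpectrum R} {w : X} (hw : AnnEq q w)
    (hA : IsSumOfHulls (fun p : S => (p : PrimeSpectrum R)) A) (hp : p ∈ S) (hqp : q ≤ p) :
    ∃ h : X →ₗ[R] A, h w ≠ 0 := by
  have hinj := hA.injective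
  obtain ⟨f, hf⟩ := hA.exists_embedding ⟨p, hp⟩ (isInjectiveHull_hull _)
  obtain ⟨x, hx⟩ := (isInjectiveHull_hull (ModuleCat.of R (R ⧸ p.asIdeal))).exists_annEq
  have hx : AnnEq p (f x) := hx.map hf
  let α : R →ₗ[R] A := LinearMap.toSpanSingleton R A (f x)
  let β : R →ₗ[R] X := LinearMap.toSpanSingleton R X w
  have hα : q.asIdeal ≤ LinearMap.ker α := fun r hr => (hx r).2 (hqp hr)
  have hβ : q.asIdeal = LinearMap.ker β := Ideal.ext fun r => (hw r).symm
  obtain ⟨h, hh⟩ := hinj.out (Submodule.liftQ q.asIdeal β hβ.le)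
    (LinearMap.ker_eq_bot.1 (Submodule.ker_liftQ_eq_bot' _ β hβ)) (Submodule.liftQ q.asIdeal α hα)
  refine ⟨h, ?_⟩
  have := hh (Submodule.Quotient.mk 1)
  rw [Submodule.liftQ_apply, Submodule.liftQ_apply] at this
  change h ((1 : R) • w) = (1 : R) • f x at this
  rw [one_smul, one_smul] at this
  rw [this]
  exact hx.ne_zero

theorem isLowerSet_prev (hlow : ∀ i, IsLowerSet (Y i)) (j : ℕ) : IsLowerSet (prev Y j) := by
  cases j with
  | zero => exact isLowerSet_empty
  | succ j => exact hlow j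

theorem isAntichain_maxPrimes (Y : ℕ → Set (PrimeSpectrum R)) (j : ℕ) :
    IsAntichain (· ≤ ·) (maxPrimes Y j) :=
  fun _ hp _ hq hne hle => hne (hp.eq_of_le hq.prop hle)

theorem exists_le_maxPrimes [IsNoetherianRing R] {j : ℕ} {q : PrimeSpectrum R}
    (hq : q ∈ Y j \ prev Y j) : ∃ p ∈ maxPrimes Y j, q ≤ p := by
  have hwf : WellFoundedGT (PrimeSpectrum R) :=
    ⟨InvImage.wf PrimeSpectrum.asIdeal (wellFounded_gt (α := Ideal R))⟩
  obtain ⟨p, hle, hp⟩ := exists_maximal_ge_of_wellFoundedGT (fun q => q ∈ Y j \ prev Y j) q hq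
  exact ⟨p, hp, hle⟩

/-- Every prime of Y_j lies in Y_{j-1} or below a prime of S_j, so maps to `A` and `K` separate the
elements of `J`; the embedding splits by injectivity. -/
theorem isSummand_pi_of_injClass [IsNoetherianRing R] {j : ℕ}
    (hA : IsSumOfHulls (fun p : prev Y j => (p : PrimeSpectrum R)) A)
    (hK : IsSumOfHulls (fun p : maxPrimes Y j => (p : PrimeSpectrum R)) K)
    (hJ : InjClass (Y j) J) :
    ∃ κ : Type u, IsSummand J (ModuleCat.of R (κ → A × K)) := by
  obtain ⟨hinj, hass⟩ := injClass_iff.1 hJ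
  refine ⟨J →ₗ[R] A × K, isSummand_of_injective hinj
    (LinearMap.pi fun h : J →ₗ[R] A × K => h) ?_⟩
  rw [injective_iff_map_eq_zero]
  intro x hx
  have hx : ∀ h : J →ₗ[R] A × K, h x = 0 := congrFun hx
  by_contra hx0
  obtain ⟨r, q, hq⟩ := exists_annEq (R := R) hx0
  have hrx : ∀ h : J →ₗ[R] A × K, h (r • x) = 0 := fun h => by rw [map_smul, hx, smul_zero]
  by_cases hqp : q ∈ prev Y j
  · obtain ⟨h, hh⟩ := hq.exists_hom hA hqp le_rfl
    exact hh (congrArg Prod.fst (hrx (LinearMap.inl R A K ∘ₗ h)))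
  · obtain ⟨p, hp, hle⟩ := exists_le_maxPrimes ⟨hass q _ hq, hqp⟩
    obtain ⟨h, hh⟩ := hq.exists_hom hK hp hle
    exact hh (congrArg Prod.snd (hrx (LinearMap.inr R A K ∘ₗ h)))

theorem InjClass.pi [IsNoetherianRing R] {Z : Set (PrimeSpectrum R)} (hZ : IsLowerSet Z)
    (hJ : InjClass Z J) (κ : Type u) : InjClass Z (ModuleCat.of R (κ → J)) := by
  obtain ⟨hinj, hass⟩ := injClass_iff.1 hJ
  exact injClass_iff.2 ⟨inferInstanceAs (Module.Injective R (κ → J)),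
    AssIn.pi (X := fun _ : κ => J) hZ fun _ => hass⟩

/-- Powers of the exact sequence of covers exhibit powers of `K` by successive cokernels, with
middle terms in the smaller classes 𝓘(Y_i). -/
theorem IsIteratedKernel.res_pi [IsNoetherianRing R]
    (hC : ∀ κ : Type u, LeftPerp C (ModuleCat.of R (κ → C))) (hlow : ∀ i, IsLowerSet (Y i))
    {j : ℕ} (hres : ∀ i < j, ∀ E, InjClass (Y i) E → Res C E) {K M : ModuleCat.{u} R}
    (h : IsIteratedKernel Y j K M) (κ : Type u) (hM : Res C (ModuleCat.of R (κ → M))) :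
    Res C (ModuleCat.of R (κ → K)) := by
  induction j generalizing K with
  | zero => exact h.elim fun e => hM.of_equiv (LinearEquiv.piCongrRight fun _ : κ => e)
  | succ j ih =>
    obtain ⟨E, φ, hφ, hsurj, h⟩ := h
    exact Res.coker (A := ModuleCat.of R (κ → LinearMap.ker φ)) (B := ModuleCat.of R (κ → E)) hC
      (f := piMap (X := fun _ => ModuleCat.of R (LinearMap.ker φ))
        fun _ => (LinearMap.ker φ).subtype) (g := piMap fun _ => φ)
      (piMap_injective fun _ => Submodule.subtype_injective _) (piMap_exact fun _ => ker_exact φ)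
      (piMap_surjective fun _ => hsurj) (ih (fun i hi => hres i (by omega)) h)
      (hres j j.lt_succ_self _ (InjClass.pi (hlow j) hφ.1.1 κ))

/-- Strong induction on `j`. A power of `A` is in 𝓘(Y_{j-1}), a power of `K` is reached from a power
of C_{S_j}, and the swindle passes to the direct summand `J`. -/
theorem res_of_injClass [IsNoetherianRing R]
    (hC : ∀ κ : Type u, LeftPerp C (ModuleCat.of R (κ → C))) (hlow : ∀ i, IsLowerSet (Y i))
    {n : ℕ} (hM : ∀ j ≤ n, ∃ M, IsCoverModule Y j (maxPrimes Y j) M ∧ IsSummand M C)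
    (j : ℕ) (hj : j ≤ n) (J : ModuleCat.{u} R) (hJ : InjClass (Y j) J) : Res C J := by
  induction j using Nat.strong_induction_on generalizing J with
  | _ j ih =>
    obtain ⟨M, ⟨K, hK, hMK⟩, hMC⟩ := hM j hj
    obtain ⟨A, hA⟩ := exists_sumOfHulls fun p : prev Y j => (p : PrimeSpectrum R)
    obtain ⟨κ, hκ⟩ := isSummand_pi_of_injClass hA hK hJ
    refine Res.of_isSummand hC hκ ?_
    have hA' : InjClass (prev Y j) A := injClass_iff.2 ⟨hA.injective, hA.assIn fun p => p.2⟩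
    have hresA : Res C (ModuleCat.of R (ℕ × κ → A)) := by
      have hA'' := InjClass.pi (isLowerSet_prev hlow j) hA' (ℕ × κ)
      cases j with
      | zero => exact ⟨0, inProd_of_subsingleton (injClass_iff.1 hA'').2.subsingleton_of_empty⟩
      | succ j => exact ih j j.lt_succ_self (by omega) _ hA''
    have hresK : Res C (ModuleCat.of R (ℕ × κ → K)) :=
      hMK.res_pi hC hlow (fun i hi E hE => ih i hi (by omega) E hE) _
        ⟨0, ℕ × κ, hMC.pi _⟩
    exact (hresA.prod hC hresK).of_equiv (X' := ModuleCat.of R (ℕ → κ → A × K))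
      { toFun := fun x a b => (x.1 (a, b), x.2 (a, b))
        map_add' := fun _ _ => rfl
        map_smul' := fun _ _ => rfl
        invFun := fun x => (fun a => (x a.1 a.2).1, fun a => (x a.1 a.2).2)
        left_inv := fun _ => rfl
        right_inv := fun _ => rfl }

theorem IsSumOfHulls.isCoseparator [IsNoetherianRing R]
    (hA : IsSumOfHulls (fun p : (Set.univ : Set (PrimeSpectrum R)) => (p : PrimeSpectrum R)) A) :
    IsCoseparator A := by
  rw [isCoseparator_def]
  intro X Z f g h
  ext x
  by_contra hx
  obtain ⟨r, q, hq⟩ := exists_annEq (R := R) (sub_ne_zero.2 hx)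
  obtain ⟨k, hk⟩ := hq.exists_hom hA (Set.mem_univ q) le_rfl
  have := congrArg (fun t => t.hom x) (h (ModuleCat.ofHom k))
  have : k (f.hom x) = k (g.hom x) := this
  refine hk ?_
  rw [map_smul, map_sub, this, sub_self, smul_zero]

end InjectiveResolution

/-! ### The modules attached to the sets of maximal primes -/

section CoverModules

variable {R : Type u} [CommRing R] {Y : ℕ → Set (PrimeSpectrum R)} {j : ℕ}
  {C D K M X : ModuleCat.{u} R}

theorem exists_isCoverModule [IsNoetherianRing R] (hY : Good Y) (j : ℕ) :
    ∃ M, IsCoverModule Y j (maxPrimes Y j) M := by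
  obtain ⟨K, hK⟩ := exists_sumOfHulls fun p : maxPrimes Y j => (p : PrimeSpectrum R)
  obtain ⟨M, hM⟩ := exists_isIteratedKernel hY j fun _ _ => leftPerp_of_injective hK.injective
  exact ⟨M, K, hK, hM⟩

theorem IsCoverModule.qPerp [IsNoetherianRing R] (hY : Monotone Y)
    (h : IsCoverModule Y j (maxPrimes Y j) M) : QPerp Y M := by
  obtain ⟨K, hK, h⟩ := h
  exact h.qPerp hY fun _ _ => leftPerp_of_injective hK.injective

theorem IsCoverModule.ccA [IsNoetherianRing R] (h : IsCoverModule Y j (maxPrimes Y j) M) :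
    CcA Y M := by
  obtain ⟨K, hK, h⟩ := h
  refine h.ccA (ccA_of_injective hK.injective ?_)
  rw [sh_apply_zero]
  exact hK.assIn fun p => p.2.prop.1

theorem IsCoverModule.extZero [IsNoetherianRing R] (h : IsCoverModule Y j (maxPrimes Y j) M)
    (X : ModuleCat.{u} R) {i : ℕ} (hi : j ≤ i) : ExtZero X M (i + 1) := by
  obtain ⟨K, hK, h⟩ := h
  exact h.extZero (m := 0) (fun X i _ => extZero_of_injective hK.injective i) X i (by omega)

/-- The cosyzygies of `C_S`. -/
theorem IsCoverModule.mhoN [IsNoetherianRing R] (h : IsCoverModule Y j (maxPrimes Y j) M) :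
    ∃ K, IsSumOfHulls (fun p : maxPrimes Y j => (p : PrimeSpectrum R)) K ∧
      IsIteratedKernel Y j K M ∧ Nonempty (mhoN j M ≃ₗ[R] K) ∧ ∀ i < j, Red (mhoN i M) := by
  obtain ⟨K, hK, h⟩ := h
  refine ⟨K, hK, h, h.mhoN fun F hF g hg => ?_⟩
  -- An associated prime of `F` would lie both in Y_{j-1} and in S_j.
  refine AssIn.subsingleton_of_empty (R := R) fun p z hz => ?_
  obtain ⟨E, hE, ⟨e⟩⟩ := hK
  obtain ⟨q, rfl, -⟩ := ((hz.map hg).map (f := e.toLinearMap) e.injective).eq_dincl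
    (isAntichain_maxPrimes Y j) hE
  exact q.2.prop.2 ((injClass_iff.1 hF).2 _ z hz)

theorem IsCoverModule.subsingleton_mhoN [IsNoetherianRing R]
    (h : IsCoverModule Y j (maxPrimes Y j) M) {i : ℕ} (hi : j < i) :
    Subsingleton (MinCotilt.mhoN i M) := by
  induction i, hi using Nat.le_induction with
  | base =>
    obtain ⟨K, hK, -, ⟨e⟩, -⟩ := h.mhoN
    exact subsingleton_mho (injective_of_linearEquiv e hK.injective)
  | succ i hi ih => exact subsingleton_mho injective_of_subsingleton

/-- Every `E(R/p)`, `p ∈ S_j`, embeds in the `j`-th cosyzygy of `D`. -/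
def HasHulls (Y : ℕ → Set (PrimeSpectrum R)) (D : ModuleCat.{u} R) (j : ℕ) : Prop :=
  ∀ p ∈ maxPrimes Y j, ∃ f : hull (ModuleCat.of R (R ⧸ p.asIdeal)) →ₗ[R] mhoN j D,
    Function.Injective f

/-- The individual embeddings are jointly injective because S_j is an antichain. -/
theorem HasHulls.isSummand [IsNoetherianRing R] (h : HasHulls Y D j)
    (hK : IsSumOfHulls (fun p : maxPrimes Y j => (p : PrimeSpectrum R)) K) :
    IsSummand K (mhoN j D) := by
  have hinj := hK.injective
  obtain ⟨E, hE, ⟨e⟩⟩ := hK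
  have : ∀ p : maxPrimes Y j, ∃ f : E p →ₗ[R] mhoN j D, Function.Injective f := fun p => by
    obtain ⟨f, hf⟩ := h p p.2
    obtain ⟨e'⟩ := hull_equiv (hE p) (isInjectiveHull_hull _)
    exact ⟨f ∘ₗ e'.toLinearMap, hf.comp e'.injective⟩
  choose f hf using this
  exact isSummand_of_injective hinj (dlift f ∘ₗ e.toLinearMap)
    ((injective_dlift_of_antichain (isAntichain_maxPrimes Y j) hE hf).comp e.injective)

/-- A reduced j-th cosyzygy of the summand `A` cannot absorb an injective hull, so the hulls survive
in the complement. -/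
theorem HasHulls.of_red (h : HasHulls Y D j) {A B : ModuleCat.{u} R} (e : D ≃ₗ[R] A × B)
    (hA : Red (mhoN j A)) : HasHulls Y B j := by
  intro p hp
  obtain ⟨f, hf⟩ := h p hp
  obtain ⟨e₁⟩ := mhoN_equiv (N := ModuleCat.of R (A × B)) e j
  obtain ⟨e₂⟩ := mhoN_prod_equiv A B j
  let g := (e₂.toLinearMap ∘ₗ e₁.toLinearMap) ∘ₗ f
  have hg : Function.Injective g := (e₂.injective.comp e₁.injective).comp hf
  exact ⟨LinearMap.snd R _ _ ∘ₗ g, hA.injective_of_jointly (hull_injective _) _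
    (LinearMap.fst R _ _ ∘ₗ g) fun z h1 h2 => (map_eq_zero_iff g hg).1 (Prod.ext h2 h1)⟩

/-- The j-th cosyzygy of `M` embeds in a power of that of `D`. On E(R/p) choose a coordinate not
killing an element of annihilator `p`; maximality of `p` shows that this coordinate alone is
injective. -/
theorem IsCoverModule.hasHulls [IsNoetherianRing R] (hlow : ∀ i, IsLowerSet (Y i))
    (h : IsCoverModule Y j (maxPrimes Y j) M) (hD : CcA Y D) (hMD : InProd D M) :
    HasHulls Y D j := by
  intro p hp
  obtain ⟨K, hK, -, ⟨e⟩, -⟩ := h.mhoN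
  obtain ⟨κ, hκ⟩ := hMD.mhoN j
  obtain ⟨a, ha⟩ := hκ.exists_injective
  have hE := isInjectiveHull_hull (ModuleCat.of R (R ⧸ p.asIdeal))
  obtain ⟨b, hb⟩ := hK.exists_embedding ⟨p, hp⟩ hE
  let g := (a ∘ₗ e.symm.toLinearMap) ∘ₗ b
  have hg : Function.Injective g := (ha.comp e.symm.injective).comp hb
  obtain ⟨x, hx⟩ := hE.exists_annEq
  obtain ⟨k, hk⟩ : ∃ k, g x k ≠ 0 := by
    by_contra! H
    exact (hx.map hg).ne_zero (funext H)
  let f := (LinearMap.proj k : (κ → MinCotilt.mhoN j D) →ₗ[R] MinCotilt.mhoN j D) ∘ₗ g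
  obtain ⟨r, q, hq⟩ := exists_annEq (R := R) (show f x ≠ 0 from hk)
  rw [← map_smul] at hq
  have hrx : AnnEq p (r • x) := hx.smul fun h0 => hq.ne_zero (by rw [h0, map_zero])
  have hpq : p ≤ q := fun s hs => (hq s).1 (by rw [← map_smul, (hrx s).2 hs, map_zero])
  -- Here `q` is in Y_j since `D` is in the class, and not in Y_{j-1} since that set is closed under
  -- generalization and misses `p`.
  have hqp : p = q := hp.eq_of_le
    ⟨hD.assIn_mhoN j q _ hq, fun h => hp.prop.2 (isLowerSet_prev hlow j hpq h)⟩ hpq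
  rw [← hqp] at hq
  exact ⟨f, hE.injective_of_annEq hrx hq⟩

end CoverModules

/-! ### Finite sums -/

section FiniteSums

variable {R : Type u} [CommRing R] {Y : ℕ → Set (PrimeSpectrum R)} {m : ℕ}
  {M : ℕ → ModuleCat.{u} R} {C D X : ModuleCat.{u} R}

/-- The module `M 0 ⊕ ⋯ ⊕ M (m - 1)`. -/
def psum (M : ℕ → ModuleCat.{u} R) : ℕ → ModuleCat.{u} R
  | 0 => ModuleCat.of R PUnit
  | m + 1 => ModuleCat.of R (psum M m × M m)

theorem pi_equiv_psum (M : ℕ → ModuleCat.{u} R) (m : ℕ) :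
    Nonempty ((∀ i : Fin m, M i) ≃ₗ[R] psum M m) := by
  induction m with
  | zero =>
    exact ⟨{ toFun := fun _ => PUnit.unit
             map_add' := fun _ _ => rfl
             map_smul' := fun _ _ => rfl
             invFun := fun _ => 0
             left_inv := fun _ => Subsingleton.elim _ _
             right_inv := fun _ => rfl }⟩
  | succ m ih =>
    obtain ⟨e⟩ := ih
    let e' : (∀ i : Fin (m + 1), M i) ≃ₗ[R] (∀ i : Fin m, M i) × M m :=
      { toFun := fun x => (fun i => x i.castSucc, x (Fin.last m))
        map_add' := fun _ _ => rfl
        map_smul' := fun _ _ => rfl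
        invFun := fun x => Fin.snoc (α := fun i : Fin (m + 1) => M i) x.1 x.2
        left_inv := fun x => Fin.snoc_init_self x
        right_inv := fun x => Prod.ext
          (funext fun i => Fin.snoc_castSucc (α := fun i : Fin (m + 1) => M i) x.2 x.1 i)
          (Fin.snoc_last (α := fun i : Fin (m + 1) => M i) x.2 x.1) }
    exact ⟨e'.trans (e.prodCongr (LinearEquiv.refl R (M m)))⟩

theorem subsingleton_mhoN_psum [IsNoetherianRing R]
    (hM : ∀ j < m, IsCoverModule Y j (maxPrimes Y j) (M j)) {i : ℕ} (hi : m ≤ i) :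
    Subsingleton (mhoN i (psum M m)) := by
  induction m with
  | zero =>
    induction i, hi using Nat.le_induction with
    | base => exact inferInstanceAs (Subsingleton PUnit)
    | succ i _ ih => exact subsingleton_mho injective_of_subsingleton
  | succ m ih =>
    obtain ⟨e⟩ := mhoN_prod_equiv (psum M m) (M m) i
    have := ih (fun j hj => hM j (by omega)) (by omega)
    have := (hM m m.lt_succ_self).subsingleton_mhoN hi
    exact e.injective.subsingleton

/-- In cosyzygy `i`, only C_{S_i} contributes an injective part: summands of smaller index have
vanished and those of larger index are still reduced. -/
theorem mhoN_psum_equiv [IsNoetherianRing R]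
    (hM : ∀ j < m, IsCoverModule Y j (maxPrimes Y j) (M j)) {i : ℕ} (hi : i < m) :
    ∃ K Z : ModuleCat.{u} R, IsSumOfHulls (fun p : maxPrimes Y i => (p : PrimeSpectrum R)) K ∧
      Red Z ∧ Nonempty (mhoN i (psum M m) ≃ₗ[R] K × Z) := by
  induction m with
  | zero => omega
  | succ m ih =>
    obtain ⟨e⟩ := mhoN_prod_equiv (psum M m) (M m) i
    have hM' := fun j hj => hM j (Nat.lt_succ_of_lt hj)
    obtain ⟨K', hK', -, ⟨e'⟩, hred⟩ := (hM m m.lt_succ_self).mhoN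
    obtain rfl | hi := Nat.eq_or_lt_of_le (Nat.le_of_lt_succ hi)
    · exact ⟨K', _, hK', Red.of_subsingleton (subsingleton_mhoN_psum hM' le_rfl),
        ⟨(e.trans (LinearEquiv.prodComm R _ _)).trans (e'.prodCongr (LinearEquiv.refl R _))⟩⟩
    · obtain ⟨K, Z, hK, hZ, ⟨e₁⟩⟩ := ih hM' hi
      exact ⟨K, ModuleCat.of R (Z × mhoN i (M m)), hK, hZ.prod (hred i hi),
        ⟨(e.trans (e₁.prodCongr (LinearEquiv.refl R _))).trans (LinearEquiv.prodAssoc R _ _ _)⟩⟩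

/-- Split off the summand of largest index first. Its cosyzygies below that index are reduced, so
the complement keeps the hulls needed for the smaller indices. -/
theorem isSummand_psum [IsNoetherianRing R] (hY : Good Y)
    (hM : ∀ j < m, IsCoverModule Y j (maxPrimes Y j) (M j)) {D : ModuleCat.{u} R} (hD : CcA Y D)
    (hDperp : QPerp Y D) (h : ∀ j < m, HasHulls Y D j) : IsSummand (psum M m) D := by
  induction m generalizing D with
  | zero =>
    exact ⟨0, 0, LinearMap.ext fun _ => Subsingleton.elim (α := PUnit) _ _⟩
  | succ m ih =>
    obtain ⟨K, hK, hMK, -, hred⟩ := (hM m m.lt_succ_self).mhoN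
    obtain ⟨D', ⟨e⟩⟩ :=
      (hMK.isSummand hY hD hDperp ((h m m.lt_succ_self).isSummand hK)).exists_compl
    have hD' : IsSummand D' D :=
      (isSummand_snd (M m) D').trans (isSummand_of_equiv (X := ModuleCat.of R (M m × D')) e.symm)
    have := ih (fun j hj => hM j (by omega)) (hD.of_isSummand hD') (hDperp.of_isSummand hD')
      fun j hj => (h j (by omega)).of_red e (hred j hj)
    exact (isSummand_prod this (IsSummand.refl (M m))).trans
      (isSummand_of_equiv (X := ModuleCat.of R (D' × M m))
        ((LinearEquiv.prodComm R D' (M m)).trans e.symm))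

/-- A finite sum of the modules `C_{S_j}` has no proper direct summand isomorphic to itself. -/
theorem subsingleton_of_psum_equiv [IsNoetherianRing R]
    (hM : ∀ j < m, IsCoverModule Y j (maxPrimes Y j) (M j)) (e : psum M m ≃ₗ[R] psum M m × X) :
    Subsingleton X := by
  have he : ∀ i, Nonempty (mhoN i (psum M m) ≃ₗ[R] mhoN i (psum M m) × mhoN i X) := fun i => by
    obtain ⟨e₁⟩ := mhoN_equiv (N := ModuleCat.of R (psum M m × X)) e i
    obtain ⟨e₂⟩ := mhoN_prod_equiv (psum M m) X i
    exact ⟨e₁.trans e₂⟩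
  -- Downward induction on `i`: once the next cosyzygy of `X` vanishes, the present one is
  -- injective. Together with `K` it embeds in `K ⊕ Z`, hence in `K` because `Z` is reduced, and the
  -- antichain leaves no room for it.
  have key : ∀ k i, i + k = m → Subsingleton (mhoN i X) := by
    intro k
    induction k with
    | zero =>
      intro i hi
      obtain ⟨e'⟩ := he i
      have := subsingleton_mhoN_psum hM (i := i) (by omega)
      have := e'.symm.injective.subsingleton
      exact (LinearMap.inr_injective (R := R) (M := mhoN i (psum M m))).subsingleton
    | succ k ih =>
      intro i hi
      have hinj : Module.Injective R (mhoN i X) :=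
        injective_of_subsingleton_mho (ih (i + 1) (by omega))
      obtain ⟨e'⟩ := he i
      obtain ⟨K, Z, hK, hZ, ⟨e''⟩⟩ := mhoN_psum_equiv hM (i := i) (by omega)
      let g : (K × mhoN i X) →ₗ[R] K × Z := e''.toLinearMap ∘ₗ e'.symm.toLinearMap ∘ₗ
        (e''.symm.toLinearMap ∘ₗ LinearMap.inl R K Z).prodMap LinearMap.id
      have hg : Function.Injective g := e''.injective.comp (e'.symm.injective.comp
        (Function.Injective.prodMap (e''.symm.injective.comp LinearMap.inl_injective)
          Function.injective_id))
      exact subsingleton_of_prod_embedding (isAntichain_maxPrimes Y i) hK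
        (LinearMap.fst R K Z ∘ₗ g) (hZ.injective_of_jointly
          (F := ModuleCat.of R (K × mhoN i X)) (injective_prod hK.injective hinj) _
          (LinearMap.snd R K Z ∘ₗ g) fun z h1 h2 => (map_eq_zero_iff g hg).1 (Prod.ext h1 h2))
  exact key m 0 (zero_add m)

end FiniteSums

/-! ### The main theorem -/

section Main

variable {R : Type u} [CommRing R] {Y : ℕ → Set (PrimeSpectrum R)} {n : ℕ}
  {M : ℕ → ModuleCat.{u} R} {C D X : ModuleCat.{u} R}

theorem isSummand_pi {ι : Type u} (X : ι → ModuleCat.{u} R) (i : ι) :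
    IsSummand (X i) (ModuleCat.of R (∀ i, X i)) := by
  classical
  exact ⟨LinearMap.single R (fun i => X i) i, LinearMap.proj i, LinearMap.proj_comp_single_same ..⟩

theorem isNCotilting_of_equiv [IsNoetherianRing R] (hY : IsCotiltSequence n Y)
    (hM : ∀ j < n + 1, IsCoverModule Y j (maxPrimes Y j) (M j))
    (e : C ≃ₗ[R] ∀ j : Fin (n + 1), M j) : IsNCotilting n C ∧ CcA Y C ∧ QPerp Y C := by
  -- The index set is lifted to the universe in which the product lemmas are stated.
  let M' : ULift.{u} (Fin (n + 1)) → ModuleCat.{u} R := fun j => M j.down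
  have hM' : ∀ j, IsCoverModule Y j.down (maxPrimes Y j.down) (M' j) :=
    fun j => hM _ j.down.isLt
  have e' : C ≃ₗ[R] ∀ j, M' j :=
    e.trans (LinearEquiv.piCongrLeft R (fun j : Fin (n + 1) => M j) Equiv.ulift).symm
  have hs : IsSummand C (ModuleCat.of R (∀ j, M' j)) := isSummand_of_equiv e'
  have hc : CcA Y C := (CcA.pi hY.generalization fun j => (hM' j).ccA).of_isSummand hs
  have hq : QPerp Y C := fun N hN =>
    (leftPerp_pi fun j => (hM' j).qPerp hY.mono N hN).of_isSummand_right hs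
  have hdim : HasInjectiveDimensionLE C n := by
    refine HasInjectiveDimensionLT.mk fun i hi N => ?_
    obtain ⟨i, rfl⟩ := Nat.exists_eq_add_of_le' (show 1 ≤ i by omega)
    exact extZero_iff.1 ((extZero_pi i M' fun j =>
      (hM' j).extZero N (by have := j.down.isLt; omega)).of_isSummand_right hs)
  have hC : ∀ κ : Type u, LeftPerp C (ModuleCat.of R (κ → C)) := fun κ =>
    hq _ (CcA.pi (X := fun _ : κ => C) hY.generalization fun _ => hc)
  refine ⟨⟨⟨⟨n, hdim⟩, hC, ?_⟩, hdim⟩, hc, hq⟩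
  obtain ⟨W, hW⟩ :=
    exists_sumOfHulls fun p : (Set.univ : Set (PrimeSpectrum R)) => (p : PrimeSpectrum R)
  obtain ⟨r, hr⟩ := res_of_injClass hC hY.generalization (n := n)
    (fun j hj => ⟨M j, hM j (by omega), (isSummand_pi M' ⟨⟨j, by omega⟩⟩).trans
      (isSummand_of_equiv (X := ModuleCat.of R (∀ j, M' j)) e'.symm)⟩) n le_rfl W
    (injClass_iff.2 ⟨hW.injective, hW.assIn fun p => by rw [hY.top]; trivial⟩)
  exact ⟨r, W, hW.injective, hW.isCoseparator, hr⟩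

theorem main_of_nat_indexed [IsNoetherianRing R] (hY : IsCotiltSequence n Y)
    (hM : ∀ j < n + 1, IsCoverModule Y j (maxPrimes Y j) (M j))
    (e : C ≃ₗ[R] ∀ j : Fin (n + 1), M j) :
    IsNCotilting n C ∧ LeftPerp C = CotiltClass Y ∧ IsMinimalCotilting C ∧
      ∀ D : ModuleCat.{u} R, IsMinimalCotilting D → LeftPerp D = CotiltClass Y →
        Nonempty (D ≃ₗ[R] C) := by
  obtain ⟨hC, hc, hq⟩ := isNCotilting_of_equiv hY hM e
  obtain ⟨e₀⟩ := pi_equiv_psum M (n + 1)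
  have e₀ : C ≃ₗ[R] psum M (n + 1) := e.trans e₀
  have hperp : LeftPerp C = CotiltClass Y := funext fun X => propext
    ⟨fun h => cotiltClass_iff.2 (hC.1.ccA hY.mono hY.generalization hc h),
      fun h => hq X (cotiltClass_iff.1 h)⟩
  have hsummand : ∀ D, IsCotilting D → LeftPerp D = CotiltClass Y → IsSummand C D := by
    intro D hD hDY
    have hDY : ∀ N, LeftPerp D N ↔ CcA Y N := fun N => by rw [hDY, cotiltClass_iff]
    have hDc := (hDY D).1 hD.self_leftPerp
    refine (isSummand_of_equiv e₀).trans (isSummand_psum hY.good hM hDc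
      (fun N hN => (hDY N).2 hN) fun j hj => ?_)
    -- A module lying both in ^⊥D and in its right orthogonal class belongs to Prod D.
    exact (hM j hj).hasHulls hY.generalization hDc (hD.inProd ((hDY _).2 (hM j hj).ccA)
      fun N hN => (hM j hj).qPerp hY.mono N ((hDY N).1 hN))
  refine ⟨hC, hperp, ⟨hC.1, fun D hD h => hsummand D hD (h.trans hperp)⟩, fun D hD hDY => ?_⟩
  obtain ⟨X, ⟨a⟩⟩ := (hD.2 C hC.1 (hperp.trans hDY.symm)).exists_compl
  obtain ⟨X', ⟨b⟩⟩ := (hsummand D hD.1 hDY).exists_compl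
  -- From C ≅ D ⊕ X and D ≅ C ⊕ X' one gets C ≅ C ⊕ (X' ⊕ X), so cancellation kills both
  -- complements.
  have : Subsingleton (X' × X) := subsingleton_of_psum_equiv (X := ModuleCat.of R (X' × X)) hM
    (e₀.symm.trans (a.trans ((b.prodCongr (LinearEquiv.refl R X)).trans
      ((LinearEquiv.prodAssoc R C X' X).trans (e₀.prodCongr (LinearEquiv.refl R (X' × X)))))))
  have : Subsingleton X' :=
    (LinearMap.inl_injective (R := R) (M := X') (M₂ := X)).subsingleton
  have : Unique X' := uniqueOfSubsingleton 0
  exact ⟨b.trans LinearEquiv.prodUnique⟩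

end Main

end MinCotilt

theorem mainTheorem2 {R : Type u} [CommRing R] [IsNoetherianRing R] (n : ℕ)
    (Y : ℕ → Set (PrimeSpectrum R)) (hY : MinCotilt.IsCotiltSequence n Y) :
    (∀ j : Fin (n + 1), ∃ M : ModuleCat.{u} R,
      MinCotilt.IsCoverModule Y j (MinCotilt.maxPrimes Y j) M) ∧
    ∀ M : Fin (n + 1) → ModuleCat.{u} R,
      (∀ j : Fin (n + 1), MinCotilt.IsCoverModule Y j (MinCotilt.maxPrimes Y j) (M j)) →
      ∀ C : ModuleCat.{u} R, Nonempty (C ≃ₗ[R] DirectSum (Fin (n + 1)) fun j => M j) →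
        MinCotilt.IsNCotilting n C ∧
        MinCotilt.LeftPerp C = MinCotilt.CotiltClass Y ∧
        MinCotilt.IsMinimalCotilting C ∧
        ∀ D : ModuleCat.{u} R, MinCotilt.IsMinimalCotilting D →
          MinCotilt.LeftPerp D = MinCotilt.CotiltClass Y → Nonempty (D ≃ₗ[R] C) := by
  refine ⟨fun j => MinCotilt.exists_isCoverModule hY.good j, fun M hM C ⟨e⟩ => ?_⟩
  -- The finite family is extended to ℕ by reducing indices modulo `n + 1`; values beyond `n` play
  -- no role.
  obtain ⟨N, rfl⟩ : ∃ N : ℕ → ModuleCat.{u} R, M = fun j : Fin (n + 1) => N j :=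
    ⟨fun k => M (Fin.ofNat (n + 1) k), funext fun j => congrArg M (Fin.ofNat_val_eq_self j).symm⟩
  exact MinCotilt.main_of_nat_indexed hY (fun j hj => hM ⟨j, hj⟩)
    (e.trans (DirectSum.linearEquivFunOnFintype R (Fin (n + 1)) fun j => N j))
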